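/- Let $\hat{\mathcal T}_0$ be a conforming triangulation, by finitely many triangles, of a bounded open set $D\subset\mathbb R^2$ (the interior of their union), with an admissible edge labelling: each edge is labelled $0$ or $1$, and each triangle has exactly two edges labelled $1$ and one labelled $0$. Newest vertex bisection of a triangle with labels $(i,i,i-1)$ bisects the edge labelled $i-1$ and gives the label $i+1$ to both of its halves and to the bisecting edge. A mesh $\mathcal T'$ is a refinement of $\mathcal T$ (it is larger) if it arises from $\mathcal T$ by finitely many such bisections. For a conforming refinement $\mathcal T$ of $\hat{\mathcal T}_0$, let $V(\mathcal T)$ be the space of continuous functions that vanish outside $D$ and are affine on each element of $\mathcal T$. Let $\hat{\mathcal T}_{j+1}$ arise from $\hat{\mathcal T}_j$ by bisecting all triangles twice in succession. Let $\Theta$ be the set of all $\lambda=(j,z)$ with $j\ge0$ and $z$ a vertex of $\hat{\mathcal T}_j$ in $D$; put $|\lambda|=j$, and let $\psi_\lambda$ be the hat function of $z$ on $\hat{\mathcal T}_j$, normalized by $\|\nabla\psi_\lambda\|_{L_2(D)}=1$. Let $\mathcal F$ be the set of finitely supported families $\nu=(\nu_\mu)_{\mu\in\mathcal M}$ of natural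 numbers over an index set $\mathcal M$. Let $\Lambda\subset\mathcal F\times\Theta$ be finite and tree-structured with respect to a choice of parents: if $(\nu,\lambda)\in\Lambda$ and $|\lambda|>0$, then $(\nu,\lambda')\in\Lambda$ for the chosen parent $\lambda'$ of $\lambda$, where $|\lambda|=|\lambda'|+1$ and $\operatorname{supp}\psi_\lambda\cap\operatorname{supp}\psi_{\lambda'}$ has positive area. Let $\Theta_\nu=\{\lambda:(\nu,\lambda)\in\Lambda\}$ and $F=\{\nu:\Theta_\nu\neq\emptyset\}$. Then there are a constant $C$ and a program, both depending only on the labelled triangulation $\hat{\mathcal T}_0$, such that for all $\mathcal M$, all such $\Lambda$ and choices of parents, and each $\nu\in F$: there is a smallest conforming refinement $\tilde{\mathcal T}_\nu$ of $\hat{\mathcal T}_0$ with $\operatorname{span}\{\psi_\lambda\}_{\lambda\in\Theta_\nu}\subseteq V(\tilde{\mathcal T}_\nu)$; it satisfies $$\#\tilde{\mathcal T}_\nu\le C\,\#\Theta_\nu ;$$ and the program computes $\tilde{\mathcal T}_\nu$ from $\Theta_\nu$ in at most $C\,\#\Theta_\nu$ operations. Here operations are counted on a random access machine on natural numbers with addition,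 truncated subtraction, halving, tests for zero and indirect addressing at unit cost. The triangles generated from $\hat{\mathcal T}_0$ are numbered as a binary forest: the $m$ triangles of $\hat{\mathcal T}_0$ by $m,\dots,2m-1$, the children of triangle $n$ by $2n$ and $2n+1$. The input lists $\Theta_\nu$ in any order without repetition, with $\lambda=(j,z)$ given by $j$, the number of any triangle of $\hat{\mathcal T}_j$ with vertex $z$, and the position of $z$ among its vertices. The output is a list without repetition of the numbers of the elements of $\tilde{\mathcal T}_\nu$. -/

import Mathlib

open MeasureTheory

/-! ## Triangles and newest vertex bisection -/

/-- Points of the plane, with the Euclidean norm. -/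
abbrev Pt := EuclideanSpace ℝ (Fin 2)

/-- A triangle with ordered vertices. Vertex `0` is the newest vertex, so that the edge joining
vertices `1` and `2` (the one with the lowest label) is the next one to be bisected. -/
abbrev Tri := Fin 3 → Pt

/-- The closed triangle as a point set. -/
def Tri.body (K : Tri) : Set Pt := convexHull ℝ (Set.range K)

/-- Newest vertex bisection: the midpoint of the edge `K 1, K 2` is the newest vertex of both
children, and the two old edges of `K` at vertex `0` become their next edges to be bisected. -/
noncomputable def Tri.bisect (K : Tri) (b : Bool) : Tri :=
  ![midpoint ℝ (K 1) (K 2), K 0, if b then K 2 else K 1]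

/-- A family of triangles is conforming if any two of its members intersect exactly in the convex
hull of their common vertices: not at all, in a common vertex or in a common edge. -/
def ConformingFamily (S : Set Tri) : Prop :=
  ∀ K ∈ S, ∀ L ∈ S, K.body ∩ L.body = convexHull ℝ (Set.range K ∩ Set.range L)

/-- A conforming initial triangulation with an admissible edge labelling: each edge is
labelled `0` or `1`, and each triangle has exactly two edges labelled `1` and one labelled `0`. The
vertices of each triangle are ordered such that vertex `0` lies opposite the edge labelled `0`. -/
structure InitialMesh where
  /-- the number of triangles -/
  size : ℕ
  /-- the triangles -/
  tri : Fin size → Tri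
  nondegenerate : ∀ r, AffineIndependent ℝ (tri r)
  distinct : Function.Injective fun r => Set.range (tri r)
  conforming : ConformingFamily (Set.range tri)
  admissible : ∃ label : Sym2 Pt → ℕ, ∀ r,
    label s(tri r 1, tri r 2) = 0 ∧ label s(tri r 0, tri r 1) = 1 ∧ label s(tri r 0, tri r 2) = 1

namespace InitialMesh

variable (T₀ : InitialMesh)

/-- The open set `D` triangulated by the initial mesh. -/
def domain : Set Pt := interior (⋃ r, (T₀.tri r).body)

/-- The nodes of the infinite binary forest of triangles that arise by newest vertex bisection:
a root together with the sequence of choices of children, the last choice first. -/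
abbrev Elem := Fin T₀.size × List Bool

variable {T₀} in
/-- The two children of an element. -/
def Elem.child (K : T₀.Elem) (b : Bool) : T₀.Elem := (K.1, b :: K.2)

/-- The triangle at a given position of the forest. -/
noncomputable def triAt (r : Fin T₀.size) : List Bool → Tri
  | [] => T₀.tri r
  | b :: p => (triAt r p).bisect b

variable {T₀} in
/-- The triangle of an element. -/
noncomputable def Elem.tri (K : T₀.Elem) : Tri := T₀.triAt K.1 K.2

/-- The initial mesh as a set of elements. -/
def initial : Finset T₀.Elem := Finset.univ.image fun r => (r, [])

/-- One step of newest vertex bisection: an element is replaced by its two children. -/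
def BisectStep (T T' : Finset T₀.Elem) : Prop :=
  ∃ K ∈ T, T' = T.erase K ∪ {K.child false, K.child true}

/-- `T'` is a refinement of `T`: it is generated from `T` by finitely many bisections. -/
def Refines (T T' : Finset T₀.Elem) : Prop := Relation.ReflTransGen T₀.BisectStep T T'

/-- `T` is a conforming triangulation generated from the initial mesh by bisections. -/
def IsConformingMesh (T : Finset T₀.Elem) : Prop :=
  T₀.Refines T₀.initial T ∧ ConformingFamily ((fun K : T₀.Elem => K.tri) '' (T : Set T₀.Elem))

/-- The standard Lagrange finite element space on a (conforming) mesh: the continuous functions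
vanishing outside `D` that are affine on each element. -/
def feSpace (T : Finset T₀.Elem) : Submodule ℝ (Pt → ℝ) where
  carrier := {v | Continuous v ∧ (∀ x ∉ T₀.domain, v x = 0) ∧
    ∀ K ∈ T, ∃ A : Pt →ᵃ[ℝ] ℝ, ∀ x ∈ K.tri.body, v x = A x}
  zero_mem' := ⟨continuous_const, fun _ _ => rfl, fun _ _ => ⟨0, fun _ _ => rfl⟩⟩
  add_mem' := by
    rintro v w ⟨hv, hv0, hvA⟩ ⟨hw, hw0, hwA⟩
    refine ⟨hv.add hw, fun x hx => by simp [hv0 x hx, hw0 x hx], fun K hK => ?_⟩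
    obtain ⟨A, hA⟩ := hvA K hK
    obtain ⟨B, hB⟩ := hwA K hK
    exact ⟨A + B, fun x hx => by simp [hA x hx, hB x hx]⟩
  smul_mem' := by
    rintro c v ⟨hv, hv0, hvA⟩
    refine ⟨hv.const_smul c, fun x hx => by simp [hv0 x hx], fun K hK => ?_⟩
    obtain ⟨A, hA⟩ := hvA K hK
    exact ⟨c • A, fun x hx => by simp [hA x hx]⟩

/-! ## The frame of hat functions on the uniform mesh hierarchy -/

/-- One pass of newest vertex bisection over the full mesh. -/
def refineAll (T : Finset T₀.Elem) : Finset T₀.Elem :=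
  T.biUnion fun K => {K.child false, K.child true}

/-- The uniform mesh of level `j`: two passes of bisection per level. -/
def uniform : ℕ → Finset T₀.Elem
  | 0 => T₀.initial
  | j + 1 => T₀.refineAll (T₀.refineAll (uniform j))

/-- The vertices of the uniform mesh of level `j` that are interior to `D`. -/
def interiorNodes (j : ℕ) : Set Pt :=
  {z | z ∈ T₀.domain ∧ ∃ K ∈ T₀.uniform j, z ∈ Set.range K.tri}

end InitialMesh

/-- The signed area of the parallelogram spanned by two plane vectors. -/
def cross (u v : Pt) : ℝ := u 0 * v 1 - u 1 * v 0

/-- The barycentric coordinate of `x` in the triangle `K` that belongs to vertex `i`. -/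
noncomputable def Tri.bary (K : Tri) (i : Fin 3) (x : Pt) : ℝ :=
  cross (K (i + 1) - x) (K (i + 2) - x) / cross (K (i + 1) - K i) (K (i + 2) - K i)

namespace InitialMesh

variable (T₀ : InitialMesh)

/-- The piecewise affine hat function of the node `z` on the uniform mesh of level `j`. On a
triangle with vertex `z` it is the barycentric coordinate belonging to `z`; the set below has then
exactly one element. It is empty, with `sSup ∅ = 0`, if no triangle containing `x` has vertex
`z`. -/
noncomputable def hat (j : ℕ) (z x : Pt) : ℝ :=
  sSup {t | ∃ K ∈ T₀.uniform j, ∃ i, K.tri i = z ∧ x ∈ K.tri.body ∧ t = K.tri.bary i x}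

/-- The norm of `V = H¹₀(D)`: the `L₂(D)` norm of the gradient. -/
noncomputable def normV (v : Pt → ℝ) : ℝ := Real.sqrt (∫ x in T₀.domain, ‖fderiv ℝ v x‖ ^ 2)

/-- The indices of the frame elements. A hat function of level `j` is indexed by its node. -/
@[ext] structure FrameIndex where
  level : ℕ
  node : Pt
  mem : node ∈ T₀.interiorNodes level

/-- The frame element with index `i`: the hat function normalized in `V`. -/
noncomputable def psi (i : T₀.FrameIndex) : Pt → ℝ :=
  (T₀.normV (T₀.hat i.level i.node))⁻¹ • T₀.hat i.level i.node

/-- `p` may be chosen as the parent of `i`: it lies one level lower and the supports overlap in a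
set of positive area. -/
def IsFrameParent (p i : T₀.FrameIndex) : Prop :=
  i.level = p.level + 1 ∧ 0 < volume (tsupport (T₀.psi i) ∩ tsupport (T₀.psi p))

/-- `Λ` has the tree structure given by the parent map: with each `(ν, i)`, where `i` has positive
level, it contains `(ν, parent i)`. -/
def IsTree {N : Type*} (parent : T₀.FrameIndex → T₀.FrameIndex)
    (Λ : Finset (N × T₀.FrameIndex)) : Prop :=
  ∀ ν i, (ν, i) ∈ Λ → 0 < i.level → (ν, parent i) ∈ Λ ∧ T₀.IsFrameParent (parent i) i

open Classical in
/-- The set `Θ_ν` of all `i` with `(ν, i) ∈ Λ`. -/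
noncomputable def slice {N : Type*} (Λ : Finset (N × T₀.FrameIndex)) (ν : N) :
    Finset T₀.FrameIndex :=
  (Λ.filter fun q => q.1 = ν).image Prod.snd

/-- `T` is a conforming mesh whose finite element space contains the span of the frame elements
with indices in `Θ`. -/
def Resolves (T : Finset T₀.Elem) (Θ : Finset T₀.FrameIndex) : Prop :=
  T₀.IsConformingMesh T ∧
    Submodule.span ℝ (T₀.psi '' (Θ : Set T₀.FrameIndex)) ≤ T₀.feSpace T

/-- `T` is the smallest conforming mesh whose finite element space contains the frame elements
with indices in `Θ`. -/
def IsSmallestMesh (T : Finset T₀.Elem) (Θ : Finset T₀.FrameIndex) : Prop :=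
  T₀.Resolves T Θ ∧ ∀ T', T₀.Resolves T' Θ → T₀.Refines T T'

end InitialMesh

/-! ## A random access machine with unit costs

Programs act on a store of natural numbers with variables and arrays (of which each program uses
finitely many). The operations are addition, truncated subtraction, halving and indirect
addressing, with unit cost each. -/

/-- The memory contents: variables, and arrays with unbounded index range. -/
structure Store where
  var : ℕ → ℕ
  arr : ℕ → ℕ → ℕ

/-- Expressions; `read a e` is the entry of array `a` at position `e`. -/
inductive Expr where
  | const (n : ℕ)
  | var (x : ℕ)
  | read (a : ℕ) (e : Expr)
  | add (e₁ e₂ : Expr)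
  | sub (e₁ e₂ : Expr)
  | half (e : Expr)

/-- The value of an expression. -/
def Expr.eval (σ : Store) : Expr → ℕ
  | .const n => n
  | .var x => σ.var x
  | .read a e => σ.arr a (e.eval σ)
  | .add e₁ e₂ => e₁.eval σ + e₂.eval σ
  | .sub e₁ e₂ => e₁.eval σ - e₂.eval σ
  | .half e => e.eval σ / 2

/-- The number of operations for evaluating an expression. -/
def Expr.cost : Expr → ℕ
  | .const _ => 1
  | .var _ => 1
  | .read _ e => e.cost + 1
  | .add e₁ e₂ => e₁.cost + e₂.cost + 1
  | .sub e₁ e₂ => e₁.cost + e₂.cost + 1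
  | .half e => e.cost + 1

/-- Programs; `write a e₁ e₂` stores the value of `e₂` in array `a` at position `e₁`. -/
inductive Prog where
  | skip
  | assign (x : ℕ) (e : Expr)
  | write (a : ℕ) (e₁ e₂ : Expr)
  | seq (c₁ c₂ : Prog)
  | cond (e : Expr) (c₁ c₂ : Prog)
  | loop (e : Expr) (c : Prog)

/-- `Exec c σ σ' t`: started in the store `σ`, the program `c` terminates in the store `σ'` after
`t` operations. Tests are passed if the value is nonzero. -/
inductive Exec : Prog → Store → Store → ℕ → Prop
  | skip (σ : Store) : Exec .skip σ σ 1
  | assign (σ : Store) (x : ℕ) (e : Expr) :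
      Exec (.assign x e) σ { σ with var := Function.update σ.var x (e.eval σ) } (e.cost + 1)
  | write (σ : Store) (a : ℕ) (e₁ e₂ : Expr) :
      Exec (.write a e₁ e₂) σ
        { σ with
          arr := Function.update σ.arr a (Function.update (σ.arr a) (e₁.eval σ) (e₂.eval σ)) }
        (e₁.cost + e₂.cost + 1)
  | seq {c₁ c₂ : Prog} {σ σ₁ σ₂ : Store} {t₁ t₂ : ℕ} (h₁ : Exec c₁ σ σ₁ t₁)
      (h₂ : Exec c₂ σ₁ σ₂ t₂) : Exec (.seq c₁ c₂) σ σ₂ (t₁ + t₂)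
  | cond_true {e : Expr} {c₁ c₂ : Prog} {σ σ₁ : Store} {t : ℕ} (he : e.eval σ ≠ 0)
      (h : Exec c₁ σ σ₁ t) : Exec (.cond e c₁ c₂) σ σ₁ (e.cost + 1 + t)
  | cond_false {e : Expr} {c₁ c₂ : Prog} {σ σ₁ : Store} {t : ℕ} (he : e.eval σ = 0)
      (h : Exec c₂ σ σ₁ t) : Exec (.cond e c₁ c₂) σ σ₁ (e.cost + 1 + t)
  | loop_true {e : Expr} {c : Prog} {σ σ₁ σ₂ : Store} {t₁ t₂ : ℕ} (he : e.eval σ ≠ 0)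
      (h₁ : Exec c σ σ₁ t₁) (h₂ : Exec (.loop e c) σ₁ σ₂ t₂) :
      Exec (.loop e c) σ σ₂ (e.cost + 1 + t₁ + t₂)
  | loop_false {e : Expr} {c : Prog} {σ : Store} (he : e.eval σ = 0) :
      Exec (.loop e c) σ σ (e.cost + 1)

/-- The store with input `L`: its length is in variable `0`, the `k`-th triple is in position `k` of
the arrays `0`, `1`, `2`, and everything else is `0`. -/
def inputStore (L : List (ℕ × ℕ × ℕ)) : Store where
  var x := if x = 0 then L.length else 0
  arr a k :=
    if a = 0 then (L.getD k (0, 0, 0)).1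
    else if a = 1 then (L.getD k (0, 0, 0)).2.1
    else if a = 2 then (L.getD k (0, 0, 0)).2.2
    else 0

namespace InitialMesh

variable (T₀ : InitialMesh)

/-- The number that represents an element of the forest: the roots have the numbers
`size, …, 2 * size - 1`, and the children of the element `n` have the numbers `2 * n` and
`2 * n + 1`. -/
def codeAt (r : Fin T₀.size) : List Bool → ℕ
  | [] => T₀.size + r
  | b :: p => 2 * codeAt r p + b.toNat

variable {T₀} in
/-- The number that represents an element. -/
def Elem.code (K : T₀.Elem) : ℕ := T₀.codeAt K.1 K.2

/-- The triple `q` represents the index `i`: it consists of the level, of (the number of) an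
element of the uniform mesh of this level that has the node of `i` as a vertex, and of the local
number of this vertex. -/
def Represents (i : T₀.FrameIndex) (q : ℕ × ℕ × ℕ) : Prop :=
  q.1 = i.level ∧ ∃ K ∈ T₀.uniform i.level, ∃ k : Fin 3,
    K.tri k = i.node ∧ q.2.1 = K.code ∧ q.2.2 = k

/-- The list `L` represents the set `Θ`: it lists, in some order and without repetition,
representations of the elements of `Θ`. -/
def IsInput (Θ : Finset T₀.FrameIndex) (L : List (ℕ × ℕ × ℕ)) : Prop :=
  ∃ l : List T₀.FrameIndex, l.Nodup ∧ (∀ i, i ∈ l ↔ i ∈ Θ) ∧ List.Forall₂ T₀.Represents l L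

/-- The store contains the mesh `T` as output: the number of elements is in variable `0`, and array
`0` lists the elements, in some order and without repetition. -/
def IsOutput (T : Finset T₀.Elem) (σ : Store) : Prop :=
  ∃ l : List T₀.Elem, l.Nodup ∧ (∀ K, K ∈ l ↔ K ∈ T) ∧ σ.var 0 = l.length ∧
    ∀ (k : ℕ) (hk : k < l.length), σ.arr 0 k = l[k].code

end InitialMesh

/-!
The mesh `T̃` and the program both come from one description: a refinement of the initial mesh is
the set of leaves of a finite parent-closed set `B` of bisected elements of the forest
(`InitialMesh.leaves`).

*The smallest mesh.* Since the initial labelling is admissible, any two elements of the same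
generation meet in the convex hull of their common vertices. Hence a refinement is conforming if
and only if `B` is also closed under passing to the neighbour across the refinement edge
(`isConformingMesh_iff`). By the same structure, `psi i` belongs to the finite element space if and
only if certain elements near the node of `i` are bisected (`Requires`, `hat_mem_feSpace_iff`): the
parents of the triangles of level `j` with vertex `z`, or their grandparents if `z` is the newest
vertex of the parent. So the smallest mesh exists and belongs to the closure of the required
elements under parents and neighbours (`Needed`, `isSmallestMesh_leaves`).

*Its size.* A needed element of generation `g`, or its neighbour, is near a node in `Θ` of level
`g / 2 + 1`, up to a multiple of the diameter of elements of generation `g` (`near_of_needed`).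
Going to the parent of an element of even generation, one passes to the parent of the node, which
belongs to `Θ` by the tree structure and is near because the supports overlap. The distances add up
in each step, but the scale grows geometrically, so that they stay bounded by a fixed multiple of
the scale. As an area argument shows (`exists_card_near_le`), only boundedly many elements of one
generation are near a given point. Thus the number of needed elements is at most a multiple of
`Θ.card` (`exists_card_needed_le`).

*The program.* It computes `B` as the list of bisected elements, starting from the empty list. To
bisect an element, `Prog.close` keeps a stack of elements that have to be bisected: a parent that is
not bisected yet is pushed, and after the bisection of an element its neighbour across the
refinement edge takes its place. Each step lowers a potential (`Closing.closeStep`), so that the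
number of steps is at most four times the number of new elements, plus one. For the navigation two
arrays hold the numbers of the neighbours of an element; those of the children are computed from
those of the element when this is bisected (`Core.bisectTop`).
For an item of the input one required element is an ancestor of the given triangle. If the node is
vertex `0` or `1` of the triangle, the only other one is the neighbour of this ancestor across its
refinement edge. Otherwise the required elements are all elements of one generation around the node;
they are reached by alternately crossing the refinement edge and another edge at the node
(`exists_walk_eq`), in a number of steps that is bounded in terms of the initial mesh. That a walk
around an interior vertex reaches all elements there rests on a connectedness argument
(`star_connected`). The vertices of an element are ordered consistently with those of its neighbours
from generation two on only; the finitely many cases of lower generations are tabulated. Apart from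
a bounded number per item, all operations are paid for by newly bisected elements (`Grows`).
-/

/-! ### Barycentric coordinates -/

/-- The signed area of the parallelogram spanned by a triangle. -/
def Tri.det (K : Tri) : ℝ := cross (K 1 - K 0) (K 2 - K 0)

namespace Tri

lemma det_ne_zero_of_affineIndependent {K : Tri} (h : AffineIndependent ℝ K) : K.det ≠ 0 := by
  intro h0
  have hc : (K 1 - K 0) 0 * (K 2 - K 0) 1 - (K 1 - K 0) 1 * (K 2 - K 0) 0 = 0 := h0
  simp only [PiLp.sub_apply] at hc
  have key : ∀ a b : ℝ, a • (K 1 - K 0) + b • (K 2 - K 0) = 0 → a = 0 ∧ b = 0 := by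
    intro a b hab
    rw [affineIndependent_iff] at h
    have := h Finset.univ ![-(a + b), a, b] (by simp [Fin.sum_univ_three]) (by
      rw [← hab]; simp [Fin.sum_univ_three]; module)
    exact ⟨by simpa using this 1 (by simp), by simpa using this 2 (by simp)⟩
  have e1 := key ((K 2) 1 - (K 0) 1) (-((K 1) 1 - (K 0) 1)) (by
    ext t; fin_cases t <;> simp <;> linarith)
  have e2 := key ((K 2) 0 - (K 0) 0) (-((K 1) 0 - (K 0) 0)) (by
    ext t; fin_cases t <;> simp <;> linarith)
  have e3 := key 0 1 (by
    ext t; fin_cases t <;> simp <;> linarith [e1.1, e2.1])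
  exact one_ne_zero e3.2

lemma bary_eq (K : Tri) (i : Fin 3) (x : Pt) :
    K.bary i x = cross (K (i + 1) - x) (K (i + 2) - x) / K.det := by
  have : cross (K (i + 1) - K i) (K (i + 2) - K i) = K.det := by
    fin_cases i <;> simp [det, cross] <;> ring
  rw [bary, this]

/-- The barycentric coordinate as an affine map. -/
noncomputable def baryMap (K : Tri) (i : Fin 3) : Pt →ᵃ[ℝ] ℝ where
  toFun := K.bary i
  linear :=
    { toFun := fun v => cross (K (i + 2) - K (i + 1)) v / K.det
      map_add' := fun v w => by simp [cross]; ring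
      map_smul' := fun c v => by simp [cross]; ring }
  map_vadd' p v := by simp [bary_eq, cross]; ring

@[simp] lemma baryMap_apply (K : Tri) (i : Fin 3) (x : Pt) : K.baryMap i x = K.bary i x := rfl

lemma continuous_bary (K : Tri) (i : Fin 3) : Continuous (K.bary i) :=
  (K.baryMap i).continuous_of_finiteDimensional

lemma bary_lineMap (K : Tri) (i : Fin 3) (x y : Pt) (t : ℝ) :
    K.bary i (AffineMap.lineMap x y t) = (1 - t) * K.bary i x + t * K.bary i y := by
  have := AffineMap.apply_lineMap (K.baryMap i) x y t
  simp only [baryMap_apply] at this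
  rw [this, AffineMap.lineMap_apply]; simp; ring

lemma bary_midpoint (K : Tri) (i : Fin 3) (x y : Pt) :
    K.bary i (midpoint ℝ x y) = (K.bary i x + K.bary i y) / 2 := by
  rw [midpoint, bary_lineMap]; simp; ring

variable {K : Tri}

lemma bary_self (h : K.det ≠ 0) (i : Fin 3) : K.bary i (K i) = 1 := by
  rw [bary_eq, div_eq_one_iff_eq h]
  fin_cases i <;> simp [det, cross] <;> ring

lemma bary_vertex_of_ne {i j : Fin 3} (hij : i ≠ j) : K.bary i (K j) = 0 := by
  rw [bary_eq]
  fin_cases i <;> fin_cases j <;> simp [cross] at hij ⊢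

lemma sum_bary (h : K.det ≠ 0) (x : Pt) : ∑ i, K.bary i x = 1 := by
  simp only [Fin.sum_univ_three, bary_eq]
  rw [← add_div, ← add_div, div_eq_one_iff_eq h]
  simp [det, cross]; ring

lemma sum_bary_smul (h : K.det ≠ 0) (x : Pt) : ∑ i, K.bary i x • K i = x := by
  simp only [Fin.sum_univ_three, bary_eq]
  ext t
  have h' := h
  simp [det, cross] at h'
  fin_cases t <;> simp [cross, det] <;> field_simp <;> ring

lemma bary_comp (h : K.det ≠ 0) (L : Tri) (j : Fin 3) (x : Pt) :
    L.bary j x = ∑ k, K.bary k x * L.bary j (K k) := by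
  rw [← baryMap_apply L]
  conv_lhs => rw [← sum_bary_smul h x]
  have := Finset.univ.map_affineCombination K (fun k => K.bary k x) (sum_bary h x) (L.baryMap j)
  rw [Finset.affineCombination_eq_linear_combination _ _ _ (sum_bary h x),
    Finset.affineCombination_eq_linear_combination _ _ _ (sum_bary h x)] at this
  simpa using this

lemma injective (h : K.det ≠ 0) : Function.Injective K := by
  intro i j hij
  by_contra hne
  have := bary_vertex_of_ne (K := K) hne
  rw [← hij, bary_self h] at this
  exact one_ne_zero this

lemma convex_body : Convex ℝ K.body := convex_convexHull ℝ _

lemma vertex_mem_body (i : Fin 3) : K i ∈ K.body := subset_convexHull ℝ _ ⟨i, rfl⟩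

lemma isCompact_body : IsCompact K.body := (Set.finite_range K).isCompact_convexHull ℝ

lemma isClosed_body : IsClosed K.body := (Set.finite_range K).isClosed_convexHull ℝ

/-- The faces of a triangle in barycentric coordinates. -/
lemma mem_convexHull_inter (h : K.det ≠ 0) (S : Set Pt) (x : Pt) :
    x ∈ convexHull ℝ (Set.range K ∩ S) ↔
      (∀ i, 0 ≤ K.bary i x) ∧ ∀ i, K i ∉ S → K.bary i x = 0 := by
  constructor
  · intro hx
    have hconv : Convex ℝ ((⋂ i, (K.baryMap i) ⁻¹' (Set.Ici 0)) ∩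
        ⋂ i, ⋂ (_ : K i ∉ S), (K.baryMap i) ⁻¹' {0}) :=
      (convex_iInter fun i => (convex_Ici 0).affine_preimage _).inter
        (convex_iInter fun i => convex_iInter fun _ => (convex_singleton 0).affine_preimage _)
    have := convexHull_min (s := Set.range K ∩ S) ?_ hconv hx
    · simpa using this
    · rintro _ ⟨⟨j, rfl⟩, hj⟩
      simp only [Set.mem_inter_iff, Set.mem_iInter, Set.mem_preimage, baryMap_apply,
        Set.mem_Ici, Set.mem_singleton_iff]
      refine ⟨fun i => ?_, fun i hi => ?_⟩
      · by_cases hij : i = j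
        · subst hij; rw [bary_self h]; exact zero_le_one
        · rw [bary_vertex_of_ne hij]
      · exact bary_vertex_of_ne (by rintro rfl; exact hi hj)
  · rintro ⟨h0, h1⟩
    classical
    have hs : ∀ i, K.bary i x ≠ 0 → K i ∈ S := fun i hi => by
      by_contra hS; exact hi (h1 i hS)
    rw [← sum_bary_smul h x, ← Finset.sum_filter_of_ne (p := fun i => K.bary i x ≠ 0)
      (by intro i _ hi h'; simp [h'] at hi)]
    refine (convex_convexHull ℝ _).sum_mem (fun i _ => h0 i) ?_ ?_
    · rw [Finset.sum_filter_ne_zero, sum_bary h]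
    · intro i hi
      exact subset_convexHull ℝ _ ⟨⟨i, rfl⟩, hs i (Finset.mem_filter.1 hi).2⟩

lemma mem_body (h : K.det ≠ 0) (x : Pt) : x ∈ K.body ↔ ∀ i, 0 ≤ K.bary i x := by
  have := mem_convexHull_inter h Set.univ x
  simpa [body] using this

lemma bary_le_one (h : K.det ≠ 0) {x : Pt} (hx : x ∈ K.body) (i : Fin 3) : K.bary i x ≤ 1 := by
  rw [← sum_bary h x]
  exact Finset.single_le_sum (f := fun i => K.bary i x)
    (fun j _ => (mem_body h x).1 hx j) (Finset.mem_univ i)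

/-- A point of which one barycentric coordinate is `1` and the others are nonnegative is a
vertex. -/
lemma eq_vertex_of_bary_eq_one (h : K.det ≠ 0) {x : Pt} (hx : x ∈ K.body) {i : Fin 3}
    (hi : K.bary i x = 1) : x = K i := by
  have hs := sum_bary h x
  have h0 := (mem_body h x).1 hx
  have hz : ∀ j, j ≠ i → K.bary j x = 0 := by
    intro j hj
    have := Finset.add_le_sum (f := fun i => K.bary i x) (fun j _ => h0 j)
      (Finset.mem_univ i) (Finset.mem_univ j) hj.symm
    simp only [hs, hi] at this
    linarith [h0 j]
  rw [← sum_bary_smul h x, Finset.sum_eq_single i, hi, one_smul]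
  · intro j _ hj; rw [hz j hj, zero_smul]
  · simp

end Tri

/-- Two triangles intersect in the convex hull of their common vertices. -/
def Meet (K L : Tri) : Prop := K.body ∩ L.body = convexHull ℝ (Set.range K ∩ Set.range L)

lemma Meet.symm {K L : Tri} (h : Meet K L) : Meet L K := by
  unfold Meet at *
  rw [Set.inter_comm, h, Set.inter_comm]

/-- On the intersection of `K` and `L` only the barycentric coordinates belonging to common
vertices are nonzero; this characterizes conformity. -/
lemma meet_iff {K L : Tri} (hK : K.det ≠ 0) :
    Meet K L ↔ ∀ x ∈ K.body, x ∈ L.body → ∀ i, K i ∉ Set.range L → K.bary i x = 0 := by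
  constructor
  · intro h x hxK hxL i hi
    have : x ∈ K.body ∩ L.body := ⟨hxK, hxL⟩
    rw [h, Tri.mem_convexHull_inter hK] at this
    exact this.2 i hi
  · intro h
    apply Set.Subset.antisymm
    · rintro x ⟨hxK, hxL⟩
      rw [Tri.mem_convexHull_inter hK]
      exact ⟨(Tri.mem_body hK x).1 hxK, h x hxK hxL⟩
    · exact Set.subset_inter (convexHull_mono Set.inter_subset_left)
        (convexHull_mono Set.inter_subset_right)

lemma Meet.bary_eq_zero {K L : Tri} (hm : Meet K L) (hK : K.det ≠ 0) {x : Pt} (hxK : x ∈ K.body)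
    (hxL : x ∈ L.body) {i : Fin 3} (hi : K i ∉ Set.range L) : K.bary i x = 0 :=
  (meet_iff hK).1 hm x hxK hxL i hi

lemma Meet.mem_range_of_bary_ne {K L : Tri} (hm : Meet K L) (hK : K.det ≠ 0) {x : Pt}
    (hxK : x ∈ K.body) (hxL : x ∈ L.body) {i : Fin 3} (hi : K.bary i x ≠ 0) :
    K i ∈ Set.range L := by
  by_contra h
  exact hi (hm.bary_eq_zero hK hxK hxL h)

/-- A vertex of one triangle that lies in the other is a vertex of the other. -/
lemma Meet.vertex_mem {K L : Tri} (hm : Meet K L) (hK : K.det ≠ 0) {i : Fin 3}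
    (hi : K i ∈ L.body) : K i ∈ Set.range L :=
  hm.mem_range_of_bary_ne hK (Tri.vertex_mem_body i) hi (by rw [Tri.bary_self hK]; exact one_ne_zero)

/-- The barycentric coordinates of two conforming triangles agree on the intersection. -/
lemma Meet.bary_eq {K L : Tri} (hm : Meet K L) (hK : K.det ≠ 0) (hL : L.det ≠ 0) {x : Pt}
    (hxK : x ∈ K.body) (hxL : x ∈ L.body) {i j : Fin 3} (hij : K i = L j) :
    K.bary i x = L.bary j x := by
  rw [Tri.bary_comp hK L j x, Finset.sum_eq_single i]
  · rw [hij, Tri.bary_self hL, mul_one]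
  · intro k _ hk
    by_cases hkL : K k ∈ Set.range L
    · obtain ⟨l, hl⟩ := hkL
      have hlj : j ≠ l := by
        rintro rfl
        exact hk (Tri.injective hK (hl.symm.trans hij.symm))
      rw [← hl, Tri.bary_vertex_of_ne hlj, mul_zero]
    · rw [hm.bary_eq_zero hK hxK hxL hkL, zero_mul]
  · simp

/-! ### Bisection -/

/-- The position, in its parent, of the old end of the halved edge of the child `b`. -/
def keep (b : Bool) : Fin 3 := if b then 2 else 1

lemma keep_ne_zero (b : Bool) : keep b ≠ 0 := by cases b <;> decide
lemma keep_ne_keep_not (b : Bool) : keep b ≠ keep (!b) := by cases b <;> decide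
lemma eq_keep (b : Bool) (i : Fin 3) : i = 0 ∨ i = keep b ∨ i = keep (!b) := by
  cases b <;> fin_cases i <;> simp [keep]

namespace Tri

variable (K : Tri) (b : Bool)

@[simp] lemma bisect_zero : K.bisect b 0 = midpoint ℝ (K 1) (K 2) := rfl
@[simp] lemma bisect_one : K.bisect b 1 = K 0 := rfl
@[simp] lemma bisect_two : K.bisect b 2 = K (keep b) := by cases b <;> rfl

lemma midpoint_apply (x y : Pt) (t : Fin 2) : (midpoint ℝ x y) t = (x t + y t) / 2 := by
  simp [midpoint_eq_smul_add]; ring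

lemma det_bisect : (K.bisect b).det = if b then -(K.det / 2) else K.det / 2 := by
  cases b <;> simp [det, cross, midpoint_apply, keep] <;> ring

lemma abs_det_bisect : |(K.bisect b).det| = |K.det| / 2 := by
  rw [det_bisect]; cases b <;> simp [abs_div]

variable {K}

lemma det_bisect_ne (h : K.det ≠ 0) : (K.bisect b).det ≠ 0 := by
  rw [det_bisect]; cases b <;> simpa using h

lemma bary_bisect_zero (h : K.det ≠ 0) (x : Pt) :
    (K.bisect b).bary 0 x = 2 * K.bary (keep (!b)) x := by
  have h' : K.det / 2 ≠ 0 := by simpa using h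
  rw [bary_eq, bary_eq, det_bisect]
  cases b
  · simp [cross, keep]; field_simp
  · simp [cross, keep]; field_simp; ring

lemma bary_bisect_one (h : K.det ≠ 0) (x : Pt) :
    (K.bisect b).bary 1 x = K.bary 0 x := by
  have h' : K.det / 2 ≠ 0 := by simpa using h
  rw [bary_eq, bary_eq, det_bisect]
  cases b <;> simp [cross, keep, midpoint_apply] <;> field_simp <;> ring

lemma bary_bisect_two (h : K.det ≠ 0) (x : Pt) :
    (K.bisect b).bary 2 x = K.bary (keep b) x - K.bary (keep (!b)) x := by
  have h' : K.det / 2 ≠ 0 := by simpa using h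
  rw [bary_eq, bary_eq, bary_eq, det_bisect]
  cases b <;> simp [cross, keep, midpoint_apply] <;> field_simp <;> ring

lemma mem_body_bisect (h : K.det ≠ 0) (x : Pt) :
    x ∈ (K.bisect b).body ↔ x ∈ K.body ∧ K.bary (keep (!b)) x ≤ K.bary (keep b) x := by
  rw [mem_body (det_bisect_ne b h), mem_body h, Fin.forall_fin_succ, Fin.forall_fin_two]
  simp only [Fin.succ_zero_eq_one, Fin.succ_one_eq_two, bary_bisect_zero b h, bary_bisect_one b h, bary_bisect_two b h]
  constructor
  · rintro ⟨h0, h1, h2⟩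
    refine ⟨fun i => ?_, by linarith⟩
    rcases eq_keep b i with rfl | rfl | rfl <;> linarith
  · rintro ⟨h0, h1⟩
    exact ⟨by linarith [h0 (keep (!b))], h0 0, by linarith⟩

lemma body_bisect_subset (h : K.det ≠ 0) : (K.bisect b).body ⊆ K.body :=
  fun x hx => ((mem_body_bisect b h x).1 hx).1

lemma exists_mem_body_bisect (h : K.det ≠ 0) {x : Pt} (hx : x ∈ K.body) :
    ∃ b, x ∈ (K.bisect b).body := by
  rcases le_total (K.bary 2 x) (K.bary 1 x) with h1 | h1
  · exact ⟨false, (mem_body_bisect _ h x).2 ⟨hx, h1⟩⟩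
  · exact ⟨true, (mem_body_bisect _ h x).2 ⟨hx, h1⟩⟩

lemma midpoint_mem_body : midpoint ℝ (K 1) (K 2) ∈ K.body :=
  K.convex_body.midpoint_mem (vertex_mem_body 1) (vertex_mem_body 2)

lemma bary_midpoint_keep (h : K.det ≠ 0) : K.bary (keep b) (midpoint ℝ (K 1) (K 2)) = 1 / 2 := by
  rw [bary_midpoint]
  cases b
  · simp [keep, bary_self h, bary_vertex_of_ne]
  · simp [keep, bary_self h, bary_vertex_of_ne]

/-- A vertex of a triangle is a vertex of one of its children. -/
lemma exists_vertex_bisect (i : Fin 3) : ∃ b, K i ∈ Set.range (K.bisect b) := by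
  rcases eq_keep false i with rfl | rfl | rfl
  · exact ⟨false, 1, rfl⟩
  · exact ⟨false, 2, by simp⟩
  · exact ⟨true, 2, by simp⟩

end Tri

/-! ### Conformity is preserved by bisecting all triangles -/

/-- Compatibility of refinement edges: if the refinement edge of `K` is an edge of `L`, then it is
the refinement edge of `L`. -/
def Compat (K L : Tri) : Prop :=
  K 1 ∈ Set.range L → K 2 ∈ Set.range L → L 0 ≠ K 1 ∧ L 0 ≠ K 2

lemma fin_three_cases (i : Fin 3) : i = 0 ∨ i = 1 ∨ i = 2 := by fin_cases i <;> simp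

lemma fin_three_cases_add (k i : Fin 3) : i = k ∨ i = k + 1 ∨ i = k + 2 := by
  revert k i; decide

lemma fin_three_add_ne (k : Fin 3) : k + 1 ≠ k + 2 ∧ k ≠ k + 1 ∧ k ≠ k + 2 := by
  revert k; decide

section Step

variable {K L : Tri}

lemma Compat.pair (hc : Compat K L) (hK : K.det ≠ 0) (h1 : K 1 ∈ Set.range L)
    (h2 : K 2 ∈ Set.range L) : (L 1 = K 1 ∧ L 2 = K 2) ∨ (L 1 = K 2 ∧ L 2 = K 1) := by
  obtain ⟨c1, c2⟩ := hc h1 h2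
  have hne : K 1 ≠ K 2 := fun h => by have := Tri.injective hK h; simp at this
  obtain ⟨i, hi⟩ := h1
  obtain ⟨j, hj⟩ := h2
  rcases fin_three_cases i with rfl | rfl | rfl <;> rcases fin_three_cases j with rfl | rfl | rfl <;>
    simp_all

lemma Compat.midpoint_eq (hc : Compat K L) (hK : K.det ≠ 0) (h1 : K 1 ∈ Set.range L)
    (h2 : K 2 ∈ Set.range L) : midpoint ℝ (L 1) (L 2) = midpoint ℝ (K 1) (K 2) := by
  rcases hc.pair hK h1 h2 with ⟨e1, e2⟩ | ⟨e1, e2⟩ <;> rw [e1, e2]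
  exact midpoint_comm _ _

/-- The midpoint of the refinement edge of `K` is in `L` only if this edge is an edge of `L`. -/
lemma Meet.edge_of_midpoint (hm : Meet K L) (hK : K.det ≠ 0)
    (h : midpoint ℝ (K 1) (K 2) ∈ L.body) (b : Bool) : K (keep b) ∈ Set.range L := by
  refine hm.mem_range_of_bary_ne hK K.midpoint_mem_body h ?_
  rw [Tri.bary_midpoint_keep b hK]; norm_num

lemma Meet.midpoint_ne_vertex (hm : Meet K L) (hK : K.det ≠ 0) (hL : L.det ≠ 0) (i : Fin 3) :
    midpoint ℝ (K 1) (K 2) ≠ L i := by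
  intro h
  obtain ⟨j, hj⟩ := hm.symm.vertex_mem hL (i := i) (h ▸ K.midpoint_mem_body)
  have h2 := Tri.bary_midpoint_keep false hK
  rw [h, ← hj] at h2
  by_cases hj1 : keep false = j
  · rw [hj1, Tri.bary_self hK] at h2; norm_num at h2
  · rw [Tri.bary_vertex_of_ne hj1] at h2; norm_num at h2

lemma Meet.refl (K : Tri) : Meet K K := by simp [Meet, Tri.body]

lemma keep_eq_of_mem_range_bisect (hK : K.det ≠ 0) {b b' : Bool}
    (h : K (keep b) ∈ Set.range (K.bisect b')) : b = b' := by
  obtain ⟨i, hi⟩ := h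
  rcases fin_three_cases i with rfl | rfl | rfl
  · exact absurd hi ((Meet.refl K).midpoint_ne_vertex hK hK _)
  · exact absurd (Tri.injective hK hi).symm (keep_ne_zero b)
  · have := Tri.injective hK ((K.bisect_two b').symm.trans hi)
    revert this; cases b <;> cases b' <;> simp [keep]

lemma forall_keep {p : Fin 3 → Prop} (b : Bool) (h1 : p (keep b)) (h2 : p (keep (!b))) :
    p 1 ∧ p 2 := by cases b <;> simp_all [keep]

/-- Bisecting two conforming triangles with compatible refinement edges gives conforming
children. -/
lemma Meet.bisect (hm : Meet K L) (hK : K.det ≠ 0) (hL : L.det ≠ 0) (hc : Compat K L)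
    (hc' : Compat L K) (b b' : Bool) : Meet (K.bisect b) (L.bisect b') := by
  rw [meet_iff (Tri.det_bisect_ne b hK)]
  intro x hx hx' i hi
  obtain ⟨hxK, hle⟩ := (Tri.mem_body_bisect b hK x).1 hx
  obtain ⟨hxL, hle'⟩ := (Tri.mem_body_bisect b' hL x).1 hx'
  have pK := (Tri.mem_body hK x).1 hxK
  have pL := (Tri.mem_body hL x).1 hxL
  -- a vertex of `K` that is dropped by the child of `L`
  have drop : ∀ k, K k ∉ Set.range (L.bisect b') → K.bary k x ≠ 0 →
      K k = L (keep (!b')) ∧ L 1 ∈ Set.range K ∧ L 2 ∈ Set.range K ∧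
        K.bary k x ≤ L.bary (keep b') x := by
    intro k hk hne
    obtain ⟨l, hl⟩ := hm.mem_range_of_bary_ne hK hxK hxL hne
    rcases eq_keep b' l with rfl | rfl | rfl
    · exact absurd ⟨1, hl⟩ hk
    · exact absurd ⟨2, by simpa using hl⟩ hk
    · have hb := hm.bary_eq hK hL hxK hxL hl.symm
      have hpos : 0 < L.bary (keep (!b')) x := by
        rw [← hb]; exact lt_of_le_of_ne (pK k) hne.symm
      have h12 := forall_keep (p := fun i => L i ∈ Set.range K) b'
        (hm.symm.mem_range_of_bary_ne hL hxL hxK (by linarith))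
        (hm.symm.mem_range_of_bary_ne hL hxL hxK hpos.ne')
      exact ⟨hl.symm, h12.1, h12.2, by rw [hb]; exact hle'⟩
  rcases fin_three_cases i with rfl | rfl | rfl
  · rw [Tri.bary_bisect_zero b hK]
    by_contra hne
    have hpos : 0 < K.bary (keep (!b)) x :=
      lt_of_le_of_ne (pK _) (fun h => hne (by rw [← h, mul_zero]))
    have h12 := forall_keep (p := fun i => K i ∈ Set.range L) b
      (hm.mem_range_of_bary_ne hK hxK hxL (by linarith))
      (hm.mem_range_of_bary_ne hK hxK hxL hpos.ne')
    exact hi ⟨0, hc.midpoint_eq hK h12.1 h12.2⟩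
  · show (K.bisect b).bary 1 x = 0
    rw [Tri.bary_bisect_one b hK]
    by_contra hne
    obtain ⟨h0, h1, h2, -⟩ := drop 0 hi hne
    have := hc' h1 h2
    revert h0 this
    cases b' <;> simp +contextual [keep]
  · show (K.bisect b).bary 2 x = 0
    rw [Tri.bary_bisect_two b hK]
    by_contra hne
    have hpos : K.bary (keep b) x ≠ 0 := fun h => hne (by linarith [pK (keep (!b))])
    obtain ⟨h0, h1, h2, h3⟩ := drop (keep b) (by simpa using hi) hpos
    have h4 : L (keep b') ∈ Set.range K := by cases b' <;> assumption
    obtain ⟨j, hj⟩ := h4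
    have hc0 := hc' h1 h2
    rcases eq_keep b j with rfl | rfl | rfl
    · revert hc0 hj; cases b' <;> simp +contextual [keep]
    · rw [h0] at hj
      exact keep_ne_keep_not b' (Tri.injective hL hj).symm
    · rw [hm.symm.bary_eq hL hK hxL hxK hj.symm] at h3
      exact hne (by linarith)

lemma Meet.compat_bisect (hm : Meet K L) (hK : K.det ≠ 0) (hL : L.det ≠ 0) (b b' : Bool) :
    Compat (K.bisect b) (L.bisect b') := fun _ _ =>
  ⟨hm.symm.midpoint_ne_vertex hL hK _, by
    rw [Tri.bisect_two]; exact hm.symm.midpoint_ne_vertex hL hK _⟩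

lemma exists_vertex_notMem_range (hK : K.det ≠ 0) (h : Set.range K ≠ Set.range L) :
    ∃ i, K i ∉ Set.range L := by
  by_contra! hall
  refine h (Set.eq_of_subset_of_ncard_le (Set.range_subset_iff.2 hall) ?_ (Set.finite_range L))
  have h1 : (Set.range K).ncard = 3 := by
    rw [← Set.image_univ, Set.ncard_image_of_injective _ (Tri.injective hK)]
    simp [Set.ncard_univ]
  have h2 : (Set.range L).ncard ≤ 3 := by
    rw [← Set.image_univ]
    refine (Set.ncard_image_le Set.finite_univ).trans ?_
    simp [Set.ncard_univ]
  omega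

lemma Meet.range_bisect_ne (hm : Meet K L) (hK : K.det ≠ 0) (hL : L.det ≠ 0)
    (h : Set.range K ≠ Set.range L) (b b' : Bool) :
    Set.range (K.bisect b) ≠ Set.range (L.bisect b') := by
  intro he
  obtain ⟨i, hi⟩ := exists_vertex_notMem_range hK h
  have hz : ∀ j, K.bary i (K.bisect b j) = 0 := by
    intro j
    have h1 : K.bisect b j ∈ Set.range (L.bisect b') := he ▸ ⟨j, rfl⟩
    obtain ⟨k, hk⟩ := h1
    exact hm.bary_eq_zero hK (Tri.body_bisect_subset b hK (Tri.vertex_mem_body j))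
      (hk ▸ Tri.body_bisect_subset b' hL (Tri.vertex_mem_body k)) hi
  rcases eq_keep b i with rfl | rfl | rfl
  · have := hz 1
    rw [Tri.bisect_one, Tri.bary_self hK] at this; norm_num at this
  · have := hz 2
    rw [Tri.bisect_two, Tri.bary_self hK] at this; norm_num at this
  · have := hz 0
    rw [Tri.bisect_zero, Tri.bary_midpoint_keep _ hK] at this; norm_num at this

/-- The triangle on the other side of an edge. -/
lemma Meet.exists_opposite (hm : Meet K L) (hK : K.det ≠ 0) (hL : L.det ≠ 0)
    (hne : Set.range K ≠ Set.range L) {k : Fin 3} (h1 : K (k + 1) ∈ Set.range L)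
    (h2 : K (k + 2) ∈ Set.range L) :
    ∃ l, L (l + 1) ∈ Set.range K ∧ L (l + 2) ∈ Set.range K ∧ L l ∉ Set.range K ∧
      K.bary k (L (l + 1)) = 0 ∧ K.bary k (L (l + 2)) = 0 ∧ K.bary k (L l) < 0 := by
  obtain ⟨l, hl⟩ := exists_vertex_notMem_range hL hne.symm
  have hk12 := fin_three_add_ne k
  have hkL : K k ∉ Set.range L := by
    obtain ⟨i, hi⟩ := exists_vertex_notMem_range hK hne
    rcases fin_three_cases_add k i with rfl | rfl | rfl
    · exact hi
    · exact absurd h1 hi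
    · exact absurd h2 hi
  obtain ⟨i, hi⟩ := h1
  obtain ⟨j, hj⟩ := h2
  have hij : i ≠ j := by
    rintro rfl; exact hk12.1 (Tri.injective hK (hi.symm.trans hj))
  have hil : i ≠ l := by rintro rfl; exact hl (hi ▸ ⟨_, rfl⟩)
  have hjl : j ≠ l := by rintro rfl; exact hl (hj ▸ ⟨_, rfl⟩)
  have hij' : ∀ m, m ≠ l → L m = K (k + 1) ∨ L m = K (k + 2) := by
    intro m hm
    have : ∀ i j l m : Fin 3, i ≠ j → i ≠ l → j ≠ l → m ≠ l → m = i ∨ m = j := by decide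
    rcases this i j l m hij hil hjl hm with rfl | rfl
    · exact Or.inl hi
    · exact Or.inr hj
  have hr : ∀ m, m ≠ l → L m ∈ Set.range K ∧ K.bary k (L m) = 0 := by
    intro m hm
    rcases hij' m hm with h | h <;> rw [h]
    · exact ⟨⟨_, rfl⟩, Tri.bary_vertex_of_ne hk12.2.1⟩
    · exact ⟨⟨_, rfl⟩, Tri.bary_vertex_of_ne hk12.2.2⟩
  have hl1 : l + 1 ≠ l ∧ l + 2 ≠ l := ⟨(fin_three_add_ne l).2.1.symm, (fin_three_add_ne l).2.2.symm⟩
  refine ⟨l, (hr _ hl1.1).1, (hr _ hl1.2).1, hl, (hr _ hl1.1).2, (hr _ hl1.2).2, ?_⟩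
  by_contra! hpos
  -- a point of `L` near the midpoint of the common edge lies in `K` as well
  set y := midpoint ℝ (K (k + 1)) (K (k + 2)) with hy
  have hyb : ∀ m, K.bary m y = if m = k then 0 else 1 / 2 := by
    intro m
    rw [hy, Tri.bary_midpoint]
    rcases fin_three_cases_add k m with rfl | rfl | rfl
    · rw [Tri.bary_vertex_of_ne hk12.2.1, Tri.bary_vertex_of_ne hk12.2.2]; simp
    · rw [Tri.bary_self hK, Tri.bary_vertex_of_ne hk12.1, if_neg hk12.2.1.symm]; norm_num
    · rw [Tri.bary_self hK, Tri.bary_vertex_of_ne hk12.1.symm, if_neg hk12.2.2.symm]; norm_num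
  have hev : ∀ m, ∀ᶠ t in nhdsWithin (0 : ℝ) (Set.Ioi 0),
      0 ≤ K.bary m (AffineMap.lineMap y (L l) t) := by
    intro m
    by_cases hmk : m = k
    · filter_upwards [self_mem_nhdsWithin] with t ht
      rw [Tri.bary_lineMap, hmk, hyb, if_pos rfl, mul_zero, zero_add]
      exact mul_nonneg (le_of_lt ht) hpos
    · have hcont : Filter.Tendsto (fun t : ℝ => K.bary m (AffineMap.lineMap y (L l) t))
          (nhdsWithin 0 (Set.Ioi 0)) (nhds (1 / 2)) := by
        have : Continuous fun t : ℝ => K.bary m (AffineMap.lineMap y (L l) t) := by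
          simp only [Tri.bary_lineMap]; fun_prop
        have h0 := this.tendsto 0
        simp only [AffineMap.lineMap_apply_zero, hyb, if_neg hmk] at h0
        exact h0.mono_left nhdsWithin_le_nhds
      exact (hcont.eventually (lt_mem_nhds (by norm_num))).mono fun t ht => le_of_lt ht
  have hev' : ∀ᶠ t in nhdsWithin (0 : ℝ) (Set.Ioi 0), 0 < t ∧ t < 1 ∧
      ∀ m, 0 ≤ K.bary m (AffineMap.lineMap y (L l) t) :=
    (eventually_mem_nhdsWithin (s := Set.Ioi (0 : ℝ))).and ((Filter.Eventually.filter_mono nhdsWithin_le_nhds (Iio_mem_nhds zero_lt_one)).and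
      (Filter.eventually_all.2 hev))
  obtain ⟨t, ht0, ht1, htm⟩ := hev'.exists
  have hxK : AffineMap.lineMap y (L l) t ∈ K.body := (Tri.mem_body hK _).2 htm
  have hyL : y ∈ L.body := by
    rw [hy, ← hi, ← hj]
    exact L.convex_body.midpoint_mem (Tri.vertex_mem_body _) (Tri.vertex_mem_body _)
  have hxL : AffineMap.lineMap y (L l) t ∈ L.body :=
    L.convex_body.lineMap_mem hyL (Tri.vertex_mem_body l) ⟨ht0.le, ht1.le⟩
  have h0 := hm.symm.bary_eq_zero hL hxL hxK hl
  rw [Tri.bary_lineMap, Tri.bary_self hL] at h0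
  have := mul_nonneg (sub_nonneg.2 ht1.le) ((Tri.mem_body hL _).1 hyL l)
  linarith

/-- At most two triangles share an edge. -/
lemma Meet.opposite_unique {M : Tri} (hKL : Meet K L) (hKM : Meet K M) (hLM : Meet L M)
    (hK : K.det ≠ 0) (hL : L.det ≠ 0) (hM : M.det ≠ 0)
    (nKL : Set.range K ≠ Set.range L) (nKM : Set.range K ≠ Set.range M) {k : Fin 3}
    (h1 : K (k + 1) ∈ Set.range L) (h2 : K (k + 2) ∈ Set.range L)
    (h1' : K (k + 1) ∈ Set.range M) (h2' : K (k + 2) ∈ Set.range M) :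
    Set.range L = Set.range M := by
  by_contra nLM
  obtain ⟨l, l1, l2, l3, l4, l5, l6⟩ := hKL.exists_opposite hK hL nKL h1 h2
  obtain ⟨m, m1, m2, m3, m4, m5, m6⟩ := hKM.exists_opposite hK hM nKM h1' h2'
  have hsub : ∀ i, L i ∈ Set.range K → K.bary k (L i) = 0 → L i ∈ Set.range M := by
    rintro i ⟨j, hj⟩ h0
    rcases fin_three_cases_add k j with rfl | rfl | rfl
    · rw [← hj, Tri.bary_self hK] at h0; norm_num at h0
    · rwa [← hj]
    · rwa [← hj]
  obtain ⟨m', a1, a2, a3, a4, a5, a6⟩ := hLM.exists_opposite hL hM nLM (hsub _ l1 l4) (hsub _ l2 l5)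
  -- the coordinates of `L` and `K` that vanish on the common edge are proportional
  have hprop : ∀ x, K.bary k x = L.bary l x * K.bary k (L l) := by
    intro x
    rw [Tri.bary_comp hL K k x, Finset.sum_eq_single l]
    · intro i _ hi
      rcases fin_three_cases_add l i with rfl | rfl | rfl
      · exact absurd rfl hi
      · rw [l4, mul_zero]
      · rw [l5, mul_zero]
    · simp
  have := hprop (M m')
  have h7 : 0 < K.bary k (M m') := by rw [this]; exact mul_pos_of_neg_of_neg a6 l6
  rcases fin_three_cases_add m m' with rfl | rfl | rfl <;> linarith

end Step

/-! ### The forest of triangles and its generations -/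

namespace InitialMesh

variable {T₀ : InitialMesh}

/-- The generation of an element: the number of bisections that generate it. -/
def Elem.gen (K : T₀.Elem) : ℕ := K.2.length

/-- The parent of an element; roots are their own parents. -/
def Elem.parent (K : T₀.Elem) : T₀.Elem := (K.1, K.2.tail)

namespace Elem

@[simp] lemma gen_child (K : T₀.Elem) (b : Bool) : (K.child b).gen = K.gen + 1 := rfl
@[simp] lemma parent_child (K : T₀.Elem) (b : Bool) : (K.child b).parent = K := rfl
@[simp] lemma tri_child (K : T₀.Elem) (b : Bool) : (K.child b).tri = K.tri.bisect b := rfl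

lemma child_inj {K L : T₀.Elem} {b b' : Bool} : K.child b = L.child b' ↔ K = L ∧ b = b' := by
  obtain ⟨r, p⟩ := K
  obtain ⟨s, q⟩ := L
  simp [child, and_comm, and_left_comm]

lemma exists_eq_child {K : T₀.Elem} (h : 0 < K.gen) : ∃ b, K = K.parent.child b := by
  obtain ⟨r, _ | ⟨b, p⟩⟩ := K
  · simp [gen] at h
  · exact ⟨b, rfl⟩

lemma exists_child_of_gen {K : T₀.Elem} {g : ℕ} (h : K.gen = g + 1) :
    ∃ P b, Elem.gen P = g ∧ K = P.child b := by
  obtain ⟨r, _ | ⟨b, p⟩⟩ := K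
  · simp [gen] at h
  · exact ⟨(r, p), b, by simpa [gen] using h, rfl⟩

lemma gen_parent (K : T₀.Elem) : K.parent.gen = K.gen - 1 := by simp [gen, parent]

/-- Induction along the branches of the forest. -/
lemma induction_on {p : T₀.Elem → Prop} (K : T₀.Elem) (root : ∀ r, p (r, []))
    (child : ∀ K b, p K → p (K.child b)) : p K := by
  obtain ⟨r, q⟩ := K
  induction q with
  | nil => exact root r
  | cons b q ih => exact child (r, q) b ih

lemma det_ne (K : T₀.Elem) : K.tri.det ≠ 0 :=
  K.induction_on (fun r => Tri.det_ne_zero_of_affineIndependent (T₀.nondegenerate r))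
    fun _ b h => Tri.det_bisect_ne b h

lemma body_child_subset (K : T₀.Elem) (b : Bool) : (K.child b).tri.body ⊆ K.tri.body :=
  Tri.body_bisect_subset b K.det_ne

lemma body_subset_parent (K : T₀.Elem) : K.tri.body ⊆ K.parent.tri.body := by
  obtain ⟨r, _ | ⟨b, p⟩⟩ := K
  · exact subset_rfl
  · exact body_child_subset (r, p) b

end Elem

/-- The triangles of one generation form a conforming triangulation without repetitions, with
compatible refinement edges. -/
theorem generation_conforming (g : ℕ) : ∀ K L : T₀.Elem, K.gen = g → L.gen = g →
    Meet K.tri L.tri ∧ Compat K.tri L.tri ∧ (Set.range K.tri = Set.range L.tri → K = L) := by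
  induction g with
  | zero =>
    rintro ⟨r, p⟩ ⟨s, q⟩ hp hq
    obtain rfl : p = [] := List.length_eq_zero_iff.1 hp
    obtain rfl : q = [] := List.length_eq_zero_iff.1 hq
    refine ⟨T₀.conforming _ ⟨r, rfl⟩ _ ⟨s, rfl⟩, ?_, fun h => ?_⟩
    · obtain ⟨label, hl⟩ := T₀.admissible
      obtain ⟨hr, -, -⟩ := hl r
      obtain ⟨-, hs1, hs2⟩ := hl s
      have hne : T₀.tri r 1 ≠ T₀.tri r 2 := fun h => by
        have := Tri.injective (Elem.det_ne (T₀ := T₀) (r, [])) h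
        simp at this
      have h01 : ∀ i : Fin 3, i ≠ 0 → label s(T₀.tri s 0, T₀.tri s i) = 1 := by
        intro i hi
        rcases fin_three_cases i with rfl | rfl | rfl
        · exact absurd rfl hi
        · exact hs1
        · exact hs2
      change T₀.tri r 1 ∈ Set.range (T₀.tri s) → T₀.tri r 2 ∈ Set.range (T₀.tri s) →
        T₀.tri s 0 ≠ T₀.tri r 1 ∧ T₀.tri s 0 ≠ T₀.tri r 2
      rintro ⟨i, hi⟩ ⟨j, hj⟩
      refine ⟨fun h => ?_, fun h => ?_⟩
      · rw [← h, ← hj, h01 j] at hr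
        · exact one_ne_zero hr
        · rintro rfl; exact hne (h.symm.trans hj)
      · rw [← h, ← hi, Sym2.eq_swap, h01 i] at hr
        · exact one_ne_zero hr
        · rintro rfl; exact hne (hi.symm.trans h)
    · exact congrArg (·, []) (T₀.distinct h)
  | succ g ih =>
    intro C D hC hD
    obtain ⟨K, b, hK, rfl⟩ := Elem.exists_child_of_gen hC
    obtain ⟨L, b', hL, rfl⟩ := Elem.exists_child_of_gen hD
    obtain ⟨hm, hc, hd⟩ := ih K L hK hL
    have hc' := (ih L K hL hK).2.1
    simp only [Elem.tri_child]
    refine ⟨hm.bisect K.det_ne L.det_ne hc hc' b b', hm.compat_bisect K.det_ne L.det_ne b b', ?_⟩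
    intro h
    by_cases hKL : K = L
    · subst hKL
      rw [Elem.child_inj]
      refine ⟨rfl, keep_eq_of_mem_range_bisect K.det_ne ?_⟩
      rw [← h]
      exact ⟨2, by simp⟩
    · exact absurd h (hm.range_bisect_ne K.det_ne L.det_ne (fun h => hKL (hd h)) b b')

namespace Elem

variable {K L M N Q : T₀.Elem}

lemma meet (h : K.gen = L.gen) : Meet K.tri L.tri := (generation_conforming _ K L rfl h.symm).1
lemma compat (h : K.gen = L.gen) : Compat K.tri L.tri :=
  (generation_conforming _ K L rfl h.symm).2.1
lemma range_ne (h : K.gen = L.gen) (hne : K ≠ L) : Set.range K.tri ≠ Set.range L.tri :=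
  fun he => hne ((generation_conforming _ K L rfl h.symm).2.2 he)

/-- `L` is the neighbour of `K` in its generation that shares the edge opposite vertex `i`. For
`i = 0` this is the refinement edge. -/
def IsNbr (i : Fin 3) (K L : T₀.Elem) : Prop :=
  K.gen = L.gen ∧ K ≠ L ∧ K.tri (i + 1) ∈ Set.range L.tri ∧ K.tri (i + 2) ∈ Set.range L.tri

lemma IsNbr.unique {i : Fin 3} (hL : IsNbr i K L) (hM : IsNbr i K M) : L = M := by
  by_contra hne
  have hg := hL.1.symm.trans hM.1
  exact range_ne hg hne (Meet.opposite_unique (meet hL.1) (meet hM.1) (meet hg) K.det_ne L.det_ne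
    M.det_ne (range_ne hL.1 hL.2.1) (range_ne hM.1 hM.2.1) hL.2.2.1 hL.2.2.2 hM.2.2.1 hM.2.2.2)

lemma IsNbr.pair (h : IsNbr 0 K L) :
    (L.tri 1 = K.tri 1 ∧ L.tri 2 = K.tri 2) ∨ (L.tri 1 = K.tri 2 ∧ L.tri 2 = K.tri 1) :=
  (compat h.1).pair K.det_ne h.2.2.1 h.2.2.2

lemma IsNbr.symm (h : IsNbr 0 K L) : IsNbr 0 L K := by
  refine ⟨h.1.symm, h.2.1.symm, ?_⟩
  rcases h.pair with ⟨h1, h2⟩ | ⟨h1, h2⟩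
  · exact ⟨⟨1, h1.symm⟩, ⟨2, h2.symm⟩⟩
  · exact ⟨⟨2, h1.symm⟩, ⟨1, h2.symm⟩⟩

lemma IsNbr.midpoint_eq (h : IsNbr 0 K L) :
    midpoint ℝ (L.tri 1) (L.tri 2) = midpoint ℝ (K.tri 1) (K.tri 2) :=
  (compat h.1).midpoint_eq K.det_ne h.2.2.1 h.2.2.2

/-- The midpoint of the refinement edge of `K` belongs only to `K` and the neighbour across this
edge. -/
lemma eq_or_isNbr_of_midpoint_mem (hg : K.gen = L.gen)
    (h : midpoint ℝ (K.tri 1) (K.tri 2) ∈ L.tri.body) : K = L ∨ IsNbr 0 K L := by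
  by_cases hKL : K = L
  · exact Or.inl hKL
  · exact Or.inr ⟨hg, hKL, (meet hg).edge_of_midpoint K.det_ne h false,
      (meet hg).edge_of_midpoint K.det_ne h true⟩

lemma midpoint_eq_of_mem (hg : K.gen = L.gen)
    (h : midpoint ℝ (K.tri 1) (K.tri 2) ∈ L.tri.body) :
    midpoint ℝ (L.tri 1) (L.tri 2) = midpoint ℝ (K.tri 1) (K.tri 2) := by
  rcases eq_or_isNbr_of_midpoint_mem hg h with rfl | h
  · rfl
  · exact h.midpoint_eq

lemma vertex_mem_range (hg : K.gen = L.gen) {i : Fin 3} (h : K.tri i ∈ L.tri.body) :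
    K.tri i ∈ Set.range L.tri := (meet hg).vertex_mem K.det_ne h

lemma range_subset_body (K : T₀.Elem) : Set.range K.tri ⊆ K.tri.body :=
  Set.range_subset_iff.2 Tri.vertex_mem_body

lemma keep_eq {b b' : Bool} (h : K.tri (keep b) ∈ Set.range (K.child b').tri) : b = b' :=
  keep_eq_of_mem_range_bisect K.det_ne h

/-! ### How neighbours are inherited by children -/

/-- From generation two on, neighbours across the refinement edge list the vertices of this edge in
the same order: the first one is the newer one. -/
lemma IsNbr.order (h : IsNbr 0 K L) (hg : 2 ≤ K.gen) :
    L.tri 1 = K.tri 1 ∧ L.tri 2 = K.tri 2 := by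
  rcases h.pair with h' | ⟨h1, h2⟩
  · exact h'
  obtain ⟨g, hg'⟩ : ∃ g, K.gen = g + 1 + 1 := ⟨K.gen - 2, by omega⟩
  obtain ⟨P, b, hP, rfl⟩ := exists_child_of_gen hg'
  obtain ⟨P', b', hP', rfl⟩ := exists_child_of_gen hP
  obtain ⟨R, c, hR, rfl⟩ := exists_child_of_gen (h.1.symm.trans hg')
  obtain ⟨R', c', hR', rfl⟩ := exists_child_of_gen hR
  have hPR : (P'.child b').gen = (R'.child c').gen := hP.trans hR.symm
  simp only [tri_child, Tri.bisect_one, Tri.bisect_two] at h1 h2 ⊢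
  have hm : midpoint ℝ (P'.tri 1) (P'.tri 2) ∈ R'.tri.body := by
    have := (R'.child c').range_subset_body ⟨keep c, rfl⟩
    rw [tri_child, h2, Tri.bisect_zero] at this
    exact body_child_subset _ _ this
  have he := midpoint_eq_of_mem (hP'.trans hR'.symm) hm
  have h3 : (R'.child c').tri 0 = (P'.child b').tri 0 := he
  simp only [tri_child] at h3
  have : (R'.child c').tri (keep c) = (R'.child c').tri 0 := by
    simp only [tri_child]; rw [h2, h3]
  exact absurd (Tri.injective (det_ne _) this) (keep_ne_zero c)

/-- The common edge of two siblings is the refinement edge of their first children. -/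
lemma isNbr_zero_child_false (K : T₀.Elem) (b : Bool) :
    IsNbr 0 ((K.child b).child false) ((K.child !b).child false) := by
  refine ⟨rfl, fun h => ?_, ⟨1, rfl⟩, ⟨2, rfl⟩⟩
  rw [child_inj, child_inj] at h
  revert h; cases b <;> simp

lemma IsNbr.one_vertices {b : Bool} (h : IsNbr 1 (K.child b) N) :
    N.tri 0 = (K.child b).tri 0 ∧ N.tri 2 = (K.child b).tri 2 := by
  obtain ⟨L, c, hL, rfl⟩ := exists_child_of_gen h.1.symm
  obtain ⟨-, hne, h2, h0⟩ := h
  have h0' : midpoint ℝ (K.tri 1) (K.tri 2) ∈ L.tri.body :=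
    body_child_subset L c (range_subset_body _ h0)
  have he := midpoint_eq_of_mem hL.symm h0'
  refine ⟨he, ?_⟩
  obtain ⟨j, hj⟩ := h2
  change (L.child c).tri j = (K.child b).tri 2 at hj
  rcases fin_three_cases j with rfl | rfl | rfl
  · have : (K.child b).tri 0 = (K.child b).tri 2 := he.symm.trans hj
    exact absurd (Tri.injective (det_ne _) this) (by decide)
  · exfalso
    change L.tri 0 = K.tri.bisect b 2 at hj
    rw [Tri.bisect_two] at hj
    rcases eq_or_isNbr_of_midpoint_mem hL.symm h0' with rfl | hn
    · exact keep_ne_zero b (Tri.injective (det_ne _) hj).symm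
    · have := (compat hn.1) hn.2.2.1 hn.2.2.2
      cases b
      · exact this.1 hj
      · exact this.2 hj
  · exact hj

/-- The neighbour of `K.child b` across the edge opposite vertex `1` determines the neighbour of
its second child across the refinement edge. -/
lemma isNbr_zero_child_true_iff {b : Bool} :
    IsNbr 0 ((K.child b).child true) L ↔ ∃ N, IsNbr 1 (K.child b) N ∧ L = N.child true := by
  constructor
  · rintro ⟨hg, hne, h1, h2⟩
    obtain ⟨N, c, hN, rfl⟩ := exists_child_of_gen hg.symm
    have hgN : (K.child b).gen = N.gen := hN.symm
    have m0 : (K.child b).tri 0 ∈ Set.range N.tri :=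
      vertex_mem_range hgN (body_child_subset N c (range_subset_body _ h1))
    have m2 : (K.child b).tri 2 ∈ Set.range N.tri :=
      vertex_mem_range hgN (body_child_subset N c (range_subset_body _ h2))
    have hKN : K.child b ≠ N := by
      rintro rfl
      obtain rfl : true = c := keep_eq (K := K.child b) h2
      exact hne rfl
    have hn : IsNbr 1 (K.child b) N := ⟨hgN, hKN, m2, m0⟩
    refine ⟨N, hn, ?_⟩
    have e2 : N.tri (keep true) = (K.child b).tri 2 := hn.one_vertices.2
    obtain rfl : true = c := keep_eq (K := N) (by rw [e2]; exact h2)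
    rfl
  · rintro ⟨N, hn, rfl⟩
    obtain ⟨e0, e2⟩ := hn.one_vertices
    refine ⟨congrArg (· + 1) hn.1, fun h => hn.2.1 (child_inj.1 h).1, ⟨1, e0⟩, ⟨2, e2⟩⟩

lemma isNbr_one_child_iff (hg : 2 ≤ K.gen) {b : Bool} :
    IsNbr 1 (K.child b) L ↔ ∃ Q, IsNbr 0 K Q ∧ L = Q.child b := by
  constructor
  · rintro ⟨hgen, hne, h2, h0⟩
    obtain ⟨Q, c, hQ, rfl⟩ := exists_child_of_gen hgen.symm
    have m0 : midpoint ℝ (K.tri 1) (K.tri 2) ∈ Q.tri.body :=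
      body_child_subset Q c (range_subset_body _ h0)
    change K.tri.bisect b 2 ∈ _ at h2
    rw [Tri.bisect_two] at h2
    rcases eq_or_isNbr_of_midpoint_mem hQ.symm m0 with rfl | hn
    · rw [keep_eq h2] at hne
      exact absurd rfl hne
    · refine ⟨Q, hn, ?_⟩
      have : Q.tri (keep b) = K.tri (keep b) := by
        cases b
        · exact (hn.order hg).1
        · exact (hn.order hg).2
      rw [← this] at h2
      rw [keep_eq h2]
  · rintro ⟨Q, hn, rfl⟩
    have : Q.tri (keep b) = K.tri (keep b) := by
      cases b
      · exact (hn.order hg).1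
      · exact (hn.order hg).2
    refine ⟨congrArg (· + 1) hn.1, fun h => hn.2.1 (child_inj.1 h).1, ⟨2, ?_⟩, ⟨0, ?_⟩⟩
    · change Q.tri.bisect b 2 = K.tri.bisect b 2
      rw [Tri.bisect_two, Tri.bisect_two, this]
    · exact hn.midpoint_eq

end Elem

/-! ### Generations cover the triangulated set -/

variable (T₀) in
/-- The elements of generation `g`. -/
def level : ℕ → Finset T₀.Elem
  | 0 => T₀.initial
  | g + 1 => T₀.refineAll (level g)

lemma mem_refineAll {T : Finset T₀.Elem} {K : T₀.Elem} :
    K ∈ T₀.refineAll T ↔ ∃ P ∈ T, ∃ b, K = P.child b := by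
  simp [refineAll, Bool.exists_bool]

@[simp] lemma mem_initial {K : T₀.Elem} : K ∈ T₀.initial ↔ K.gen = 0 := by
  obtain ⟨r, p⟩ := K
  simp [initial, Elem.gen, eq_comm]

@[simp] lemma mem_level {g : ℕ} {K : T₀.Elem} : K ∈ T₀.level g ↔ K.gen = g := by
  induction g generalizing K with
  | zero => exact mem_initial
  | succ g ih =>
    rw [level, mem_refineAll]
    constructor
    · rintro ⟨P, hP, b, rfl⟩
      rw [Elem.gen_child, ih.1 hP]
    · intro h
      obtain ⟨P, b, hP, rfl⟩ := Elem.exists_child_of_gen h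
      exact ⟨P, ih.2 hP, b, rfl⟩

lemma uniform_eq_level (j : ℕ) : T₀.uniform j = T₀.level (2 * j) := by
  induction j with
  | zero => rfl
  | succ j ih => rw [uniform, ih]; rfl

@[simp] lemma mem_uniform {j : ℕ} {K : T₀.Elem} : K ∈ T₀.uniform j ↔ K.gen = 2 * j := by
  rw [uniform_eq_level, mem_level]

/-- The ancestor of an element that lies `n` generations higher up. -/
def Elem.up (n : ℕ) (K : T₀.Elem) : T₀.Elem := Elem.parent^[n] K

lemma Elem.up_succ (n : ℕ) (K : T₀.Elem) : K.up (n + 1) = (K.up n).parent :=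
  Function.iterate_succ_apply' _ _ _

lemma Elem.gen_up (n : ℕ) (K : T₀.Elem) : (K.up n).gen = K.gen - n := by
  induction n with
  | zero => rfl
  | succ n ih => rw [up_succ, gen_parent, ih]; omega

lemma Elem.body_subset_up (n : ℕ) (K : T₀.Elem) : K.tri.body ⊆ (K.up n).tri.body := by
  induction n with
  | zero => exact subset_rfl
  | succ n ih => rw [up_succ]; exact ih.trans (body_subset_parent _)

/-- The descendants of `K` that lie `n` generations lower cover `K`. -/
lemma Elem.exists_up_eq (n : ℕ) (K : T₀.Elem) {x : Pt} (hx : x ∈ K.tri.body) :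
    ∃ K' : T₀.Elem, K'.gen = K.gen + n ∧ K'.up n = K ∧ x ∈ K'.tri.body := by
  induction n with
  | zero => exact ⟨K, rfl, rfl, hx⟩
  | succ n ih =>
    obtain ⟨K', h1, h2, h3⟩ := ih
    obtain ⟨b, hb⟩ := Tri.exists_mem_body_bisect K'.det_ne h3
    exact ⟨K'.child b, by rw [gen_child, h1]; rfl, h2, hb⟩

lemma iUnion_body_eq (g : ℕ) :
    (⋃ r, (T₀.tri r).body) = ⋃ K ∈ T₀.level g, K.tri.body := by
  ext x
  simp only [Set.mem_iUnion, mem_level, exists_prop]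
  constructor
  · rintro ⟨r, hr⟩
    obtain ⟨K', h1, -, h3⟩ := Elem.exists_up_eq (T₀ := T₀) g (r, []) hr
    exact ⟨K', by simpa [Elem.gen] using h1, h3⟩
  · rintro ⟨K, hK, hx⟩
    have h := K.body_subset_up g hx
    have hg : (K.up g).gen = 0 := by rw [Elem.gen_up]; omega
    refine ⟨(K.up g).1, ?_⟩
    have : K.up g = ((K.up g).1, []) := Prod.ext rfl (List.length_eq_zero_iff.1 hg)
    rw [this] at h
    exact h

lemma domain_eq (g : ℕ) : T₀.domain = interior (⋃ K ∈ T₀.level g, K.tri.body) := by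
  rw [domain, iUnion_body_eq g]

end InitialMesh

/-! ### Meshes and their sets of bisected elements -/

lemma Meet.bisect_left {K L : Tri} (hm : Meet K L) (hK : K.det ≠ 0)
    (h : ¬ (K 1 ∈ Set.range L ∧ K 2 ∈ Set.range L)) (b : Bool) : Meet (K.bisect b) L := by
  rw [meet_iff (Tri.det_bisect_ne b hK)]
  intro x hx hxL i hi
  obtain ⟨hxK, hle⟩ := (Tri.mem_body_bisect b hK x).1 hx
  have pK := (Tri.mem_body hK x).1 hxK
  rcases fin_three_cases i with rfl | rfl | rfl
  · rw [Tri.bary_bisect_zero b hK]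
    by_contra hne
    have hpos : 0 < K.bary (keep (!b)) x :=
      lt_of_le_of_ne (pK _) (fun h => hne (by rw [← h, mul_zero]))
    exact h (forall_keep (p := fun i => K i ∈ Set.range L) b
      (hm.mem_range_of_bary_ne hK hxK hxL (by linarith))
      (hm.mem_range_of_bary_ne hK hxK hxL hpos.ne'))
  · rw [Tri.bary_bisect_one b hK]
    exact hm.bary_eq_zero hK hxK hxL hi
  · rw [Tri.bisect_two] at hi
    have := hm.bary_eq_zero hK hxK hxL hi
    rw [Tri.bary_bisect_two b hK]
    linarith [pK (keep (!b))]

namespace InitialMesh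

variable {T₀ : InitialMesh}

/-- A set of elements is closed under parents. -/
def ParentClosed (B : Finset T₀.Elem) : Prop := ∀ K b, K.child b ∈ B → K ∈ B

/-- A set of elements is closed under passing to the neighbour across the refinement edge. -/
def PartnerClosed (B : Finset T₀.Elem) : Prop := ∀ K ∈ B, ∀ L, Elem.IsNbr 0 K L → L ∈ B

/-- The mesh that arises from the initial mesh by bisecting the elements of `B`. -/
def leaves (B : Finset T₀.Elem) : Finset T₀.Elem := (T₀.initial ∪ T₀.refineAll B) \ B

lemma mem_leaves {B : Finset T₀.Elem} {K : T₀.Elem} :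
    K ∈ leaves B ↔ (K.gen = 0 ∨ ∃ P ∈ B, ∃ b, K = P.child b) ∧ K ∉ B := by
  simp [leaves, mem_refineAll]

lemma leaves_empty : leaves (∅ : Finset T₀.Elem) = T₀.initial := by
  ext K; simp [mem_leaves]

lemma card_leaves_le (B : Finset T₀.Elem) : (leaves B).card ≤ T₀.size + 2 * B.card := by
  have h1 : T₀.initial.card ≤ T₀.size := Finset.card_image_le.trans (by simp)
  have h2 : (T₀.refineAll B).card ≤ B.card * 2 :=
    Finset.card_biUnion_le_card_mul _ _ _ fun K _ => Finset.card_le_two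
  calc (leaves B).card ≤ (T₀.initial ∪ T₀.refineAll B).card :=
        Finset.card_le_card Finset.sdiff_subset
    _ ≤ _ := (Finset.card_union_le _ _).trans (by omega)

lemma ParentClosed.up_mem {B : Finset T₀.Elem} (hB : ParentClosed B) {K : T₀.Elem} (h : K ∈ B)
    (n : ℕ) : K.up n ∈ B := by
  induction n with
  | zero => exact h
  | succ n ih =>
    rw [Elem.up_succ]
    by_cases h0 : 0 < (K.up n).gen
    · obtain ⟨b, hb⟩ := Elem.exists_eq_child h0
      rw [hb] at ih
      exact hB _ _ ih
    · have : (K.up n).parent = K.up n := by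
        have h2 : (K.up n).2 = [] := List.length_eq_zero_iff.1 (by simpa [Elem.gen] using h0)
        exact Prod.ext rfl (by simp [Elem.parent, h2])
      rwa [this]

section Bisected

variable {B B' : Finset T₀.Elem}

lemma ParentClosed.insert (hB : ParentClosed B) {K : T₀.Elem} (hK : K ∈ leaves B) :
    ParentClosed (insert K B) := by
  intro L b h
  rcases Finset.mem_insert.1 h with rfl | h
  · rcases (mem_leaves.1 hK).1 with h0 | ⟨P, hP, c, hc⟩
    · simp at h0
    · rw [(Elem.child_inj.1 hc).1]; exact Finset.mem_insert_of_mem hP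
  · exact Finset.mem_insert_of_mem (hB L b h)

lemma leaves_insert (hB : ParentClosed B) {K : T₀.Elem} (hK : K ∈ leaves B) :
    leaves (insert K B) = (leaves B).erase K ∪ {K.child false, K.child true} := by
  have hKB := (mem_leaves.1 hK).2
  have hne : ∀ b, K.child b ≠ K := fun b h => by
    have := congrArg Elem.gen h; simp at this
  ext L
  simp only [Finset.mem_union, Finset.mem_erase, mem_leaves, Finset.mem_insert,
    Finset.mem_singleton, not_or]
  constructor
  · rintro ⟨h0 | ⟨P, rfl | hP, b, rfl⟩, h1, h2⟩
    · exact Or.inl ⟨h1, Or.inl h0, h2⟩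
    · right; cases b <;> simp
    · exact Or.inl ⟨h1, Or.inr ⟨P, hP, b, rfl⟩, h2⟩
  · rintro (⟨h1, h0 | ⟨P, hP, b, rfl⟩, h2⟩ | rfl | rfl)
    · exact ⟨Or.inl h0, h1, h2⟩
    · exact ⟨Or.inr ⟨P, Or.inr hP, b, rfl⟩, h1, h2⟩
    · exact ⟨Or.inr ⟨K, Or.inl rfl, _, rfl⟩, hne _, fun h => hKB (hB _ _ h)⟩
    · exact ⟨Or.inr ⟨K, Or.inl rfl, _, rfl⟩, hne _, fun h => hKB (hB _ _ h)⟩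

/-- Every refinement of the initial mesh arises by bisecting the elements of a set that is closed
under parents. -/
lemma exists_eq_leaves {T : Finset T₀.Elem} (h : T₀.Refines T₀.initial T) :
    ∃ B : Finset T₀.Elem, ParentClosed B ∧ T = leaves B := by
  induction h with
  | refl => exact ⟨∅, fun _ _ h => by simp at h, leaves_empty.symm⟩
  | tail _ hstep ih =>
    obtain ⟨B, hB, rfl⟩ := ih
    obtain ⟨K, hK, rfl⟩ := hstep
    exact ⟨insert K B, hB.insert hK, (leaves_insert hB hK).symm⟩

lemma leaves_refines (hB : ParentClosed B) (hB' : ParentClosed B') (h : B ⊆ B') :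
    T₀.Refines (leaves B) (leaves B') := by
  induction hn : (B' \ B).card generalizing B with
  | zero =>
    have : B = B' := h.antisymm (by simpa [Finset.sdiff_eq_empty_iff_subset] using hn)
    rw [this]; exact Relation.ReflTransGen.refl
  | succ n ih =>
    have hne : (B' \ B).Nonempty := Finset.card_pos.1 (by omega)
    obtain ⟨K, hK, hmin⟩ := Finset.exists_min_image _ Elem.gen hne
    obtain ⟨hK', hKB⟩ := Finset.mem_sdiff.1 hK
    have hleaf : K ∈ leaves B := by
      rw [mem_leaves]
      refine ⟨?_, hKB⟩
      rcases Nat.eq_zero_or_pos K.gen with h0 | h0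
      · exact Or.inl h0
      · obtain ⟨b, hb⟩ := Elem.exists_eq_child h0
        refine Or.inr ⟨K.parent, ?_, b, hb⟩
        by_contra hP
        have hP' : K.parent ∈ B' := hB' _ b (hb ▸ hK')
        have := hmin _ (Finset.mem_sdiff.2 ⟨hP', hP⟩)
        rw [Elem.gen_parent] at this
        omega
    refine Relation.ReflTransGen.head ⟨K, hleaf, leaves_insert hB hleaf⟩ (ih (hB.insert hleaf)
      (Finset.insert_subset hK' h) ?_)
    rw [Finset.sdiff_insert, Finset.card_erase_of_mem hK, hn]; rfl

/-- Every element is bisected or part of an element of the mesh. -/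
lemma exists_up_mem_leaves (Q : T₀.Elem) (hQ : Q ∉ B) : ∃ n, Q.up n ∈ leaves B := by
  induction Q using Elem.induction_on with
  | root r => exact ⟨0, mem_leaves.2 ⟨Or.inl rfl, hQ⟩⟩
  | child K b ih =>
    by_cases hK : K ∈ B
    · exact ⟨0, mem_leaves.2 ⟨Or.inr ⟨K, hK, b, rfl⟩, hQ⟩⟩
    · obtain ⟨n, hn⟩ := ih hK
      exact ⟨n + 1, hn⟩

/-- A vertex generated by bisecting is a vertex of an element of the mesh. -/
lemma exists_leaf_vertex {K : T₀.Elem} (hK : K ∈ B) :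
    ∃ N ∈ leaves B, midpoint ℝ (K.tri 1) (K.tri 2) ∈ Set.range N.tri := by
  classical
  have hne : ((T₀.refineAll B).filter fun N =>
      midpoint ℝ (K.tri 1) (K.tri 2) ∈ Set.range N.tri).Nonempty :=
    ⟨K.child false, Finset.mem_filter.2 ⟨mem_refineAll.2 ⟨K, hK, _, rfl⟩, 0, rfl⟩⟩
  obtain ⟨N, hN, hmax⟩ := Finset.exists_max_image _ Elem.gen hne
  obtain ⟨hN', hm⟩ := Finset.mem_filter.1 hN
  refine ⟨N, mem_leaves.2 ⟨Or.inr (mem_refineAll.1 hN'), fun hNB => ?_⟩, hm⟩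
  obtain ⟨i, hi⟩ := hm
  obtain ⟨b, hb⟩ := Tri.exists_vertex_bisect (K := N.tri) i
  have := hmax (N.child b) (Finset.mem_filter.2 ⟨mem_refineAll.2 ⟨N, hNB, b, rfl⟩, hi ▸ hb⟩)
  simp at this

lemma up_notMem_leaves (hB : ParentClosed B) {K : T₀.Elem} (hK : K ∈ B) (n : ℕ) :
    K.up n ∉ leaves B := fun h => (mem_leaves.1 h).2 (hB.up_mem hK n)

/-- If `K` is bisected in a conforming mesh, then so is its neighbour `Q` across the refinement
edge: the new vertex would otherwise be a hanging node of the element containing `Q`. -/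
lemma partnerClosed_of_conforming
    (hc : ConformingFamily ((fun K : T₀.Elem => K.tri) '' (leaves B : Set T₀.Elem))) :
    PartnerClosed B := by
  intro K hK Q hKQ
  by_contra hQ
  obtain ⟨n, hL⟩ := exists_up_mem_leaves Q hQ
  obtain ⟨N, hN, i, hi⟩ := exists_leaf_vertex hK
  have hm : Meet N.tri (Q.up n).tri := hc _ ⟨N, hN, rfl⟩ _ ⟨_, hL, rfl⟩
  set L := Q.up n
  have hQL : Q.tri.body ⊆ L.tri.body := Q.body_subset_up n
  have hmid : midpoint ℝ (Q.tri 1) (Q.tri 2) = N.tri i := by rw [hKQ.midpoint_eq, hi]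
  have hmem : N.tri i ∈ L.tri.body := hmid ▸ hQL Tri.midpoint_mem_body
  obtain ⟨k, hk⟩ := hm.vertex_mem N.det_ne hmem
  have h1 : L.tri.bary k (midpoint ℝ (Q.tri 1) (Q.tri 2)) = 1 := by
    rw [hmid, ← hk, Tri.bary_self L.det_ne]
  rw [Tri.bary_midpoint] at h1
  have b1 := hQL (Tri.vertex_mem_body 1)
  have b2 := hQL (Tri.vertex_mem_body 2)
  have l1 := Tri.bary_le_one L.det_ne b1 k
  have l2 := Tri.bary_le_one L.det_ne b2 k
  have e1 := Tri.eq_vertex_of_bary_eq_one L.det_ne b1 (i := k) (by linarith)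
  have e2 := Tri.eq_vertex_of_bary_eq_one L.det_ne b2 (i := k) (by linarith)
  have := Tri.injective Q.det_ne (e1.trans e2.symm)
  simp at this

lemma meet_of_unbisected (hB : ParentClosed B) (hP : PartnerClosed B) {K : T₀.Elem} (hK : K ∉ B)
    (n : ℕ) : ∀ M : T₀.Elem, M.gen = K.gen + n → (M.gen = 0 ∨ ∃ P ∈ B, ∃ b, M = P.child b) →
      M.up n ≠ K → Meet M.tri K.tri := by
  induction n with
  | zero => exact fun M hg _ _ => Elem.meet hg
  | succ n ih =>
    rintro M hg hM hne
    rcases hM with h0 | ⟨P, hPB, b, rfl⟩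
    · omega
    have hgP : P.gen = K.gen + n := by rw [Elem.gen_child] at hg; omega
    have hPt : P.gen = 0 ∨ ∃ P' ∈ B, ∃ b, P = P'.child b := by
      rcases Nat.eq_zero_or_pos P.gen with h0 | h0
      · exact Or.inl h0
      · obtain ⟨c, hc⟩ := Elem.exists_eq_child h0
        exact Or.inr ⟨P.parent, hB _ c (hc ▸ hPB), c, hc⟩
    refine (ih P hgP hPt hne).bisect_left P.det_ne (fun ⟨h1, h2⟩ => ?_) b
    -- the part of `K` at the refinement edge of `P` would be bisected together with `P`
    have hmid : midpoint ℝ (P.tri 1) (P.tri 2) ∈ K.tri.body :=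
      Tri.convex_body.midpoint_mem (K.range_subset_body h1) (K.range_subset_body h2)
    obtain ⟨K', hg', hup, hmem⟩ := Elem.exists_up_eq n K hmid
    rcases Elem.eq_or_isNbr_of_midpoint_mem (hgP.trans hg'.symm) hmem with rfl | hn
    · exact hne hup
    · exact hK (hup ▸ hB.up_mem (hP P hPB K' hn) n)

lemma conforming_of_partnerClosed (hB : ParentClosed B) (hP : PartnerClosed B) :
    ConformingFamily ((fun K : T₀.Elem => K.tri) '' (leaves B : Set T₀.Elem)) := by
  have key : ∀ K ∈ leaves B, ∀ L ∈ leaves B, K.gen ≤ L.gen → Meet L.tri K.tri := by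
    intro K hK L hL hg
    obtain ⟨n, hn⟩ := Nat.exists_eq_add_of_le hg
    by_cases hup : L.up n = K
    · rcases n with _ | n
      · rw [← hup]; exact Meet.refl _
      · exfalso
        rcases (mem_leaves.1 hL).1 with h0 | ⟨P, hPB, b, rfl⟩
        · omega
        · exact up_notMem_leaves hB hPB n (hup ▸ hK)
    · exact meet_of_unbisected hB hP (mem_leaves.1 hK).2 n L hn (mem_leaves.1 hL).1 hup
  rintro _ ⟨K, hK, rfl⟩ _ ⟨L, hL, rfl⟩
  rcases le_total K.gen L.gen with h | h
  · exact (key K hK L hL h).symm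
  · exact key L hL K hK h

/-- The conforming refinements of the initial mesh are given by the sets of bisected elements that
are closed under parents and under neighbours across refinement edges. -/
theorem isConformingMesh_iff {T : Finset T₀.Elem} :
    T₀.IsConformingMesh T ↔ ∃ B, ParentClosed B ∧ PartnerClosed B ∧ T = leaves B := by
  constructor
  · rintro ⟨h, hc⟩
    obtain ⟨B, hB, rfl⟩ := exists_eq_leaves h
    exact ⟨B, hB, partnerClosed_of_conforming hc, rfl⟩
  · rintro ⟨B, hB, hP, rfl⟩
    refine ⟨?_, conforming_of_partnerClosed hB hP⟩
    rw [← leaves_empty]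
    exact leaves_refines (fun _ _ h => by simp at h) hB (Finset.empty_subset _)

end Bisected

end InitialMesh

/-! ### Size and number of the triangles near a point -/

namespace Tri

/-- A quadratic measure of the size of a triangle that is exactly halved by bisection. -/
noncomputable def sizeSq (K : Tri) : ℝ :=
  ‖K 1 - K 2‖ ^ 2 + ‖K 1 + K 2 - (2 : ℝ) • K 0‖ ^ 2

/-- This is the parallelogram law. -/
lemma sizeSq_bisect (K : Tri) (b : Bool) : (K.bisect b).sizeSq = K.sizeSq / 2 := by
  cases b <;> simp [sizeSq, EuclideanSpace.norm_sq_eq, midpoint_apply, keep] <;> ring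

lemma dist_vertex_sq_le (K : Tri) (i j : Fin 3) : dist (K i) (K j) ^ 2 ≤ K.sizeSq := by
  have h : ∀ a b c d e f : ℝ, (a - b) ^ 2 + (d - e) ^ 2 ≤
      (b - c) ^ 2 + (e - f) ^ 2 + ((b + c - 2 * a) ^ 2 + (e + f - 2 * d) ^ 2) := by
    intro a b c d e f
    nlinarith [sq_nonneg (b - a - (2 * (a - c))), sq_nonneg (e - d - (2 * (d - f))),
      sq_nonneg (a - c), sq_nonneg (d - f), sq_nonneg (b - a), sq_nonneg (e - d),
      sq_nonneg (b - a + (c - a)), sq_nonneg (e - d + (f - d)), sq_nonneg (b - c),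
      sq_nonneg (e - f)]
  rw [dist_eq_norm]
  fin_cases i <;> fin_cases j <;>
    simp [sizeSq, EuclideanSpace.norm_sq_eq] <;>
    nlinarith [h (K 0 0) (K 1 0) (K 2 0) (K 0 1) (K 1 1) (K 2 1),
      h (K 0 0) (K 2 0) (K 1 0) (K 0 1) (K 2 1) (K 1 1), sq_nonneg (K 1 0 - K 2 0),
      sq_nonneg (K 1 1 - K 2 1), sq_nonneg (K 1 0 + K 2 0 - 2 * K 0 0),
      sq_nonneg (K 1 1 + K 2 1 - 2 * K 0 1)]

lemma dist_le (K : Tri) {x y : Pt} (hx : x ∈ K.body) (hy : y ∈ K.body) :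
    dist x y ≤ Real.sqrt K.sizeSq := by
  obtain ⟨x', ⟨i, rfl⟩, y', ⟨j, rfl⟩, h⟩ := convexHull_exists_dist_ge2 hx hy
  exact h.trans (Real.le_sqrt_of_sq_le (K.dist_vertex_sq_le i j))

/-- The reference triangle. -/
noncomputable def ref : Tri := ![0, !₂[1, 0], !₂[0, 1]]

/-- The linear map that takes the edge vectors of the reference triangle to those of `K`. -/
noncomputable def edgeMap (K : Tri) : Pt →ₗ[ℝ] Pt :=
  Matrix.toLin (EuclideanSpace.basisFun (Fin 2) ℝ).toBasis (EuclideanSpace.basisFun (Fin 2) ℝ).toBasis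
    !![(K 1 - K 0) 0, (K 2 - K 0) 0; (K 1 - K 0) 1, (K 2 - K 0) 1]

lemma det_edgeMap (K : Tri) : LinearMap.det K.edgeMap = K.det := by
  rw [edgeMap, LinearMap.det_toLin, Matrix.det_fin_two_of, det, cross]; ring

lemma edgeMap_apply (K : Tri) (v : Pt) : K.edgeMap v = v 0 • (K 1 - K 0) + v 1 • (K 2 - K 0) := by
  ext t
  simp [edgeMap, Matrix.toLin_apply, Matrix.mulVec, dotProduct, Fin.sum_univ_two]
  fin_cases t <;> simp <;> ring

lemma body_eq_image (K : Tri) : K.body = (fun x => K 0 + x) '' (K.edgeMap '' ref.body) := by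
  let e : Pt →ᵃ[ℝ] Pt := AffineMap.const ℝ Pt (K 0) + K.edgeMap.toAffineMap
  have he : ∀ x, e x = K 0 + K.edgeMap x := fun x => rfl
  have hr : Set.range K = e '' Set.range ref := by
    rw [← Set.range_comp]
    congr 1
    ext i : 1
    rw [Function.comp_apply, he, edgeMap_apply]
    fin_cases i <;> simp [ref]
  rw [body, hr, ← AffineMap.image_convexHull, ← Set.image_comp]
  rfl

lemma volume_body (K : Tri) : volume K.body = ENNReal.ofReal |K.det| * volume ref.body := by
  rw [body_eq_image, Set.image_add_left, measure_preimage_add, Measure.addHaar_image_linearMap,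
    det_edgeMap]

/-- The interior of a triangle in barycentric coordinates. -/
def inner (K : Tri) : Set Pt := {x | ∀ i, 0 < K.bary i x}

lemma isOpen_inner (K : Tri) : IsOpen K.inner := by
  have : K.inner = ⋂ i, {x | 0 < K.bary i x} := by ext; simp [inner]
  rw [this]
  exact isOpen_iInter_of_finite fun i => isOpen_lt continuous_const (K.continuous_bary i)

lemma inner_nonempty {K : Tri} (h : K.det ≠ 0) : K.inner.Nonempty := by
  refine ⟨midpoint ℝ (midpoint ℝ (K 1) (K 2)) (K 0), fun i => ?_⟩
  rw [bary_midpoint, bary_midpoint]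
  rcases fin_three_cases i with rfl | rfl | rfl <;>
    simp [bary_self h, bary_vertex_of_ne]

lemma inner_subset_body {K : Tri} (h : K.det ≠ 0) : K.inner ⊆ K.body :=
  fun x hx => (mem_body h x).2 fun i => (hx i).le

lemma volume_ref_pos : 0 < volume ref.body := by
  have h : ref.det ≠ 0 := by simp [ref, det, cross]
  exact (ref.isOpen_inner.measure_pos volume (inner_nonempty h)).trans_le
    (measure_mono (inner_subset_body h))

lemma volume_bary_eq_zero {K : Tri} (h : K.det ≠ 0) (i : Fin 3) :
    volume {x | K.bary i x = 0} = 0 := by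
  have he : {x | K.bary i x = 0} =
      ((affineSpan ℝ {(0 : ℝ)}).comap (K.baryMap i) : Set Pt) := by
    ext x; simp [AffineSubspace.coe_comap]
  rw [he]
  refine Measure.addHaar_affineSubspace _ _ fun htop => ?_
  have : K i ∈ ((affineSpan ℝ {(0 : ℝ)}).comap (K.baryMap i) : Set Pt) := by
    rw [htop]; trivial
  rw [← he, Set.mem_ofPred_eq, bary_self h] at this
  exact one_ne_zero this

end Tri

namespace InitialMesh

variable {T₀ : InitialMesh}

/-- The natural length scale of generation `g`: two bisections halve it. -/
noncomputable def scale (g : ℕ) : ℝ := (1 / 2) ^ (g / 2)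

lemma scale_pos (g : ℕ) : 0 < scale g := by unfold scale; positivity

lemma scale_sq_le (g : ℕ) : scale g ^ 2 ≤ 2 * (1 / 2) ^ g := by
  unfold scale
  rw [← pow_mul]
  obtain h | h : g = g / 2 * 2 ∨ g = g / 2 * 2 + 1 := by omega
  · rw [← h]; linarith [pow_pos (one_half_pos (α := ℝ)) g]
  · conv_rhs => rw [h, pow_succ]
    exact le_of_eq (by ring)

lemma le_scale_sq (g : ℕ) : (1 / 2 : ℝ) ^ g ≤ scale g ^ 2 := by
  unfold scale
  rw [← pow_mul]
  exact pow_le_pow_of_le_one (by norm_num) (by norm_num) (by omega)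

namespace Elem

lemma sizeSq_tri (K : T₀.Elem) : K.tri.sizeSq = (1 / 2) ^ K.gen * (T₀.tri K.1).sizeSq := by
  induction K using induction_on with
  | root r => simp [gen, tri, triAt]
  | child K b ih =>
    rw [tri_child, Tri.sizeSq_bisect, ih, gen_child]
    change _ = _ * (T₀.tri K.1).sizeSq
    ring

lemma abs_det_tri (K : T₀.Elem) : |K.tri.det| = (1 / 2) ^ K.gen * |(T₀.tri K.1).det| := by
  induction K using induction_on with
  | root r => simp [gen, tri, triAt]
  | child K b ih =>
    rw [tri_child, Tri.abs_det_bisect, ih, gen_child]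
    change _ = _ * |(T₀.tri K.1).det|
    ring

lemma volume_inter_eq_zero {K L : T₀.Elem} (hg : K.gen = L.gen) (hne : K ≠ L) :
    volume (K.tri.body ∩ L.tri.body) = 0 := by
  obtain ⟨i, hi⟩ := exists_vertex_notMem_range K.det_ne (range_ne hg hne)
  exact measure_mono_null (fun x hx => (meet hg).bary_eq_zero K.det_ne hx.1 hx.2 hi)
    (Tri.volume_bary_eq_zero K.det_ne i)

end Elem

variable (T₀)

lemma exists_diam_bound : ∃ d : ℝ, 0 ≤ d ∧ ∀ K : T₀.Elem, ∀ x ∈ K.tri.body, ∀ y ∈ K.tri.body,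
    dist x y ≤ d * scale K.gen := by
  obtain ⟨D, hD⟩ := (Set.finite_range fun r => (T₀.tri r).sizeSq).bddAbove
  refine ⟨Real.sqrt (max D 0), Real.sqrt_nonneg _, fun K x hx y hy => (K.tri.dist_le hx hy).trans ?_⟩
  rw [← Real.sqrt_sq (scale_pos K.gen).le, ← Real.sqrt_mul (le_max_right _ _), K.sizeSq_tri]
  apply Real.sqrt_le_sqrt
  have h1 : (T₀.tri K.1).sizeSq ≤ max D 0 := (hD ⟨K.1, rfl⟩).trans (le_max_left _ _)
  have h2 := le_scale_sq K.gen
  have h3 : (0 : ℝ) ≤ (1 / 2) ^ K.gen := by positivity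
  rw [mul_comm]
  exact mul_le_mul h1 h2 h3 (le_max_right _ _)

lemma exists_det_bound : ∃ a : ℝ, 0 < a ∧ ∀ K : T₀.Elem, (1 / 2) ^ K.gen * a ≤ |K.tri.det| := by
  obtain ⟨D, hD⟩ := (Set.finite_range fun r => |(T₀.tri r).det|⁻¹).bddAbove
  refine ⟨(max D 1)⁻¹, by positivity, fun K => ?_⟩
  rw [K.abs_det_tri]
  have h0 : 0 < |(T₀.tri K.1).det| := abs_pos.2 (Elem.det_ne (T₀ := T₀) (K.1, []))
  have h1 : |(T₀.tri K.1).det|⁻¹ ≤ max D 1 := (hD ⟨K.1, rfl⟩).trans (le_max_left _ _)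
  gcongr
  exact inv_le_of_inv_le₀ h0 h1

/-- Only boundedly many triangles of a generation are near a given point, on the length scale of
this generation: they do not overlap, and their areas are comparable. -/
theorem exists_card_near_le (c : ℝ) (hc : 0 ≤ c) : ∃ N : ℕ, ∀ (g : ℕ) (z : Pt) (S : Finset T₀.Elem),
    (∀ K ∈ S, K.gen = g ∧ ∃ x ∈ K.tri.body, dist z x ≤ c * scale g) → S.card ≤ N := by
  obtain ⟨d, hd0, hd⟩ := T₀.exists_diam_bound
  obtain ⟨a, ha0, ha⟩ := T₀.exists_det_bound
  have hv0 := Tri.volume_ref_pos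
  have hvt : volume Tri.ref.body ≠ ⊤ := Tri.isCompact_body.measure_lt_top.ne
  have hbt : volume (Metric.ball (0 : Pt) 1) ≠ ⊤ := measure_ball_lt_top.ne
  set v := (volume Tri.ref.body).toReal with hv
  set w := (volume (Metric.ball (0 : Pt) 1)).toReal with hw
  have hvpos : 0 < v := ENNReal.toReal_pos hv0.ne' hvt
  obtain ⟨N, hN⟩ := exists_nat_ge (2 * (c + d) ^ 2 * w / (a * v))
  refine ⟨N, fun g z S hS => ?_⟩
  have hball : ∀ K ∈ S, K.tri.body ⊆ Metric.closedBall z ((c + d) * scale g) := by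
    intro K hK y hy
    obtain ⟨hg, x, hx, hzx⟩ := hS K hK
    have := hd K x hx y hy
    rw [hg] at this
    rw [Metric.mem_closedBall, dist_comm]
    linarith [dist_triangle z x y]
  have hsum : ∑ K ∈ S, volume K.tri.body ≤ volume (Metric.closedBall z ((c + d) * scale g)) := by
    rw [← measure_biUnion_finset₀]
    · exact measure_mono (Set.iUnion₂_subset hball)
    · intro K hK L hL hne
      exact Elem.volume_inter_eq_zero ((hS K hK).1.trans (hS L hL).1.symm) hne
    · exact fun K _ => Tri.isClosed_body.nullMeasurableSet
  have hlow : (S.card : ENNReal) * ENNReal.ofReal ((1 / 2) ^ g * a * v) ≤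
      ∑ K ∈ S, volume K.tri.body := by
    rw [← nsmul_eq_mul]
    refine Finset.card_nsmul_le_sum _ _ _ fun K hK => ?_
    rw [K.tri.volume_body, ENNReal.ofReal_mul (by positivity), hv, ENNReal.ofReal_toReal hvt]
    gcongr
    rw [← (hS K hK).1]
    exact ha K
  have hR : 0 ≤ (c + d) * scale g := by have := scale_pos g; positivity
  rw [Measure.addHaar_closedBall _ _ hR, ← ENNReal.ofReal_toReal hbt, ← hw,
    ← ENNReal.ofReal_mul (by positivity), finrank_euclideanSpace_fin] at hsum
  have hfin := hlow.trans hsum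
  rw [← ENNReal.ofReal_natCast, ← ENNReal.ofReal_mul (by positivity),
    ENNReal.ofReal_le_ofReal_iff (by positivity)] at hfin
  have h2 : (0 : ℝ) < (1 / 2) ^ g := by positivity
  have h3 : (S.card : ℝ) * (a * v) ≤ 2 * (c + d) ^ 2 * w := by
    have h4 : ((c + d) * scale g) ^ 2 * w ≤ (1 / 2) ^ g * (2 * (c + d) ^ 2 * w) := by
      rw [mul_pow]
      have := mul_le_mul_of_nonneg_left (scale_sq_le g)
        (show 0 ≤ (c + d) ^ 2 * w by positivity)
      linarith
    have h5 : (1 / 2) ^ g * (S.card * (a * v)) ≤ (1 / 2) ^ g * (2 * (c + d) ^ 2 * w) := by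
      linarith
    exact le_of_mul_le_mul_left h5 h2
  have h4 : (S.card : ℝ) ≤ N := ((le_div_iff₀ (by positivity)).2 h3).trans hN
  exact_mod_cast h4

end InitialMesh

/-! ### Hat functions -/

lemma volume_biUnion_finset_eq_zero {ι : Type*} (S : Finset ι) {f : ι → Set Pt}
    (h : ∀ i ∈ S, volume (f i) = 0) : volume (⋃ i ∈ S, f i) = 0 :=
  (measure_biUnion_null_iff (Finset.countable_toSet S)).2 h

namespace InitialMesh

variable {T₀ : InitialMesh}

lemma Elem.exists_vertex_descendant {K : T₀.Elem} {v : Pt} (hv : v ∈ Set.range K.tri) (n : ℕ) :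
    ∃ K' : T₀.Elem, K'.gen = K.gen + n ∧ v ∈ Set.range K'.tri := by
  induction n with
  | zero => exact ⟨K, rfl, hv⟩
  | succ n ih =>
    obtain ⟨K', hg, i, rfl⟩ := ih
    obtain ⟨b, hb⟩ := Tri.exists_vertex_bisect (K := K'.tri) i
    exact ⟨K'.child b, by rw [gen_child, hg]; rfl, hb⟩

section Hat

variable {j : ℕ} {z : Pt}

lemma hat_of_vertex {K : T₀.Elem} (hg : K.gen = 2 * j) {i : Fin 3} (hi : K.tri i = z) {x : Pt}
    (hx : x ∈ K.tri.body) : T₀.hat j z x = K.tri.bary i x := by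
  have : {t | ∃ K ∈ T₀.uniform j, ∃ i, K.tri i = z ∧ x ∈ K.tri.body ∧ t = K.tri.bary i x} =
      {K.tri.bary i x} := by
    ext t
    simp only [Set.mem_ofPred_eq, Set.mem_singleton_iff, mem_uniform]
    constructor
    · rintro ⟨L, hL, l, hl, hxL, rfl⟩
      exact (Elem.meet (hL.trans hg.symm)).bary_eq L.det_ne K.det_ne hxL hx (hl.trans hi.symm)
    · rintro rfl
      exact ⟨K, hg, i, hi, hx, rfl⟩
  rw [hat, this, csSup_singleton]

lemma hat_of_forall {x : Pt} (h : ∀ K : T₀.Elem, K.gen = 2 * j → ∀ i, K.tri i = z →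
    x ∈ K.tri.body → K.tri.bary i x = 0) : T₀.hat j z x = 0 := by
  have : {t | ∃ K ∈ T₀.uniform j, ∃ i, K.tri i = z ∧ x ∈ K.tri.body ∧ t = K.tri.bary i x} ⊆
      {0} := by
    rintro t ⟨K, hK, i, hi, hx, rfl⟩
    exact h K (mem_uniform.1 hK) i hi hx
  rcases Set.subset_singleton_iff_eq.1 this with h | h
  · rw [hat, h, Real.sSup_empty]
  · rw [hat, h, csSup_singleton]

lemma hat_of_notMem {K : T₀.Elem} (hg : K.gen = 2 * j) (hz : z ∉ Set.range K.tri) {x : Pt}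
    (hx : x ∈ K.tri.body) : T₀.hat j z x = 0 :=
  hat_of_forall fun L hL _ hi hxL =>
    (Elem.meet (hL.trans hg.symm)).bary_eq_zero L.det_ne hxL hx (hi ▸ hz)

lemma exists_of_hat_ne_zero {x : Pt} (h : T₀.hat j z x ≠ 0) :
    ∃ K : T₀.Elem, K.gen = 2 * j ∧ ∃ i, K.tri i = z ∧ x ∈ K.tri.body ∧ K.tri.bary i x ≠ 0 := by
  by_contra! hcon
  exact h (hat_of_forall hcon)

open Classical in
lemma hat_vertex {K : T₀.Elem} (hg : K.gen = 2 * j) (i : Fin 3) :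
    T₀.hat j z (K.tri i) = if K.tri i = z then 1 else 0 := by
  have hx := Tri.vertex_mem_body (K := K.tri) i
  split_ifs with h
  · rw [hat_of_vertex hg h hx, Tri.bary_self K.det_ne]
  · by_cases hz : z ∈ Set.range K.tri
    · obtain ⟨k, hk⟩ := hz
      rw [hat_of_vertex hg hk hx, Tri.bary_vertex_of_ne]
      rintro rfl; exact h hk
    · exact hat_of_notMem hg hz hx

/-- Near a point the triangulated set consists of the triangles with this point. -/
lemma exists_ball_subset_star (g : ℕ) (hz : z ∈ T₀.domain) : ∃ ε > 0, ∀ y, dist y z < ε →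
    (∃ K : T₀.Elem, K.gen = g ∧ y ∈ K.tri.body) ∧
    ∀ K : T₀.Elem, K.gen = g → y ∈ K.tri.body → z ∈ K.tri.body := by
  rw [domain_eq g] at hz
  have h1 : ∀ᶠ y in nhds z, ∃ K : T₀.Elem, K.gen = g ∧ y ∈ K.tri.body := by
    filter_upwards [mem_interior_iff_mem_nhds.1 hz] with y hy
    simpa using hy
  have h2 : ∀ᶠ y in nhds z, ∀ K ∈ T₀.level g, y ∈ K.tri.body → z ∈ K.tri.body := by
    rw [Filter.eventually_all_finset]
    intro K _
    by_cases hK : z ∈ K.tri.body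
    · exact Filter.Eventually.of_forall fun _ _ => hK
    · filter_upwards [Tri.isClosed_body.isOpen_compl.mem_nhds hK] with y hy hy'
      exact absurd hy' hy
  obtain ⟨ε, hε, h⟩ := Metric.eventually_nhds_iff.1 (h1.and h2)
  exact ⟨ε, hε, fun y hy => ⟨(h hy).1, fun K hK => (h hy).2 K (mem_level.2 hK)⟩⟩

/-- The star of an interior vertex, without its boundary, belongs to the domain. -/
lemma mem_domain_of_bary_pos {g : ℕ} (hz : z ∈ T₀.domain) {K : T₀.Elem} (hg : K.gen = g)
    {i : Fin 3} (hi : K.tri i = z) {x : Pt} (hx : x ∈ K.tri.body) (hpos : 0 < K.tri.bary i x) :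
    x ∈ T₀.domain := by
  obtain ⟨ε, hε, hball⟩ := exists_ball_subset_star g hz
  -- a homothety with centre `z` that moves a neighbourhood of `x` into the ball
  set δ : ℝ := min 1 (ε / (2 * (dist x z + 1))) with hδ
  have hd : 0 < dist x z + 1 := by positivity
  have hδ0 : 0 < δ := lt_min one_pos (by positivity)
  have hδ1 : δ ≤ 1 := min_le_left _ _
  set φ : Pt → Pt := fun y => AffineMap.lineMap z y δ with hφ
  have hφc : Continuous φ := by
    simp only [hφ, AffineMap.lineMap_apply]; fun_prop
  have hφd : ∀ y, dist y x < 1 → dist (φ y) z < ε := by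
    intro y hy
    rw [hφ, dist_lineMap_left, Real.norm_of_nonneg hδ0.le, dist_comm z y]
    have h1 : dist y z ≤ dist x z + 1 := by linarith [dist_triangle y x z]
    calc δ * dist y z ≤ ε / (2 * (dist x z + 1)) * (dist x z + 1) :=
          mul_le_mul (min_le_right _ _) h1 dist_nonneg (by positivity)
      _ = ε / 2 := by field_simp
      _ < ε := by linarith
  rw [domain_eq g, mem_interior_iff_mem_nhds]
  have hev : ∀ᶠ y in nhds x, ∀ L ∈ T₀.level g, z ∈ L.tri.body → φ y ∈ L.tri.body →
      y ∈ L.tri.body := by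
    rw [Filter.eventually_all_finset]
    intro L hL
    have hgL : L.gen = g := mem_level.1 hL
    by_cases hxL : φ x ∈ L.tri.body
    · by_cases hzL : z ∈ L.tri.body
      swap
      · exact Filter.Eventually.of_forall fun _ h => absurd h hzL
      have hzL' := hzL
      rw [← hi] at hzL'
      obtain ⟨l, hl⟩ := Elem.vertex_mem_range (hg.trans hgL.symm) hzL'
      rw [hi] at hl
      have hzK : z ∈ K.tri.body := hi ▸ Tri.vertex_mem_body i
      have hxK : φ x ∈ K.tri.body := K.tri.convex_body.lineMap_mem hzK hx ⟨hδ0.le, hδ1⟩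
      have he := (Elem.meet (hg.trans hgL.symm)).bary_eq K.det_ne L.det_ne hxK hxL
        (hi.trans hl.symm)
      have e1 : K.tri.bary i z = 1 := by rw [← hi, Tri.bary_self K.det_ne]
      have e2 : L.tri.bary l z = 1 := by rw [← hl, Tri.bary_self L.det_ne]
      simp only [hφ] at he
      rw [Tri.bary_lineMap, Tri.bary_lineMap, e1, e2] at he
      have he' : L.tri.bary l x = K.tri.bary i x :=
        (mul_left_cancel₀ hδ0.ne' (by linarith)).symm
      have hposL : ∀ᶠ y in nhds x, 0 < L.tri.bary l y :=
        (L.tri.continuous_bary l).continuousAt.eventually (lt_mem_nhds (by rwa [he']))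
      filter_upwards [hposL] with y hy _ hyL
      rw [Tri.mem_body L.det_ne]
      intro m
      by_cases hm : m = l
      · rw [hm]; exact hy.le
      · have := (Tri.mem_body L.det_ne _).1 hyL m
        simp only [hφ] at this
        rw [Tri.bary_lineMap, ← hl, Tri.bary_vertex_of_ne hm, mul_zero, zero_add] at this
        exact nonneg_of_mul_nonneg_right this hδ0
    · filter_upwards [hφc.continuousAt.preimage_mem_nhds
        (Tri.isClosed_body.isOpen_compl.mem_nhds hxL)] with y hy _ hyL
      exact absurd hyL hy
  filter_upwards [hev, Metric.ball_mem_nhds x one_pos] with y hy hyb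
  obtain ⟨⟨L, hgL, hyL⟩, hstar⟩ := hball (φ y) (hφd y hyb)
  simp only [Set.mem_iUnion, exists_prop]
  exact ⟨L, mem_level.2 hgL, hy L (mem_level.2 hgL) (hstar L hgL hyL) hyL⟩

lemma hat_eq_zero_of_notMem_domain (hz : z ∈ T₀.domain) {x : Pt} (hx : x ∉ T₀.domain) :
    T₀.hat j z x = 0 := by
  by_contra h
  obtain ⟨K, hg, i, hi, hxK, hne⟩ := exists_of_hat_ne_zero h
  exact hx (mem_domain_of_bary_pos hz hg hi hxK
    (lt_of_le_of_ne ((Tri.mem_body K.det_ne x).1 hxK i) hne.symm))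

lemma exists_affine_hat (K : T₀.Elem) (hg : K.gen = 2 * j) :
    ∃ A : Pt →ᵃ[ℝ] ℝ, ∀ x ∈ K.tri.body, T₀.hat j z x = A x := by
  by_cases hz : z ∈ Set.range K.tri
  · obtain ⟨i, hi⟩ := hz
    exact ⟨K.tri.baryMap i, fun x hx => hat_of_vertex hg hi hx⟩
  · exact ⟨0, fun x hx => hat_of_notMem hg hz hx⟩

lemma continuous_hat (hz : z ∈ T₀.domain) : Continuous (T₀.hat j z) := by
  let F : Option (T₀.level (2 * j)) → Set Pt := fun o =>
    o.elim T₀.domainᶜ fun K => K.1.tri.body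
  have hF : ⋃ o, F o = Set.univ := by
    rw [Set.eq_univ_iff_forall]
    intro x
    rw [Set.mem_iUnion]
    by_cases hx : x ∈ T₀.domain
    · rw [domain_eq (2 * j)] at hx
      have := interior_subset hx
      simp only [Set.mem_iUnion, exists_prop] at this
      obtain ⟨K, hK, hxK⟩ := this
      exact ⟨some ⟨K, hK⟩, hxK⟩
    · exact ⟨none, hx⟩
  refine (locallyFinite_of_finite F).continuous hF ?_ ?_
  · rintro (_ | K)
    · exact isOpen_interior.isClosed_compl
    · exact Tri.isClosed_body
  · rintro (_ | ⟨K, hK⟩)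
    · exact continuousOn_const.congr fun x hx => hat_eq_zero_of_notMem_domain hz hx
    · obtain ⟨A, hA⟩ := exists_affine_hat (z := z) K (mem_level.1 hK)
      exact A.continuous_of_finiteDimensional.continuousOn.congr hA

/-- The norm of a hat function is positive, so that the normalization is not degenerate. -/
lemma normV_hat_pos (hz : z ∈ T₀.interiorNodes j) : 0 < T₀.normV (T₀.hat j z) := by
  have hfd : ∀ K : T₀.Elem, K.gen = 2 * j → ∀ A : Pt →ᵃ[ℝ] ℝ,
      (∀ x ∈ K.tri.body, T₀.hat j z x = A x) → ∀ x ∈ K.tri.inner,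
      fderiv ℝ (T₀.hat j z) x = A.linear.toContinuousLinearMap := by
    intro K hg A hA x hx
    have : T₀.hat j z =ᶠ[nhds x] A := by
      filter_upwards [K.tri.isOpen_inner.mem_nhds hx] with y hy
      exact hA y (Tri.inner_subset_body K.det_ne hy)
    rw [this.fderiv_eq]
    have h2 : (A : Pt → ℝ) = fun y => A.linear.toContinuousLinearMap y + A 0 := by
      conv_lhs => rw [A.decomp]
      rfl
    rw [h2]
    exact (A.linear.toContinuousLinearMap.hasFDerivAt.add_const _).fderiv
  choose A hA using fun K : T₀.Elem => fun hg : K.gen = 2 * j => exists_affine_hat (z := z) K hg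
  -- the gradient is bounded almost everywhere
  obtain ⟨C, hC⟩ : ∃ C : ℝ, ∀ K : T₀.level (2 * j),
      ‖(A K.1 (mem_level.1 K.2)).linear.toContinuousLinearMap‖ ≤ C := by
    obtain ⟨C, hC⟩ := (Set.finite_range fun K : T₀.level (2 * j) =>
      ‖(A K.1 (mem_level.1 K.2)).linear.toContinuousLinearMap‖).bddAbove
    exact ⟨C, fun K => hC ⟨K, rfl⟩⟩
  have hnull : volume (⋃ K ∈ T₀.level (2 * j), ⋃ i : Fin 3, {x | K.tri.bary i x = 0}) = 0 :=
    volume_biUnion_finset_eq_zero _ fun K _ =>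
      measure_iUnion_null fun i => Tri.volume_bary_eq_zero K.det_ne i
  have hcov : ∀ x ∈ T₀.domain, x ∉ (⋃ K ∈ T₀.level (2 * j), ⋃ i, {x | K.tri.bary i x = 0}) →
      ∃ K : T₀.Elem, ∃ _ : K.gen = 2 * j, x ∈ K.tri.inner := by
    intro x hx hxn
    rw [domain_eq (2 * j)] at hx
    have := interior_subset hx
    simp only [Set.mem_iUnion, exists_prop] at this hxn
    obtain ⟨K, hK, hxK⟩ := this
    refine ⟨K, mem_level.1 hK, fun i => lt_of_le_of_ne ((Tri.mem_body K.det_ne x).1 hxK i) ?_⟩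
    exact fun h0 => hxn ⟨K, hK, i, h0.symm⟩
  have hdm : MeasurableSet T₀.domain := isOpen_interior.measurableSet
  have hvol : volume T₀.domain < ⊤ := by
    refine (measure_mono interior_subset).trans_lt ?_
    exact (isCompact_iUnion fun r => Tri.isCompact_body).measure_lt_top
  have hint : IntegrableOn (fun x => ‖fderiv ℝ (T₀.hat j z) x‖ ^ 2) T₀.domain := by
    refine Measure.integrableOn_of_bounded (M := C ^ 2) hvol.ne
      ((measurable_fderiv ℝ _).norm.pow_const 2).aestronglyMeasurable ?_
    rw [ae_restrict_iff' hdm]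
    filter_upwards [measure_eq_zero_iff_ae_notMem.1 hnull] with x hxn hx
    obtain ⟨K, hK, hxK⟩ := hcov x hx hxn
    rw [hfd K hK _ (hA K hK) x hxK, norm_pow, norm_norm]
    exact pow_le_pow_left₀ (norm_nonneg _) (hC ⟨K, mem_level.2 hK⟩) 2
  -- the gradient does not vanish on the triangles with vertex `z`
  obtain ⟨hzD, K, hK, i, hi⟩ := hz
  rw [mem_uniform] at hK
  rw [normV, Real.sqrt_pos, integral_pos_iff_support_of_nonneg (fun x => sq_nonneg _) hint,
    Measure.restrict_apply' hdm]
  have hsub : K.tri.inner ⊆ (Function.support fun x => ‖fderiv ℝ (T₀.hat j z) x‖ ^ 2) ∩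
      T₀.domain := by
    intro x hx
    refine ⟨?_, mem_domain_of_bary_pos hzD hK hi (Tri.inner_subset_body K.det_ne hx) (hx i)⟩
    have := hfd K hK (K.tri.baryMap i) (fun y hy => hat_of_vertex hK hi hy) x hx
    rw [Function.mem_support, this]
    intro h0
    have hl : (K.tri.baryMap i).linear = 0 := by
      have := norm_eq_zero.1 (pow_eq_zero_iff two_ne_zero |>.1 h0)
      ext v
      exact congrArg (fun f : Pt →L[ℝ] ℝ => f v) this
    have hv := (K.tri.baryMap i).linearMap_vsub (K.tri i) (K.tri (i + 1))
    rw [hl] at hv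
    simp [Tri.bary_self K.det_ne, Tri.bary_vertex_of_ne (fin_three_add_ne i).2.1] at hv
  exact (K.tri.isOpen_inner.measure_pos volume (Tri.inner_nonempty K.det_ne)).trans_le
    (measure_mono hsub)

/-! ### Which elements have to be bisected -/

variable (T₀) in
/-- The elements that have to be bisected in order to resolve the hat function of `z` of level
`j`: the parents of the triangles `K` of level `j` with vertex `z`. If `z` is vertex `1` of `K`, so
that it is the newest vertex of the parent, the hat function is affine on the parent, and it is the
grandparent that has to be bisected. -/
def Requires (j : ℕ) (z : Pt) (P : T₀.Elem) : Prop :=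
  ∃ K : T₀.Elem, ∃ k, 0 < j ∧ K.gen = 2 * j ∧ K.tri k = z ∧
    P = if k = 1 then K.parent.parent else K.parent

lemma node_ne_of_mem_feSpace {B : Finset T₀.Elem} (hf : T₀.hat j z ∈ T₀.feSpace (leaves B))
    {X : T₀.Elem} (hX : X ∉ B) (hg : X.gen < 2 * j) :
    z ≠ X.tri 1 ∧ z ≠ X.tri 2 ∧ z ≠ midpoint ℝ (X.tri 1) (X.tri 2) := by
  classical
  obtain ⟨n, hL⟩ := exists_up_mem_leaves X hX
  obtain ⟨A, hA⟩ := hf.2.2 _ hL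
  have hsub := X.body_subset_up n
  have hv : ∀ v, (∃ b, v ∈ Set.range (X.child b).tri) →
      T₀.hat j z v = if v = z then 1 else 0 := by
    rintro v ⟨b, hb⟩
    obtain ⟨K, hK, i, rfl⟩ := Elem.exists_vertex_descendant hb (2 * j - X.gen - 1)
    exact hat_vertex (by rw [hK, Elem.gen_child]; omega) i
  have h1 := hv _ ⟨false, 2, rfl⟩
  have h2 := hv _ ⟨true, 2, rfl⟩
  have h0 := hv _ ⟨true, 0, rfl⟩
  change T₀.hat j z (X.tri 1) = if X.tri 1 = z then 1 else 0 at h1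
  change T₀.hat j z (X.tri 2) = if X.tri 2 = z then 1 else 0 at h2
  change T₀.hat j z (midpoint ℝ (X.tri 1) (X.tri 2)) =
    if midpoint ℝ (X.tri 1) (X.tri 2) = z then 1 else 0 at h0
  rw [hA _ (hsub (Tri.vertex_mem_body 1))] at h1
  rw [hA _ (hsub (Tri.vertex_mem_body 2))] at h2
  rw [hA _ (hsub Tri.midpoint_mem_body), AffineMap.map_midpoint, h1, h2] at h0
  have n12 : X.tri 1 ≠ X.tri 2 := fun h => by
    have := Tri.injective X.det_ne h; simp at this
  have n1 : midpoint ℝ (X.tri 1) (X.tri 2) ≠ X.tri 1 := by simpa [midpoint_eq_left_iff] using n12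
  have n2 : midpoint ℝ (X.tri 1) (X.tri 2) ≠ X.tri 2 := by simpa [midpoint_eq_right_iff] using n12
  refine ⟨?_, ?_, ?_⟩ <;> rintro rfl
  · rw [if_pos rfl, if_neg n12.symm, if_neg n1] at h0
    simp [midpoint_eq_smul_add] at h0
  · rw [if_pos rfl, if_neg n12, if_neg n2] at h0
    simp [midpoint_eq_smul_add] at h0
  · rw [if_pos rfl, if_neg n1.symm, if_neg n2.symm] at h0
    simp at h0

lemma hat_mem_feSpace_iff (hz : z ∈ T₀.domain) {B : Finset T₀.Elem} (hB : ParentClosed B) :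
    T₀.hat j z ∈ T₀.feSpace (leaves B) ↔ ∀ P, T₀.Requires j z P → P ∈ B := by
  constructor
  · rintro hf P ⟨K, k, hj, hg, hk, rfl⟩
    obtain ⟨X, b, hX, rfl⟩ := Elem.exists_child_of_gen (g := 2 * j - 2 + 1) (K := K) (by omega)
    obtain ⟨G, c, hG, rfl⟩ := Elem.exists_child_of_gen hX
    by_contra hcon
    split_ifs at hcon with h1
    · subst h1
      exact (node_ne_of_mem_feSpace hf hcon (by simp; omega)).2.2 hk.symm
    · obtain ⟨n1, n2, n0⟩ := node_ne_of_mem_feSpace hf hcon (by simp; omega)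
      rw [Elem.parent_child] at n1 n2 n0
      rcases fin_three_cases k with rfl | rfl | rfl
      · exact n0 hk.symm
      · exact h1 rfl
      · rw [Elem.tri_child, Tri.bisect_two] at hk
        cases b
        · exact n1 hk.symm
        · exact n2 hk.symm
  · intro hreq
    refine ⟨continuous_hat hz, fun x hx => hat_eq_zero_of_notMem_domain hz hx, fun K hK => ?_⟩
    rcases le_or_gt (2 * j) K.gen with hg | hg
    · obtain ⟨A, hA⟩ := exists_affine_hat (j := j) (z := z)
        (K.up (K.gen - 2 * j)) (by rw [Elem.gen_up]; omega)
      exact ⟨A, fun x hx => hA x (K.body_subset_up _ hx)⟩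
    · obtain ⟨n, hn⟩ : ∃ n, 2 * j = K.gen + (n + 1) := ⟨2 * j - K.gen - 1, by omega⟩
      have hKB := (mem_leaves.1 hK).2
      by_cases hex : ∃ K' : T₀.Elem, K'.gen = 2 * j ∧ K'.up (n + 1) = K ∧ z ∈ Set.range K'.tri
      · obtain ⟨K', hg', hup, k, hk⟩ := hex
        have hr := hreq _ ⟨K', k, by omega, hg', hk, rfl⟩
        by_cases h1 : k = 1
        · subst h1
          rw [if_pos rfl] at hr
          rcases n with _ | n
          · obtain ⟨b, hb⟩ := Elem.exists_eq_child (K := K') (by omega)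
            have hKK : K'.parent = K := hup
            rw [hKK] at hb
            subst hb
            refine ⟨K.tri.baryMap 0, fun x hx => ?_⟩
            obtain ⟨c, hc⟩ := Tri.exists_mem_body_bisect K.det_ne hx
            rw [hat_of_vertex (K := K.child c) (i := 1) hg' hk hc]
            exact Tri.bary_bisect_one c K.det_ne x
          · exact absurd (hup ▸ hB.up_mem hr n) hKB
        · rw [if_neg h1] at hr
          exact absurd (hup ▸ hB.up_mem hr n) hKB
      · refine ⟨0, fun x hx => ?_⟩
        obtain ⟨K', hg', hup, hx'⟩ := Elem.exists_up_eq (n + 1) K hx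
        rw [← hn] at hg'
        exact hat_of_notMem hg' (fun h => hex ⟨K', hg', hup, h⟩) hx'

end Hat

/-- The conforming meshes that resolve a set of frame elements. -/
lemma resolves_leaves_iff {B : Finset T₀.Elem} (hB : ParentClosed B) (hP : PartnerClosed B)
    (Θ : Finset T₀.FrameIndex) :
    T₀.Resolves (leaves B) Θ ↔ ∀ i ∈ Θ, ∀ P, T₀.Requires i.level i.node P → P ∈ B := by
  have hc : T₀.IsConformingMesh (leaves B) := isConformingMesh_iff.2 ⟨B, hB, hP, rfl⟩
  rw [Resolves, and_iff_right hc, Submodule.span_le, Set.image_subset_iff]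
  refine forall₂_congr fun i _ => ?_
  rw [← hat_mem_feSpace_iff i.mem.1 hB, Set.mem_preimage, SetLike.mem_coe, psi]
  exact Submodule.smul_mem_iff _ (inv_ne_zero (normV_hat_pos i.mem).ne')

/-- A node and its parent are close to each other: the node belongs to a triangle of which the
grandparent has the parent node as a vertex. -/
lemma IsFrameParent.exists_elem {p i : T₀.FrameIndex} (h : T₀.IsFrameParent p i) :
    ∃ K : T₀.Elem, K.gen = 2 * i.level ∧ i.node ∈ Set.range K.tri ∧
      p.node ∈ Set.range (K.up 2).tri := by
  classical
  obtain ⟨hl, hvol⟩ := h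
  have hts : ∀ q : T₀.FrameIndex, tsupport (T₀.psi q) ⊆
      ⋃ K ∈ (T₀.level (2 * q.level)).filter fun K => q.node ∈ Set.range K.tri, K.tri.body := by
    intro q
    refine closure_minimal ?_ (isClosed_biUnion_finset fun _ _ => Tri.isClosed_body)
    intro x hx
    rw [Function.mem_support, psi, Pi.smul_apply, smul_eq_mul] at hx
    obtain ⟨K, hg, k, hk, hxK, -⟩ := exists_of_hat_ne_zero (right_ne_zero_of_mul hx)
    simp only [Set.mem_iUnion]
    exact ⟨K, Finset.mem_filter.2 ⟨mem_level.2 hg, k, hk⟩, hxK⟩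
  by_contra! hcon
  refine hvol.ne' (measure_mono_null (Set.inter_subset_inter (hts i) (hts p)) ?_)
  rw [Set.iUnion₂_inter]
  refine volume_biUnion_finset_eq_zero _ fun K hK => ?_
  rw [Set.inter_iUnion₂]
  refine volume_biUnion_finset_eq_zero _ fun G hG => ?_
  obtain ⟨hK, hiK⟩ := Finset.mem_filter.1 hK
  obtain ⟨hG, hpG⟩ := Finset.mem_filter.1 hG
  rw [mem_level] at hK hG
  have hne : K.up 2 ≠ G := by
    rintro rfl
    exact hcon K hK hiK hpG
  refine measure_mono_null (Set.inter_subset_inter_left _ (K.body_subset_up 2))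
    (Elem.volume_inter_eq_zero ?_ hne)
  rw [Elem.gen_up]; omega

end InitialMesh

/-! ### The number of elements that have to be bisected -/

namespace InitialMesh

variable {T₀ : InitialMesh}

/-- The elements that are bisected in the smallest conforming mesh in which all elements of `R` are
bisected. -/
inductive Needed (R : T₀.Elem → Prop) : T₀.Elem → Prop
  | base {K} : R K → Needed R K
  | parent {K b} : Needed R (Elem.child K b) → Needed R K
  | partner {K L} : Needed R K → Elem.IsNbr 0 K L → Needed R L

variable (T₀) in
/-- The elements required by one of the frame elements with indices in `Θ`. -/
def Required (Θ : Finset T₀.FrameIndex) (P : T₀.Elem) : Prop :=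
  ∃ i ∈ Θ, T₀.Requires i.level i.node P

lemma scale_succ_of_even (n : ℕ) : scale (2 * n + 1) = scale (2 * n) := by
  simp only [scale]
  congr 1
  omega

lemma scale_of_odd (n : ℕ) : scale (2 * n + 1) = 2 * scale (2 * (n + 1)) := by
  rw [scale_succ_of_even]
  simp only [scale]
  rw [show 2 * n / 2 = n by omega, show 2 * (n + 1) / 2 = n + 1 by omega, pow_succ]
  ring

variable (T₀) in
/-- `K` is near the node of level `K.gen / 2 + 1` with index `i`, up to the constant `d`. The factors
`3` and `4` are chosen such that nearness is inherited by parents: passing from an odd generation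
to the next lower one costs `d`, for the step to a neighbour; the step from an even generation costs
`2 * d`, as the node is replaced by its parent as well, but it doubles the scale. -/
def Near (d : ℝ) (i : T₀.FrameIndex) (K : T₀.Elem) : Prop :=
  i.level = K.gen / 2 + 1 ∧ ∃ x ∈ K.tri.body,
    dist i.node x ≤ (if Even K.gen then 4 else 3) * (d * scale K.gen)

/-- All needed elements, or their neighbours across the refinement edge, are near a node of `Θ` of
the corresponding level. This is the place where the tree structure of `Θ` is used. -/
lemma near_of_needed {d : ℝ} (hd0 : 0 ≤ d)
    (hd : ∀ K : T₀.Elem, ∀ x ∈ K.tri.body, ∀ y ∈ K.tri.body, dist x y ≤ d * scale K.gen)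
    {Θ : Finset T₀.FrameIndex}
    (hΘ : ∀ i ∈ Θ, 0 < i.level → ∃ p ∈ Θ, T₀.IsFrameParent p i) {K : T₀.Elem}
    (hK : Needed (T₀.Required Θ) K) :
    ∃ i ∈ Θ, ∃ M, T₀.Near d i M ∧ (M = K ∨ Elem.IsNbr 0 M K) := by
  induction hK with
  | @base P hP =>
    obtain ⟨i, hi, K, k, hj, hg, hk, rfl⟩ := hP
    have hz : i.node ∈ K.tri.body := hk ▸ Tri.vertex_mem_body k
    have h1 : i.node ∈ K.parent.tri.body := K.body_subset_parent hz
    refine ⟨i, hi, _, ⟨?_, i.node, ?_, ?_⟩, Or.inl rfl⟩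
    · split_ifs <;> simp only [Elem.gen_parent] <;> omega
    · split_ifs
      · exact K.parent.body_subset_parent h1
      · exact h1
    · rw [dist_self]
      have := scale_pos (if k = 1 then K.parent.parent else K.parent).gen
      exact mul_nonneg (by split_ifs <;> norm_num) (mul_nonneg hd0 this.le)
  | @partner K L _ hKL ih =>
    obtain ⟨i, hi, M, hM, rfl | hMK⟩ := ih
    · exact ⟨i, hi, M, hM, Or.inr hKL⟩
    · exact ⟨i, hi, M, hM, Or.inl (hMK.symm.unique hKL)⟩
  | @parent K b _ ih =>
    obtain ⟨i, hi, M, ⟨hl, x, hx, hdist⟩, hM⟩ := ih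
    have hg : M.gen = K.gen + 1 := by
      rcases hM with rfl | hM
      · rfl
      · exact hM.1
    obtain ⟨y, hyK, hy⟩ : ∃ y ∈ K.tri.body, dist i.node y ≤
        ((if Even M.gen then 4 else 3) + 1) * (d * scale M.gen) := by
      rcases hM with rfl | hM
      · refine ⟨x, K.body_child_subset b hx, hdist.trans ?_⟩
        have := mul_nonneg hd0 (scale_pos (K.child b).gen).le
        linarith
      · refine ⟨M.tri 1, K.body_child_subset b (Elem.range_subset_body _ hM.2.2.1), ?_⟩
        have := hd M x hx _ (Tri.vertex_mem_body 1)
        linarith [dist_triangle i.node x (M.tri 1)]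
    rw [hg] at hy hl
    rcases Nat.even_or_odd' K.gen with ⟨n, hn | hn⟩
    · refine ⟨i, hi, K, ⟨by omega, y, hyK, ?_⟩, Or.inl rfl⟩
      rw [hn, if_neg (by simp), scale_succ_of_even] at hy
      rw [hn, if_pos (by simp)]
      linarith
    · obtain ⟨p, hp, hpi⟩ := hΘ i hi (by omega)
      obtain ⟨X, hX, hiX, hpX⟩ := hpi.exists_elem
      have hlev := hpi.1
      refine ⟨p, hp, K, ⟨by omega, y, hyK, ?_⟩, Or.inl rfl⟩
      have h1 := hd (X.up 2) _ (Elem.range_subset_body _ hpX) _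
        (X.body_subset_up 2 (Elem.range_subset_body _ hiX))
      rw [Elem.gen_up, hX, show 2 * i.level - 2 = 2 * (n + 1) by omega] at h1
      rw [hn, show 2 * n + 1 + 1 = 2 * (n + 1) by ring, if_pos (by simp)] at hy
      rw [hn, if_neg (by simp), scale_of_odd]
      linarith [dist_triangle p.node i.node y]

open Classical in
/-- The number of needed elements is proportional to the number of frame elements. -/
theorem exists_card_needed_le (T₀ : InitialMesh) : ∃ N : ℕ, ∀ Θ : Finset T₀.FrameIndex,
    (∀ i ∈ Θ, 0 < i.level → ∃ p ∈ Θ, T₀.IsFrameParent p i) →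
    ∃ B : Finset T₀.Elem, (∀ K, K ∈ B ↔ Needed (T₀.Required Θ) K) ∧ B.card ≤ N * Θ.card := by
  obtain ⟨d, hd0, hd⟩ := T₀.exists_diam_bound
  obtain ⟨N, hN⟩ := T₀.exists_card_near_le (4 * d) (by positivity)
  refine ⟨4 * N, fun Θ hΘ => ?_⟩
  let near : T₀.FrameIndex → ℕ → Finset T₀.Elem := fun i g =>
    (T₀.level g).filter fun K => T₀.Near d i K
  have hnear : ∀ i g, (near i g).card ≤ N := fun i g => by
    refine hN g i.node _ fun K hK => ?_
    obtain ⟨hK, -, x, hx, hdist⟩ := Finset.mem_filter.1 hK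
    rw [mem_level] at hK
    refine ⟨hK, x, hx, hdist.trans ?_⟩
    rw [← hK]
    have := mul_nonneg hd0 (scale_pos K.gen).le
    split_ifs <;> linarith
  let A : Finset T₀.Elem :=
    Θ.biUnion fun i => near i (2 * (i.level - 1)) ∪ near i (2 * (i.level - 1) + 1)
  have hA : A.card ≤ Θ.card * (2 * N) := by
    refine Finset.card_biUnion_le_card_mul _ _ _ fun i _ => (Finset.card_union_le _ _).trans ?_
    linarith [hnear i (2 * (i.level - 1)), hnear i (2 * (i.level - 1) + 1)]
  let f : T₀.Elem → T₀.Elem := fun M => if h : ∃ K, Elem.IsNbr 0 M K then h.choose else M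
  let S := A ∪ A.image f
  have hS : S.card ≤ 4 * N * Θ.card := by
    have := (Finset.card_union_le A (A.image f)).trans
      (add_le_add_right Finset.card_image_le A.card)
    calc S.card ≤ _ := this
      _ ≤ _ := by linarith
  refine ⟨S.filter fun K => Needed (T₀.Required Θ) K, fun K => ?_,
    (Finset.card_filter_le _ _).trans hS⟩
  rw [Finset.mem_filter, and_iff_right_iff_imp]
  intro hK
  obtain ⟨i, hi, M, hM, hMK⟩ := near_of_needed hd0 hd hΘ hK
  have hMA : M ∈ A := by
    refine Finset.mem_biUnion.2 ⟨i, hi, ?_⟩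
    have hl := hM.1
    rcases Nat.even_or_odd' M.gen with ⟨n, hn | hn⟩
    · exact Finset.mem_union_left _ (Finset.mem_filter.2 ⟨mem_level.2 (by omega), hM⟩)
    · exact Finset.mem_union_right _ (Finset.mem_filter.2 ⟨mem_level.2 (by omega), hM⟩)
  rcases hMK with rfl | hMK
  · exact Finset.mem_union_left _ hMA
  · refine Finset.mem_union_right _ (Finset.mem_image.2 ⟨M, hMA, ?_⟩)
    have h : ∃ K, Elem.IsNbr 0 M K := ⟨K, hMK⟩
    change (if h : ∃ K, Elem.IsNbr 0 M K then h.choose else M) = K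
    rw [dif_pos h]
    exact h.choose_spec.unique hMK

lemma parentClosed_of_needed {R : T₀.Elem → Prop} {B : Finset T₀.Elem}
    (h : ∀ K, K ∈ B ↔ Needed R K) : ParentClosed B :=
  fun K _ hK => (h K).2 (.parent ((h _).1 hK))

lemma partnerClosed_of_needed {R : T₀.Elem → Prop} {B : Finset T₀.Elem}
    (h : ∀ K, K ∈ B ↔ Needed R K) : PartnerClosed B :=
  fun K hK L hL => (h L).2 (.partner ((h K).1 hK) hL)

lemma needed_subset {R : T₀.Elem → Prop} {B : Finset T₀.Elem} (hB : ParentClosed B)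
    (hP : PartnerClosed B) (hR : ∀ K, R K → K ∈ B) {K : T₀.Elem} (hK : Needed R K) : K ∈ B := by
  induction hK with
  | base h => exact hR _ h
  | parent _ ih => exact hB _ _ ih
  | partner _ h ih => exact hP _ ih _ h

/-- Bisecting the needed elements gives the smallest mesh. -/
theorem isSmallestMesh_leaves {Θ : Finset T₀.FrameIndex} {B : Finset T₀.Elem}
    (h : ∀ K, K ∈ B ↔ Needed (T₀.Required Θ) K) : T₀.IsSmallestMesh (leaves B) Θ := by
  have hB := parentClosed_of_needed h
  have hP := partnerClosed_of_needed h
  refine ⟨(resolves_leaves_iff hB hP Θ).2 fun i hi P hPi => (h P).2 (.base ⟨i, hi, hPi⟩), ?_⟩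
  intro T' hT'
  obtain ⟨B', hB', hP', rfl⟩ := isConformingMesh_iff.1 hT'.1
  refine leaves_refines hB hB' fun K hK => needed_subset hB' hP' ?_ ((h K).1 hK)
  rintro K ⟨i, hi, hiK⟩
  exact (resolves_leaves_iff hB' hP' Θ).1 hT' i hi K hiK

end InitialMesh

/-! ### Walking around an interior vertex -/

namespace InitialMesh

variable {T₀ : InitialMesh}

/-- Every edge at an interior vertex has a triangle on its other side. -/
lemma exists_isNbr_of_interior {K : T₀.Elem} {i m : Fin 3} (hz : K.tri i ∈ T₀.domain)
    (him : i ≠ m) : ∃ L, Elem.IsNbr m K L := by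
  classical
  obtain ⟨k, hki, hkm, hk⟩ : ∃ k, k ≠ i ∧ k ≠ m ∧ ∀ n, n ≠ m → n = i ∨ n = k := by
    clear hz; revert i m; decide
  -- a point of the open edge near the vertex
  have hcont : Continuous fun t : ℝ => (AffineMap.lineMap (K.tri i) (K.tri k) t : Pt) := by
    simp only [AffineMap.lineMap_apply]; fun_prop
  have hopen : IsOpen T₀.domain := isOpen_interior
  have hev : ∀ᶠ t in nhdsWithin (0 : ℝ) (Set.Ioi 0),
      0 < t ∧ t < 1 ∧ (AffineMap.lineMap (K.tri i) (K.tri k) t : Pt) ∈ T₀.domain := by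
    refine (eventually_mem_nhdsWithin (s := Set.Ioi (0 : ℝ))).and
      (Filter.Eventually.filter_mono nhdsWithin_le_nhds ?_)
    refine Filter.Eventually.and (Iio_mem_nhds zero_lt_one) ?_
    exact hcont.continuousAt.preimage_mem_nhds (hopen.mem_nhds (by simpa using hz))
  obtain ⟨t, ht0, ht1, hy⟩ := hev.exists
  set y : Pt := AffineMap.lineMap (K.tri i) (K.tri k) t with hydef
  have hyK : y ∈ K.tri.body :=
    Tri.convex_body.lineMap_mem (Tri.vertex_mem_body i) (Tri.vertex_mem_body k) ⟨ht0.le, ht1.le⟩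
  have bm : K.tri.bary m y = 0 := by
    rw [hydef, Tri.bary_lineMap, Tri.bary_vertex_of_ne him.symm, Tri.bary_vertex_of_ne hkm.symm]
    ring
  have bn : ∀ n, n ≠ m → K.tri.bary n y ≠ 0 := by
    intro n hn
    rw [hydef, Tri.bary_lineMap]
    rcases hk n hn with rfl | rfl
    · rw [Tri.bary_self K.det_ne, Tri.bary_vertex_of_ne hki.symm]
      linarith
    · rw [Tri.bary_self K.det_ne, Tri.bary_vertex_of_ne hki]
      linarith
  -- points behind the edge belong to other triangles of the generation
  have hc2 : Continuous fun s : ℝ => (AffineMap.lineMap y (K.tri m) (-s) : Pt) := by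
    simp only [AffineMap.lineMap_apply]; fun_prop
  have hmem : y ∈ ⋃ L ∈ (T₀.level K.gen).filter fun L => K ≠ L, L.tri.body := by
    have hcl : IsClosed (⋃ L ∈ (T₀.level K.gen).filter fun L => K ≠ L, L.tri.body) :=
      isClosed_biUnion_finset fun _ _ => Tri.isClosed_body
    have ht : Filter.Tendsto (fun s : ℝ => (AffineMap.lineMap y (K.tri m) (-s) : Pt))
        (nhdsWithin 0 (Set.Ioi 0)) (nhds y) := by
      have := hc2.tendsto 0
      rw [neg_zero, AffineMap.lineMap_apply_zero] at this
      exact this.mono_left nhdsWithin_le_nhds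
    refine hcl.mem_of_tendsto ht ?_
    filter_upwards [eventually_mem_nhdsWithin, ht (hopen.mem_nhds hy)] with s hs hsD
    rw [Set.mem_preimage, domain_eq K.gen] at hsD
    have := interior_subset hsD
    simp only [Set.mem_iUnion, exists_prop] at this ⊢
    obtain ⟨L, hL, hsL⟩ := this
    refine ⟨L, Finset.mem_filter.2 ⟨hL, ?_⟩, hsL⟩
    rintro rfl
    have := (Tri.mem_body K.det_ne _).1 hsL m
    rw [Tri.bary_lineMap, bm, Tri.bary_self K.det_ne] at this
    have hs' : (0 : ℝ) < s := hs
    linarith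
  simp only [Set.mem_iUnion, exists_prop] at hmem
  obtain ⟨L, hL, hyL⟩ := hmem
  obtain ⟨hL, hne⟩ := Finset.mem_filter.1 hL
  have hg : K.gen = L.gen := (mem_level.1 hL).symm
  have hm := Elem.meet hg
  exact ⟨L, hg, hne,
    hm.mem_range_of_bary_ne K.det_ne hyK hyL (bn _ (fin_three_add_ne m).2.1.symm),
    hm.mem_range_of_bary_ne K.det_ne hyK hyL (bn _ (fin_three_add_ne m).2.2.symm)⟩

lemma exists_mem_body_dist_eq {K : T₀.Elem} {z : Pt} (hz : z ∈ Set.range K.tri) :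
    ∃ D > 0, ∀ δ, 0 ≤ δ → δ ≤ D → ∃ x ∈ K.tri.body, dist x z = δ := by
  obtain ⟨i, rfl⟩ := hz
  have hne : K.tri i ≠ K.tri (i + 1) := fun h =>
    (fin_three_add_ne i).2.1 (Tri.injective K.det_ne h)
  have hD := dist_pos.2 hne
  refine ⟨dist (K.tri i) (K.tri (i + 1)), hD, fun δ h0 h1 => ?_⟩
  refine ⟨AffineMap.lineMap (K.tri i) (K.tri (i + 1)) (δ / dist (K.tri i) (K.tri (i + 1))),
    Tri.convex_body.lineMap_mem (Tri.vertex_mem_body _) (Tri.vertex_mem_body _)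
      ⟨by positivity, (div_le_one hD).2 h1⟩, ?_⟩
  rw [dist_lineMap_left, Real.norm_of_nonneg (by positivity)]
  field_simp

/-- The triangles at an interior vertex are connected via common edges at this vertex: a small
circle around the vertex is connected, and triangles without a common edge meet only in the
vertex. -/
lemma star_connected {g : ℕ} {z : Pt} (hz : z ∈ T₀.domain) (W : Set T₀.Elem) {K₀ : T₀.Elem}
    (hK₀ : K₀ ∈ W) (hg₀ : K₀.gen = g) (hz₀ : z ∈ Set.range K₀.tri)
    (hW : ∀ K ∈ W, ∀ L : T₀.Elem, K.gen = g → L.gen = g → z ∈ Set.range K.tri →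
      z ∈ Set.range L.tri → K ≠ L → ∀ v ≠ z, v ∈ Set.range K.tri → v ∈ Set.range L.tri → L ∈ W)
    {L : T₀.Elem} (hgL : L.gen = g) (hzL : z ∈ Set.range L.tri) : L ∈ W := by
  classical
  by_contra hL
  obtain ⟨ε, hε, hball⟩ := exists_ball_subset_star g hz
  obtain ⟨D₁, hD₁, h₁⟩ := exists_mem_body_dist_eq hz₀
  obtain ⟨D₂, hD₂, h₂⟩ := exists_mem_body_dist_eq hzL
  set δ := min (ε / 2) (min D₁ D₂)
  have hδ : 0 < δ := lt_min (by positivity) (lt_min hD₁ hD₂)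
  have hδε : δ < ε := (min_le_left _ _).trans_lt (by linarith)
  obtain ⟨x₁, hx₁, hd₁⟩ := h₁ δ hδ.le ((min_le_right _ _).trans (min_le_left _ _))
  obtain ⟨x₂, hx₂, hd₂⟩ := h₂ δ hδ.le ((min_le_right _ _).trans (min_le_right _ _))
  let S : Finset T₀.Elem := (T₀.level g).filter fun K => z ∈ Set.range K.tri
  have hS : ∀ K, K ∈ S ↔ K.gen = g ∧ z ∈ Set.range K.tri := fun K => by
    simp only [S, Finset.mem_filter, mem_level]
  have hpre := isPreconnected_closed_iff.1 (isPreconnected_sphere (E := Pt)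
    (by rw [← Module.finrank_eq_rank, finrank_euclideanSpace_fin]; norm_num) z δ)
    (⋃ K ∈ S.filter fun K => K ∈ W, K.tri.body) (⋃ K ∈ S.filter fun K => K ∉ W, K.tri.body)
    (isClosed_biUnion_finset fun _ _ => Tri.isClosed_body)
    (isClosed_biUnion_finset fun _ _ => Tri.isClosed_body) ?_ ?_ ?_
  · obtain ⟨x, hxs, hx⟩ := hpre
    simp only [Set.mem_inter_iff, Set.mem_iUnion, exists_prop] at hx
    obtain ⟨⟨K, hK, hxK⟩, M, hM, hxM⟩ := hx
    obtain ⟨hK, hKW⟩ := Finset.mem_filter.1 hK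
    obtain ⟨hM, hMW⟩ := Finset.mem_filter.1 hM
    obtain ⟨hgK, hzK⟩ := (hS K).1 hK
    obtain ⟨hgM, hzM⟩ := (hS M).1 hM
    have hne : K ≠ M := by rintro rfl; exact hMW hKW
    have hxz : x ≠ z := by
      rintro rfl
      rw [Metric.mem_sphere, dist_self] at hxs
      exact hδ.ne hxs
    refine hMW ?_
    by_contra hcon
    have hz1 : ∀ n, K.tri n ≠ z → K.tri.bary n x = 0 := by
      intro n hn
      by_contra hb
      exact hMW (hW K hKW M hgK hgM hzK hzM hne _ hn ⟨n, rfl⟩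
        ((Elem.meet (hgK.trans hgM.symm)).mem_range_of_bary_ne K.det_ne hxK hxM hb))
    obtain ⟨i, hi⟩ := hzK
    have hi1 : K.tri.bary i x = 1 := by
      rw [← Tri.sum_bary K.det_ne x, Finset.sum_eq_single i]
      · intro n _ hn
        exact hz1 n fun h => hn (Tri.injective K.det_ne (h.trans hi.symm))
      · simp
    exact hxz ((Tri.eq_vertex_of_bary_eq_one K.det_ne hxK hi1).trans hi)
  · intro x hx
    obtain ⟨⟨K, hgK, hxK⟩, hst⟩ := hball x (by rw [Metric.mem_sphere.1 hx]; exact hδε)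
    have hzK : z ∈ Set.range K.tri := by
      have := hst K hgK hxK
      obtain ⟨i, hi⟩ := hz₀
      rw [← hi] at this ⊢
      exact Elem.vertex_mem_range (hg₀.trans hgK.symm) this
    by_cases hKW : K ∈ W
    · left
      simp only [Set.mem_iUnion, exists_prop]
      exact ⟨K, Finset.mem_filter.2 ⟨(hS K).2 ⟨hgK, hzK⟩, hKW⟩, hxK⟩
    · right
      simp only [Set.mem_iUnion, exists_prop]
      exact ⟨K, Finset.mem_filter.2 ⟨(hS K).2 ⟨hgK, hzK⟩, hKW⟩, hxK⟩
  · refine ⟨x₁, hd₁, ?_⟩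
    simp only [Set.mem_iUnion, exists_prop]
    exact ⟨K₀, Finset.mem_filter.2 ⟨(hS _).2 ⟨hg₀, hz₀⟩, hK₀⟩, hx₁⟩
  · refine ⟨x₂, hd₂, ?_⟩
    simp only [Set.mem_iUnion, exists_prop]
    exact ⟨L, Finset.mem_filter.2 ⟨(hS _).2 ⟨hgL, hzL⟩, hL⟩, hx₂⟩

/-- One step of the walk around vertex `keep b`: across the refinement edge, and then across the
other edge at this vertex, which is opposite vertex `keep (!b)`. -/
def WalkStep (b : Bool) (K L : T₀.Elem) : Prop :=
  ∃ Q, Elem.IsNbr 0 K Q ∧ Elem.IsNbr (keep (!b)) Q L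

lemma Elem.isNbr_two_child (K : T₀.Elem) (b : Bool) : IsNbr 2 (K.child b) (K.child !b) := by
  refine ⟨rfl, fun h => ?_, ⟨0, rfl⟩, ⟨1, rfl⟩⟩
  rw [child_inj] at h
  revert h; cases b <;> simp

/-- Neighbours across an edge at the newest vertex list the vertices of this edge in the same
order. -/
lemma Elem.IsNbr.keep_vertices {b : Bool} {K L : T₀.Elem} (h : IsNbr (keep b) K L)
    (hg : 0 < K.gen) : L.tri 0 = K.tri 0 ∧ L.tri (keep (!b)) = K.tri (keep (!b)) := by
  obtain ⟨c, hc⟩ := exists_eq_child hg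
  rw [hc] at h ⊢
  cases b
  · exact h.one_vertices
  · rw [IsNbr.unique h (isNbr_two_child _ c)]
    exact ⟨rfl, rfl⟩

lemma Elem.IsNbr.symm_keep {b : Bool} {K L : T₀.Elem} (h : IsNbr (keep b) K L)
    (hg : 0 < K.gen) : IsNbr (keep b) L K := by
  obtain ⟨h0, h1⟩ := h.keep_vertices hg
  refine ⟨h.1.symm, h.2.1.symm, ?_⟩
  cases b
  · exact ⟨⟨2, h1.symm⟩, ⟨0, h0.symm⟩⟩
  · exact ⟨⟨0, h0.symm⟩, ⟨1, h1.symm⟩⟩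

lemma Elem.IsNbr.tri_keep {K L : T₀.Elem} (h : IsNbr 0 K L) (hg : 2 ≤ K.gen) (b : Bool) :
    L.tri (keep b) = K.tri (keep b) := by
  cases b
  · exact (h.order hg).1
  · exact (h.order hg).2

section Walk

variable {b : Bool} {K L M : T₀.Elem}

lemma WalkStep.gen_eq (h : WalkStep b K L) : L.gen = K.gen := by
  obtain ⟨Q, h1, h2⟩ := h
  exact h2.1.symm.trans h1.1.symm

lemma WalkStep.tri_keep (h : WalkStep b K L) (hg : 2 ≤ K.gen) :
    L.tri (keep b) = K.tri (keep b) := by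
  obtain ⟨Q, h1, h2⟩ := h
  have := (h2.keep_vertices (by rw [← h1.1]; omega)).2
  rw [Bool.not_not] at this
  rw [this, h1.tri_keep hg]

lemma WalkStep.unique (hL : WalkStep b K L) (hM : WalkStep b K M) : L = M := by
  obtain ⟨Q, h1, h2⟩ := hL
  obtain ⟨Q', h1', h2'⟩ := hM
  obtain rfl := h1.unique h1'
  exact h2.unique h2'

lemma WalkStep.injective (hK : WalkStep b K M) (hL : WalkStep b L M) (hg : 0 < M.gen) : K = L := by
  obtain ⟨Q, h1, h2⟩ := hK
  obtain ⟨Q', h1', h2'⟩ := hL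
  have e := (h2.symm_keep (h2.1 ▸ hg)).unique (h2'.symm_keep (h2'.1 ▸ hg))
  subst e
  exact h1.symm.unique h1'.symm

lemma exists_walkStep (hz : K.tri (keep b) ∈ T₀.domain) (hg : 2 ≤ K.gen) :
    ∃ L, WalkStep b K L := by
  obtain ⟨Q, hQ⟩ := exists_isNbr_of_interior (m := 0) hz (keep_ne_zero b)
  rw [← hQ.tri_keep hg b] at hz
  obtain ⟨L, hL⟩ := exists_isNbr_of_interior (m := keep (!b)) hz (keep_ne_keep_not b)
  exact ⟨L, Q, hQ, hL⟩

end Walk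

open Classical in
/-- The walk around vertex `keep b`, as a function. -/
noncomputable def walk (b : Bool) (K : T₀.Elem) : T₀.Elem :=
  if h : ∃ L, WalkStep b K L then h.choose else K

section Walk

variable {b : Bool} {K : T₀.Elem}

lemma walkStep_walk (hz : K.tri (keep b) ∈ T₀.domain) (hg : 2 ≤ K.gen) :
    WalkStep b K (walk b K) := by
  have h := exists_walkStep hz hg
  rw [walk, dif_pos h]
  exact h.choose_spec

lemma iterate_walk (hz : K.tri (keep b) ∈ T₀.domain) (hg : 2 ≤ K.gen) (t : ℕ) :
    ((walk b)^[t] K).gen = K.gen ∧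
    ((walk b)^[t] K).tri (keep b) = K.tri (keep b) := by
  induction t with
  | zero => exact ⟨rfl, rfl⟩
  | succ t ih =>
    rw [Function.iterate_succ_apply']
    obtain ⟨h1, h2⟩ := ih
    have hs := walkStep_walk (K := (walk b)^[t] K) (by rwa [h2]) (by omega)
    exact ⟨hs.gen_eq.trans h1, (hs.tri_keep (by omega)).trans h2⟩

lemma walkStep_iterate (hz : K.tri (keep b) ∈ T₀.domain) (hg : 2 ≤ K.gen) (t : ℕ) :
    WalkStep b ((walk b)^[t] K) ((walk b)^[t + 1] K) := by
  rw [Function.iterate_succ_apply']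
  obtain ⟨h1, h2⟩ := iterate_walk hz hg t
  exact walkStep_walk (by rwa [h2]) (by omega)

/-- The walk around an interior vertex, together with the neighbours across the refinement edges,
visits all triangles with this vertex. -/
theorem exists_walk_eq (hz : K.tri (keep b) ∈ T₀.domain) (hg : 2 ≤ K.gen) {V : ℕ}
    (hV : ∀ S : Finset T₀.Elem, (∀ L ∈ S, L.gen = K.gen ∧ K.tri (keep b) ∈ L.tri.body) →
      S.card ≤ V) {L : T₀.Elem} (hgL : L.gen = K.gen) (hL : K.tri (keep b) ∈ Set.range L.tri) :
    ∃ t < V, L = (walk b)^[t] K ∨ Elem.IsNbr 0 ((walk b)^[t] K) L := by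
  classical
  set n := Function.minimalPeriod (walk b) K with hn
  have hcancel : ∀ t s, (walk b)^[t] K = (walk b)^[t + s] K → (walk b)^[s] K = K := by
    intro t
    induction t with
    | zero => intro s h; rw [zero_add] at h; exact h.symm
    | succ t ih =>
      intro s h
      have h1 := walkStep_iterate hz hg t
      have h2 := walkStep_iterate hz hg (t + s)
      rw [show t + s + 1 = t + 1 + s by ring, ← h] at h2
      refine ih s (h1.injective h2 ?_)
      rw [(iterate_walk hz hg (t + 1)).1]; omega
  have himg : ∀ s : Finset ℕ, (s.image fun t => (walk b)^[t] K).card ≤ V := fun s => by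
    refine hV _ fun L hL => ?_
    obtain ⟨t, -, rfl⟩ := Finset.mem_image.1 hL
    obtain ⟨h1, h2⟩ := iterate_walk hz hg t
    exact ⟨h1, h2 ▸ Tri.vertex_mem_body _⟩
  have hper : 0 < n := by
    obtain ⟨t, ht, s, hs, hts, he⟩ := Finset.exists_ne_map_eq_of_card_lt_of_maps_to
      (s := Finset.range (V + 1)) (t := (Finset.range (V + 1)).image fun t => (walk b)^[t] K)
      (f := fun t => (walk b)^[t] K) (by rw [Finset.card_range]; exact Nat.lt_succ_of_le (himg _))
      (fun t ht => Finset.mem_image_of_mem _ ht)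
    rcases lt_or_gt_of_ne hts with h | h
    · obtain ⟨d, rfl⟩ := Nat.exists_eq_add_of_lt h
      exact Function.IsPeriodicPt.minimalPeriod_pos (n := d + 1) (by omega) (hcancel t (d + 1) he)
    · obtain ⟨d, rfl⟩ := Nat.exists_eq_add_of_lt h
      exact Function.IsPeriodicPt.minimalPeriod_pos (n := d + 1) (by omega)
        (hcancel s (d + 1) he.symm)
  have hnV : n ≤ V := by
    have := himg (Finset.range n)
    rwa [Finset.card_image_of_injOn, Finset.card_range] at this
    intro s hs t ht
    exact fun h => Function.iterate_injOn_Iio_minimalPeriod (f := walk b) (x := K)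
      (Finset.mem_range.1 hs) (Finset.mem_range.1 ht) h
  have hperK : (walk b)^[n] K = K := Function.isPeriodicPt_minimalPeriod _ _
  -- every triangle of the walk has a predecessor
  have hpred : ∀ t, ∃ s, WalkStep b ((walk b)^[s] K) ((walk b)^[t] K) := by
    rintro (_ | t)
    · refine ⟨n - 1, ?_⟩
      have := walkStep_iterate hz hg (n - 1)
      rwa [Nat.sub_add_cancel hper, hperK] at this
    · exact ⟨t, walkStep_iterate hz hg t⟩
  have hall := star_connected hz
    (W := {L | ∃ t, L = (walk b)^[t] K ∨ Elem.IsNbr 0 ((walk b)^[t] K) L}) (K₀ := K)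
    ⟨0, Or.inl rfl⟩ rfl ⟨_, rfl⟩ ?_ hgL hL
  · obtain ⟨t, ht⟩ := hall
    refine ⟨t % n, (Nat.mod_lt _ hper).trans_le hnV, ?_⟩
    rwa [Function.iterate_mod_minimalPeriod_eq]
  · rintro X hX Y hgX hgY hzX hzY hne v hvz ⟨k, rfl⟩ hvY
    have hXb : X.tri (keep b) = K.tri (keep b) := by
      obtain ⟨t, rfl | ht⟩ := hX
      · exact (iterate_walk hz hg t).2
      · rw [ht.tri_keep (by rw [(iterate_walk hz hg t).1]; exact hg), (iterate_walk hz hg t).2]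
    rw [← hXb] at hvz hzY
    have hg' : X.gen = Y.gen := hgX.trans hgY.symm
    rcases eq_keep b k with rfl | rfl | rfl
    · -- `Y` is the neighbour of `X` across an old edge
      have hn : Elem.IsNbr (keep (!b)) X Y := by
        refine ⟨hg', hne, ?_⟩
        cases b
        · exact ⟨hvY, hzY⟩
        · exact ⟨hzY, hvY⟩
      obtain ⟨t, rfl | ht⟩ := hX
      · obtain ⟨s, Q, h1, h2⟩ := hpred t
        have h3 := h2.symm_keep (by rw [h2.1, (iterate_walk hz hg t).1]; omega)
        exact ⟨s, Or.inr (hn.unique h3 ▸ h1)⟩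
      · refine ⟨t + 1, Or.inl ?_⟩
        exact (WalkStep.unique ⟨X, ht, hn⟩ (walkStep_iterate hz hg t))
    · exact absurd rfl hvz
    · have hn : Elem.IsNbr 0 X Y := by
        refine ⟨hg', hne, ?_⟩
        cases b
        · exact ⟨hzY, hvY⟩
        · exact ⟨hvY, hzY⟩
      obtain ⟨t, rfl | ht⟩ := hX
      · exact ⟨t, Or.inr hn⟩
      · exact ⟨t, Or.inl (hn.unique ht.symm)⟩

end Walk

end InitialMesh

/-! ### Running programs with a bound on the number of operations -/

namespace Prog

/-- Started in the store `σ`, the program terminates in the store `σ'` after at most `T`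
operations. -/
def Runs (c : Prog) (σ σ' : Store) (T : ℕ) : Prop := ∃ t ≤ T, Exec c σ σ' t

/-- The store after the execution of a program without loops. -/
def effect : Prog → Store → Store
  | skip, σ => σ
  | assign x e, σ => { σ with var := Function.update σ.var x (e.eval σ) }
  | write a e₁ e₂, σ =>
      { σ with
        arr := Function.update σ.arr a (Function.update (σ.arr a) (e₁.eval σ) (e₂.eval σ)) }
  | seq c₁ c₂, σ => c₂.effect (c₁.effect σ)
  | cond e c₁ c₂, σ => if e.eval σ = 0 then c₂.effect σ else c₁.effect σ
  | loop _ _, σ => σ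

lemma effect_cond_neg {e : Expr} {c₁ c₂ : Prog} {σ : Store} (h : e.eval σ = 0) :
    (cond e c₁ c₂).effect σ = c₂.effect σ := if_pos h

lemma effect_cond_pos {e : Expr} {c₁ c₂ : Prog} {σ : Store} (h : e.eval σ ≠ 0) :
    (cond e c₁ c₂).effect σ = c₁.effect σ := if_neg h

/-- The program contains no loops. -/
def LoopFree : Prog → Prop
  | seq c₁ c₂ => c₁.LoopFree ∧ c₂.LoopFree
  | cond _ c₁ c₂ => c₁.LoopFree ∧ c₂.LoopFree
  | loop _ _ => False
  | _ => True

/-- A bound on the number of operations of a program without loops. -/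
def maxCost : Prog → ℕ
  | skip => 1
  | assign _ e => e.cost + 1
  | write _ e₁ e₂ => e₁.cost + e₂.cost + 1
  | seq c₁ c₂ => c₁.maxCost + c₂.maxCost
  | cond e c₁ c₂ => e.cost + 1 + (c₁.maxCost + c₂.maxCost)
  | loop _ _ => 0

lemma runs_effect {c : Prog} (h : c.LoopFree) (σ : Store) : c.Runs σ (c.effect σ) c.maxCost := by
  induction c generalizing σ with
  | skip => exact ⟨_, le_rfl, .skip σ⟩
  | assign x e => exact ⟨_, le_rfl, .assign σ x e⟩
  | write a e₁ e₂ => exact ⟨_, le_rfl, .write σ a e₁ e₂⟩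
  | seq c₁ c₂ ih₁ ih₂ =>
    obtain ⟨t₁, h₁, e₁⟩ := ih₁ h.1 σ
    obtain ⟨t₂, h₂, e₂⟩ := ih₂ h.2 (c₁.effect σ)
    exact ⟨_, add_le_add h₁ h₂, .seq e₁ e₂⟩
  | cond e c₁ c₂ ih₁ ih₂ =>
    rw [effect]
    split_ifs with he
    · obtain ⟨t, ht, h'⟩ := ih₂ h.2 σ
      exact ⟨_, by rw [maxCost]; omega, .cond_false he h'⟩
    · obtain ⟨t, ht, h'⟩ := ih₁ h.1 σ
      exact ⟨_, by rw [maxCost]; omega, .cond_true he h'⟩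
  | loop e c => exact h.elim

lemma Runs.mono {c : Prog} {σ σ' : Store} {T T' : ℕ} (h : c.Runs σ σ' T) (hT : T ≤ T') :
    c.Runs σ σ' T' :=
  ⟨h.choose, h.choose_spec.1.trans hT, h.choose_spec.2⟩

lemma Runs.seq {c₁ c₂ : Prog} {σ σ₁ σ₂ : Store} {T₁ T₂ : ℕ} (h₁ : c₁.Runs σ σ₁ T₁)
    (h₂ : c₂.Runs σ₁ σ₂ T₂) : (seq c₁ c₂).Runs σ σ₂ (T₁ + T₂) := by
  obtain ⟨t₁, l₁, e₁⟩ := h₁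
  obtain ⟨t₂, l₂, e₂⟩ := h₂
  exact ⟨_, add_le_add l₁ l₂, .seq e₁ e₂⟩

lemma Runs.cond_true {e : Expr} {c₁ c₂ : Prog} {σ σ₁ : Store} {T : ℕ} (he : e.eval σ ≠ 0)
    (h : c₁.Runs σ σ₁ T) : (cond e c₁ c₂).Runs σ σ₁ (e.cost + 1 + T) := by
  obtain ⟨t, l, e'⟩ := h
  exact ⟨_, by omega, .cond_true he e'⟩

lemma Runs.cond_false {e : Expr} {c₁ c₂ : Prog} {σ σ₁ : Store} {T : ℕ} (he : e.eval σ = 0)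
    (h : c₂.Runs σ σ₁ T) : (cond e c₁ c₂).Runs σ σ₁ (e.cost + 1 + T) := by
  obtain ⟨t, l, e'⟩ := h
  exact ⟨_, by omega, .cond_false he e'⟩

/-- If the body of a loop decreases a potential, then the number of iterations is at most the loss of
potential. -/
lemma runs_loop {e : Expr} {c : Prog} {T : ℕ} (I : ℕ → Store → Prop)
    (hbody : ∀ n σ, I n σ → e.eval σ ≠ 0 → ∃ n' < n, ∃ σ', c.Runs σ σ' T ∧ I n' σ')
    (n : ℕ) (σ : Store) (h : I n σ) :
    ∃ n' ≤ n, ∃ σ', (loop e c).Runs σ σ' ((n - n') * (e.cost + 1 + T) + (e.cost + 1)) ∧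
      I n' σ' ∧ e.eval σ' = 0 := by
  induction n using Nat.strong_induction_on generalizing σ with
  | _ n ih =>
    by_cases he : e.eval σ = 0
    · exact ⟨n, le_rfl, σ, ⟨_, by omega, .loop_false he⟩, h, he⟩
    · obtain ⟨n₁, h₁, σ₁, ⟨t₁, l₁, e₁⟩, hI⟩ := hbody n σ h he
      obtain ⟨n₂, h₂, σ₂, ⟨t₂, l₂, e₂⟩, hI₂, he₂⟩ := ih n₁ h₁ σ₁ hI
      refine ⟨n₂, by omega, σ₂, ⟨_, ?_, .loop_true he e₁ e₂⟩, hI₂, he₂⟩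
      obtain ⟨d, hd⟩ : ∃ d, n - n₂ = d + 1 + (n₁ - n₂) := ⟨n - n₁ - 1, by omega⟩
      rw [hd]
      calc e.cost + 1 + t₁ + t₂
          ≤ 1 * (e.cost + 1 + T) + (n₁ - n₂) * (e.cost + 1 + T) + (e.cost + 1) := by omega
        _ ≤ (d + 1 + (n₁ - n₂)) * (e.cost + 1 + T) + (e.cost + 1) := by
          rw [← add_mul]; gcongr; omega

/-- The program does not assign to variable `x`. -/
def AvoidsVar (x : ℕ) : Prog → Prop
  | assign y _ => y ≠ x
  | seq c₁ c₂ => c₁.AvoidsVar x ∧ c₂.AvoidsVar x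
  | cond _ c₁ c₂ => c₁.AvoidsVar x ∧ c₂.AvoidsVar x
  | loop _ c => c.AvoidsVar x
  | _ => True

/-- The program does not write to array `a`. -/
def AvoidsArr (a : ℕ) : Prog → Prop
  | write b _ _ => b ≠ a
  | seq c₁ c₂ => c₁.AvoidsArr a ∧ c₂.AvoidsArr a
  | cond _ c₁ c₂ => c₁.AvoidsArr a ∧ c₂.AvoidsArr a
  | loop _ c => c.AvoidsArr a
  | _ => True

lemma Runs.var_eq {c : Prog} {σ σ' : Store} {T x : ℕ} (h : c.Runs σ σ' T) (hc : c.AvoidsVar x) :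
    σ'.var x = σ.var x := by
  obtain ⟨t, -, h⟩ := h
  induction h with
  | skip | write | loop_false => rfl
  | assign => exact Function.update_of_ne (Ne.symm hc) _ _
  | seq _ _ ih₁ ih₂ => exact (ih₂ hc.2).trans (ih₁ hc.1)
  | cond_true _ _ ih => exact ih hc.1
  | cond_false _ _ ih => exact ih hc.2
  | loop_true _ _ _ ih₁ ih₂ => exact (ih₂ hc).trans (ih₁ hc)

lemma Runs.arr_eq {c : Prog} {σ σ' : Store} {T a : ℕ} (h : c.Runs σ σ' T) (hc : c.AvoidsArr a) :
    σ'.arr a = σ.arr a := by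
  obtain ⟨t, -, h⟩ := h
  induction h with
  | skip | assign | loop_false => rfl
  | write => exact Function.update_of_ne (Ne.symm hc) _ _
  | seq _ _ ih₁ ih₂ => exact (ih₂ hc.2).trans (ih₁ hc.1)
  | cond_true _ _ ih => exact ih hc.1
  | cond_false _ _ ih => exact ih hc.2
  | loop_true _ _ _ ih₁ ih₂ => exact (ih₂ hc).trans (ih₁ hc)

lemma effect_var_eq {c : Prog} (hl : c.LoopFree) {x : ℕ} (hc : c.AvoidsVar x) (σ : Store) :
    (c.effect σ).var x = σ.var x := (runs_effect hl σ).var_eq hc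

lemma effect_arr_eq {c : Prog} (hl : c.LoopFree) {a : ℕ} (hc : c.AvoidsArr a) (σ : Store) :
    (c.effect σ).arr a = σ.arr a := (runs_effect hl σ).arr_eq hc

end Prog

/-! ### Numbers of elements and of neighbours -/

namespace InitialMesh

variable {T₀ : InitialMesh}

namespace Elem

lemma code_child (K : T₀.Elem) (b : Bool) : (K.child b).code = 2 * K.code + b.toNat := rfl

lemma code_bounds (K : T₀.Elem) :
    2 ^ K.gen * T₀.size ≤ K.code ∧ K.code < 2 ^ (K.gen + 1) * T₀.size := by
  induction K using induction_on with
  | root r =>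
    have := r.2
    constructor
    · simp [gen, code, codeAt]
    · simp [gen, code, codeAt]; omega
  | child K b ih =>
    have hb : b.toNat ≤ 1 := by cases b <;> simp
    have e₁ : 2 ^ (K.gen + 1) * T₀.size = 2 * (2 ^ K.gen * T₀.size) := by ring
    have e₂ : 2 ^ (K.gen + 1 + 1) * T₀.size = 2 * (2 ^ (K.gen + 1) * T₀.size) := by ring
    rw [code_child, gen_child, e₂, e₁]
    omega

lemma size_pos (K : T₀.Elem) : 0 < T₀.size := (Nat.zero_le _).trans_lt K.1.2

lemma code_pos (K : T₀.Elem) : 0 < K.code :=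
  (Nat.mul_pos (by positivity) K.size_pos).trans_le K.code_bounds.1

lemma mul_size_le_code_iff (K : T₀.Elem) (g : ℕ) : 2 ^ g * T₀.size ≤ K.code ↔ g ≤ K.gen := by
  constructor
  · intro h
    by_contra hg
    have h1 : 2 ^ (K.gen + 1) * T₀.size ≤ 2 ^ g * T₀.size := by
      gcongr
      · norm_num
      · omega
    exact absurd K.code_bounds.2 (by omega)
  · intro h
    refine le_trans ?_ K.code_bounds.1
    gcongr
    norm_num

lemma code_injective : Function.Injective (code : T₀.Elem → ℕ) := by
  intro K
  induction K using induction_on with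
  | root r =>
    intro L h
    have hL : L.gen = 0 := by
      by_contra hg
      have h1 := (L.mul_size_le_code_iff 1).2 (by omega)
      rw [← h] at h1
      have := (mul_size_le_code_iff (T₀ := T₀) (r, []) 1).1 h1
      simp [gen] at this
    obtain ⟨s, q⟩ := L
    obtain rfl : q = [] := List.length_eq_zero_iff.1 hL
    have : r.1 = s.1 := by simpa [code, codeAt] using h
    rw [Fin.ext this]
  | child K b ih =>
    intro L h
    have hL : 0 < L.gen := by
      by_contra hg
      have h1 := ((K.child b).mul_size_le_code_iff 1).2 (by simp)
      rw [h] at h1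
      have := (L.mul_size_le_code_iff 1).1 h1
      omega
    obtain ⟨c, hc⟩ := exists_eq_child hL
    rw [hc, code_child, code_child] at h
    have hb : b.toNat ≤ 1 := by cases b <;> simp
    have hb' : c.toNat ≤ 1 := by cases c <;> simp
    rw [hc, child_inj]
    refine ⟨ih (by omega), ?_⟩
    have : b.toNat = c.toNat := by omega
    revert this; cases b <;> cases c <;> simp

lemma code_inj {K L : T₀.Elem} : K.code = L.code ↔ K = L := code_injective.eq_iff

lemma code_child_half (K : T₀.Elem) (b : Bool) : (K.child b).code / 2 = K.code := by
  rw [code_child]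
  cases b
  · simp
  · simp; omega

lemma code_half {K : T₀.Elem} (h : 0 < K.gen) : K.code / 2 = K.parent.code := by
  obtain ⟨b, hb⟩ := exists_eq_child h
  rw [hb, code_child_half, parent_child]

open Classical in
/-- The number of the neighbour across the edge opposite vertex `i`, or `0` if there is none. -/
noncomputable def nbrCode (i : Fin 3) (K : T₀.Elem) : ℕ :=
  if h : ∃ L, IsNbr i K L then h.choose.code else 0

lemma nbrCode_eq {i : Fin 3} {K L : T₀.Elem} (h : IsNbr i K L) : nbrCode i K = L.code := by
  have h' : ∃ L, IsNbr i K L := ⟨L, h⟩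
  rw [nbrCode, dif_pos h', h'.choose_spec.unique h]

lemma nbrCode_eq_zero {i : Fin 3} {K : T₀.Elem} (h : ¬ ∃ L, IsNbr i K L) : nbrCode i K = 0 :=
  dif_neg h

/-- The number of the sibling is `4 * (code / 2) + 1 - code`. -/
lemma code_sibling (K : T₀.Elem) (b : Bool) : (K.child !b).code =
    (K.child b).code / 2 + (K.child b).code / 2 + ((K.child b).code / 2 + (K.child b).code / 2) + 1 -
      (K.child b).code := by
  rw [code_child_half, code_child, code_child]
  cases b <;> simp <;> omega

lemma nbrCode_zero_child_false (K : T₀.Elem) (b : Bool) :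
    nbrCode 0 ((K.child b).child false) = 2 * (K.child !b).code := by
  rw [nbrCode_eq (isNbr_zero_child_false K b), code_child]; rfl

lemma nbrCode_child {i i' : Fin 3} {K : T₀.Elem} {b b' : Bool}
    (h : ∀ L, IsNbr i' (K.child b) L ↔ ∃ Q, IsNbr i K Q ∧ L = Q.child b') :
    nbrCode i' (K.child b) =
      if nbrCode i K = 0 then 0 else 2 * nbrCode i K + b'.toNat := by
  by_cases hQ : ∃ Q, IsNbr i K Q
  · obtain ⟨Q, hQ⟩ := hQ
    rw [nbrCode_eq ((h _).2 ⟨Q, hQ, rfl⟩), nbrCode_eq hQ, if_neg Q.code_pos.ne', code_child]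
  · rw [nbrCode_eq_zero hQ, if_pos rfl, nbrCode_eq_zero]
    rintro ⟨L, hL⟩
    obtain ⟨Q, hQ', -⟩ := (h L).1 hL
    exact hQ ⟨Q, hQ'⟩

lemma nbrCode_zero_child_true (K : T₀.Elem) (b : Bool) :
    nbrCode 0 ((K.child b).child true) =
      if nbrCode 1 (K.child b) = 0 then 0 else 2 * nbrCode 1 (K.child b) + 1 :=
  nbrCode_child (b' := true) fun _ => isNbr_zero_child_true_iff

lemma nbrCode_one_child {K : T₀.Elem} (hg : 2 ≤ K.gen) (b : Bool) :
    nbrCode 1 (K.child b) =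
      if nbrCode 0 K = 0 then 0 else 2 * nbrCode 0 K + b.toNat :=
  nbrCode_child fun _ => isNbr_one_child_iff hg

end Elem

end InitialMesh

/-! ### A program that closes a set of bisected elements

The program uses the arrays `3` (marks of the bisected elements), `4` and `5` (numbers of the
neighbours of an element opposite its vertices `0` and `1`), `6` (a stack of elements that have to
be bisected) and `7` (the list of the bisected elements). Variable `2` is the height of the stack,
variable `3` the number of bisected elements. -/

namespace Prog

/-- Remove the top of the stack. -/
def pop : Prog := assign 2 (.sub (.var 2) (.const 1))

/-- Put the parent of the element in variable `5` on the stack. -/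
def pushParent : Prog :=
  seq (write 6 (.var 2) (.half (.var 5))) (assign 2 (.add (.var 2) (.const 1)))

/-- Record that the element in variable `5` is bisected. -/
def record : Prog :=
  seq (write 3 (.var 5) (.const 1)) (seq (write 7 (.var 3) (.var 5))
    (assign 3 (.add (.var 3) (.const 1))))

/-- Replace the top of the stack, which is the element in variable `5`, by its neighbour across the
refinement edge. -/
def replaceTop : Prog :=
  cond (.read 4 (.var 5)) (write 6 (.sub (.var 2) (.const 1)) (.read 4 (.var 5))) pop

/-- The expression for `2 * x + 1` if `x` is nonzero, and for `0` otherwise. -/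
def secondChild (x : Expr) : Expr := .add (.add x x) (.sub (.const 1) (.sub (.const 1) x))

/-- The number of the sibling of the element with number `x`. -/
def sibling (x : Expr) : Expr :=
  .sub (.add (.add (.add (.half x) (.half x)) (.add (.half x) (.half x))) (.const 1)) x

/-- Compute the neighbours of the children of the element in variable `5` from its own neighbours;
`m` is the number of roots. Nothing is done for elements of generation zero and one, since the
neighbours of their children are tabulated. -/
def inherit (m : ℕ) : Prog :=
  cond (.sub (.add (.var 5) (.const 1)) (.const (4 * m)))
    (seq (write 4 (.add (.var 5) (.var 5)) (.add (sibling (.var 5)) (sibling (.var 5))))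
      (seq (write 4 (.add (.add (.var 5) (.var 5)) (.const 1)) (secondChild (.read 5 (.var 5))))
        (seq (write 5 (.add (.var 5) (.var 5)) (.add (.read 4 (.var 5)) (.read 4 (.var 5))))
          (write 5 (.add (.add (.var 5) (.var 5)) (.const 1)) (secondChild (.read 4 (.var 5)))))))
    skip

/-- Bisect the element in variable `5`, of which the parent is bisected already. -/
def bisectTop (m : ℕ) : Prog := seq record (seq replaceTop (inherit m))

/-- One step of the closure: treat the top of the stack. -/
def closeStep (m : ℕ) : Prog :=
  seq (assign 5 (.read 6 (.sub (.var 2) (.const 1))))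
    (cond (.read 3 (.var 5)) pop
      (cond (.sub (.add (.var 5) (.const 1)) (.const (2 * m)))
        (cond (.read 3 (.half (.var 5))) (bisectTop m) pushParent)
        (bisectTop m)))

/-- Bisect the element in variable `4` and all elements that have to be bisected with it. -/
def close (m : ℕ) : Prog :=
  seq (write 6 (.const 0) (.var 4)) (seq (assign 2 (.const 1)) (loop (.var 2) (closeStep m)))

lemma closeStep_loopFree (m : ℕ) : (closeStep m).LoopFree := by
  simp [closeStep, bisectTop, record, replaceTop, inherit, pushParent, pop, LoopFree]

end Prog

namespace InitialMesh

variable {T₀ : InitialMesh}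

/-- `f` lists the numbers of the elements of a list, in reverse order. -/
def Holds (f : ℕ → ℕ) : List T₀.Elem → Prop
  | [] => True
  | K :: l => f l.length = K.code ∧ Holds f l

lemma Holds.update {f : ℕ → ℕ} {l : List T₀.Elem} (h : Holds f l) {n : ℕ} (hn : l.length ≤ n)
    (x : ℕ) : Holds (Function.update f n x) l := by
  induction l with
  | nil => trivial
  | cons K l ih =>
    rw [List.length_cons] at hn
    refine ⟨?_, ih h.2 (by omega)⟩
    rw [Function.update_of_ne (by omega)]
    exact h.1

lemma Holds.cons {f : ℕ → ℕ} {l : List T₀.Elem} (h : Holds f l) (K : T₀.Elem) :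
    Holds (Function.update f l.length K.code) (K :: l) :=
  ⟨Function.update_self _ _ _, h.update le_rfl _⟩

/-- The elements of `M` are marked as bisected, and the neighbours of their children are known. -/
structure Core (M : List T₀.Elem) (σ : Store) : Prop where
  mark : ∀ K : T₀.Elem, σ.arr 3 K.code = if K ∈ M then 1 else 0
  nodup : M.Nodup
  parent : ∀ (K : T₀.Elem) b, K.child b ∈ M → K ∈ M
  holds : Holds (σ.arr 7) M
  length : σ.var 3 = M.length
  nbr_zero : ∀ K : T₀.Elem, K.gen ≤ 2 ∨ K.parent ∈ M → σ.arr 4 K.code = K.nbrCode 0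
  nbr_one : ∀ K : T₀.Elem, 2 ≤ K.gen → K.gen = 2 ∨ K.parent ∈ M → σ.arr 5 K.code = K.nbrCode 1

/-- The invariant of the closure: the stack `s` contains the neighbours of bisected elements that
remain to be bisected. The generations increase from the top of the stack to its bottom. -/
structure Closing (B : Finset T₀.Elem) (M s : List T₀.Elem) (σ : Store) : Prop where
  core : Core M σ
  subset : ∀ K ∈ M, K ∈ B
  stack_subset : ∀ K ∈ s, K ∈ B
  stack_holds : Holds (σ.arr 6) s
  stack_length : σ.var 2 = s.length
  sorted : s.Pairwise fun K L => K.gen < L.gen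
  partner : ∀ K ∈ M, ∀ L, Elem.IsNbr 0 K L → L ∈ M ∨ L ∈ s

/-- The potential that pays for the operations: it accounts for the elements that are not bisected
yet, for those that in addition are not on the stack, and for the height of the stack. It decreases
if the stack is popped, if an element is bisected, and also if an element is pushed that was not on
the stack before. -/
def potential (B : Finset T₀.Elem) (M s : List T₀.Elem) : ℕ :=
  2 * (B.card - M.length) + 2 * (B.card - (M.toFinset ∪ s.toFinset).card) + s.length

lemma Core.congr {M : List T₀.Elem} {σ τ : Store} (h : Core M σ) (h3 : τ.arr 3 = σ.arr 3)
    (h4 : τ.arr 4 = σ.arr 4) (h5 : τ.arr 5 = σ.arr 5) (h7 : τ.arr 7 = σ.arr 7)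
    (hv : τ.var 3 = σ.var 3) : Core M τ where
  mark := by rw [h3]; exact h.mark
  nodup := h.nodup
  parent := h.parent
  holds := by rw [h7]; exact h.holds
  length := by rw [hv]; exact h.length
  nbr_zero := by rw [h4]; exact h.nbr_zero
  nbr_one := by rw [h5]; exact h.nbr_one

lemma eval_secondChild (x : Expr) (σ : Store) :
    (Prog.secondChild x).eval σ = if x.eval σ = 0 then 0 else 2 * x.eval σ + 1 := by
  simp only [Prog.secondChild, Expr.eval]
  split_ifs <;> omega

lemma eval_sibling {x : Expr} {σ : Store} {K : T₀.Elem} {b : Bool}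
    (h : x.eval σ = (K.child b).code) : (Prog.sibling x).eval σ = (K.child !b).code := by
  simp only [Prog.sibling, Expr.eval, h]
  rw [Elem.code_sibling]

section Effect

variable (m : ℕ) (σ : Store)

lemma record_effect : Prog.record.effect σ = {
    var := Function.update σ.var 3 (σ.var 3 + 1)
    arr := Function.update (Function.update σ.arr 3 (Function.update (σ.arr 3) (σ.var 5) 1)) 7
      (Function.update (σ.arr 7) (σ.var 3) (σ.var 5)) } := rfl

lemma replaceTop_effect_arr : (Prog.replaceTop.effect σ).arr 6 =
    if σ.arr 4 (σ.var 5) = 0 then σ.arr 6 else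
      Function.update (σ.arr 6) (σ.var 2 - 1) (σ.arr 4 (σ.var 5)) := by
  by_cases h : σ.arr 4 (σ.var 5) = 0
  · rw [if_pos h, Prog.replaceTop, Prog.effect_cond_neg]
    · simp [Prog.pop, Prog.effect, Expr.eval]
    · exact h
  · rw [if_neg h, Prog.replaceTop, Prog.effect_cond_pos]
    · simp [Prog.effect, Expr.eval]
    · exact h

lemma replaceTop_effect_var : (Prog.replaceTop.effect σ).var 2 =
    if σ.arr 4 (σ.var 5) = 0 then σ.var 2 - 1 else σ.var 2 := by
  by_cases h : σ.arr 4 (σ.var 5) = 0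
  · rw [if_pos h, Prog.replaceTop, Prog.effect_cond_neg]
    · simp [Prog.pop, Prog.effect, Expr.eval]
    · exact h
  · rw [if_neg h, Prog.replaceTop, Prog.effect_cond_pos]
    · simp [Prog.effect, Expr.eval]
    · exact h

lemma inherit_effect_four : ((Prog.inherit m).effect σ).arr 4 =
    if σ.var 5 + 1 - 4 * m = 0 then σ.arr 4 else
      Function.update (Function.update (σ.arr 4) (σ.var 5 + σ.var 5)
        ((Prog.sibling (.var 5)).eval σ + (Prog.sibling (.var 5)).eval σ)) (σ.var 5 + σ.var 5 + 1)
        (if σ.arr 5 (σ.var 5) = 0 then 0 else 2 * σ.arr 5 (σ.var 5) + 1) := by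
  by_cases h : σ.var 5 + 1 - 4 * m = 0
  · rw [if_pos h, Prog.inherit, Prog.effect_cond_neg]
    · rfl
    · exact h
  · rw [if_neg h, Prog.inherit, Prog.effect_cond_pos]
    · simp [Prog.effect, Prog.sibling, Expr.eval, eval_secondChild]
    · exact h

lemma inherit_effect_five (h : 0 < σ.var 5) : ((Prog.inherit m).effect σ).arr 5 =
    if σ.var 5 + 1 - 4 * m = 0 then σ.arr 5 else
      Function.update (Function.update (σ.arr 5) (σ.var 5 + σ.var 5) (2 * σ.arr 4 (σ.var 5)))
        (σ.var 5 + σ.var 5 + 1)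
        (if σ.arr 4 (σ.var 5) = 0 then 0 else 2 * σ.arr 4 (σ.var 5) + 1) := by
  have h1 : σ.var 5 ≠ σ.var 5 + σ.var 5 := by omega
  have h2 : σ.var 5 ≠ σ.var 5 + σ.var 5 + 1 := by omega
  by_cases h : σ.var 5 + 1 - 4 * m = 0
  · rw [if_pos h, Prog.inherit, Prog.effect_cond_neg]
    · rfl
    · exact h
  · rw [if_neg h, Prog.inherit, Prog.effect_cond_pos]
    · simp [Prog.effect, Expr.eval, eval_secondChild, Function.update_of_ne h1,
      Function.update_of_ne h2, two_mul]
    · exact h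

end Effect

section Step

variable {B : Finset T₀.Elem} {M s : List T₀.Elem} {k : T₀.Elem} {σ : Store}

lemma code_child_false (K : T₀.Elem) : (K.child false).code = K.code + K.code := by
  rw [Elem.code_child]; simp [two_mul]

lemma code_child_true (K : T₀.Elem) : (K.child true).code = K.code + K.code + 1 := by
  rw [Elem.code_child]; simp [two_mul]

lemma le_gen_iff_code_sub (K : T₀.Elem) (g : ℕ) :
    K.code + 1 - 2 ^ g * T₀.size ≠ 0 ↔ g ≤ K.gen := by
  rw [← K.mul_size_le_code_iff]; omega

/-- Bisecting an element of which the parent is bisected. -/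
lemma Core.bisectTop (h : Core M σ) (hk : σ.var 5 = k.code) (hkM : k ∉ M)
    (hpar : k.gen = 0 ∨ k.parent ∈ M) :
    Core (k :: M) ((Prog.bisectTop T₀.size).effect σ) := by
  set σ₁ := Prog.record.effect σ with hσ₁
  set σ₂ := Prog.replaceTop.effect σ₁ with hσ₂
  have hσ₃ : (Prog.bisectTop T₀.size).effect σ = (Prog.inherit T₀.size).effect σ₂ := rfl
  have lf : Prog.replaceTop.LoopFree ∧ (Prog.inherit T₀.size).LoopFree := by
    simp [Prog.replaceTop, Prog.inherit, Prog.pop, Prog.LoopFree]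
  -- the arrays and variables that are left alone
  have keep₁ : σ₁.arr 4 = σ.arr 4 ∧ σ₁.arr 5 = σ.arr 5 ∧ σ₁.var 5 = σ.var 5 := by
    rw [hσ₁, record_effect]; simp
  have keep₂ : ∀ a ≠ 6, σ₂.arr a = σ₁.arr a := fun a ha =>
    Prog.effect_arr_eq lf.1 (by simp [Prog.replaceTop, Prog.pop, Prog.AvoidsArr, ha.symm]) _
  have keepv₂ : ∀ x ≠ 2, σ₂.var x = σ₁.var x := fun x hx =>
    Prog.effect_var_eq lf.1 (by simp [Prog.replaceTop, Prog.pop, Prog.AvoidsVar, hx.symm]) _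
  have hk₂ : σ₂.var 5 = k.code := by rw [keepv₂ 5 (by decide), keep₁.2.2, hk]
  have keep₃ : ∀ a, a ≠ 4 → a ≠ 5 → ((Prog.inherit T₀.size).effect σ₂).arr a = σ₂.arr a :=
    fun a h4 h5 => Prog.effect_arr_eq lf.2
      (by simp [Prog.inherit, Prog.AvoidsArr, h4.symm, h5.symm]) _
  have keepv₃ : ∀ x, ((Prog.inherit T₀.size).effect σ₂).var x = σ₂.var x :=
    fun x => Prog.effect_var_eq lf.2 (by simp [Prog.inherit, Prog.AvoidsVar]) _
  have e4 : σ₂.arr 4 = σ.arr 4 := (keep₂ 4 (by decide)).trans keep₁.1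
  have e5 : σ₂.arr 5 = σ.arr 5 := (keep₂ 5 (by decide)).trans keep₁.2.1
  have v4 : σ.arr 4 k.code = k.nbrCode 0 :=
    h.nbr_zero k (hpar.imp (fun h => by omega) id)
  have hne : ∀ K : T₀.Elem, ∀ b, K ≠ k.child b → K.code ≠ (k.child b).code :=
    fun K b hK hc => hK (Elem.code_inj.1 hc)
  have hold : ∀ K : T₀.Elem, K.gen ≤ 2 ∨ K.parent ∈ k :: M → (∀ b, K ≠ k.child b) →
      K.gen ≤ 2 ∨ K.parent ∈ M := by
    rintro K (hK | hK) hb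
    · exact Or.inl hK
    · rcases List.mem_cons.1 hK with hK | hK
      · rcases Nat.eq_zero_or_pos K.gen with h0 | h0
        · exact Or.inl (by omega)
        · obtain ⟨b, hb'⟩ := Elem.exists_eq_child h0
          exact absurd (hK ▸ hb') (hb b)
      · exact Or.inr hK
  have hsmall : ∀ K : T₀.Elem, ¬ 2 ≤ k.gen → K.gen ≤ 2 ∨ K.parent ∈ k :: M →
      K.gen ≤ 2 ∨ K.parent ∈ M := by
    rintro K hg (hK | hK)
    · exact Or.inl hK
    · rcases List.mem_cons.1 hK with hK | hK
      · have := K.gen_parent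
        rw [hK] at this
        exact Or.inl (by omega)
      · exact Or.inr hK
  have hc2 : k.code + 1 - 4 * T₀.size ≠ 0 ↔ 2 ≤ k.gen := le_gen_iff_code_sub k 2
  rw [hσ₃]
  refine ⟨?_, ?_, ?_, ?_, ?_, ?_, ?_⟩
  · intro K
    rw [keep₃ 3 (by decide) (by decide), keep₂ 3 (by decide), hσ₁, record_effect, hk]
    simp only [Function.update_self, Function.update_of_ne (show (3 : ℕ) ≠ 7 by decide)]
    by_cases hKk : K = k
    · subst hKk; simp
    · rw [Function.update_of_ne (fun h => hKk (Elem.code_inj.1 h)), h.mark]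
      simp [hKk]
  · exact List.nodup_cons.2 ⟨hkM, h.nodup⟩
  · intro K b hKb
    rcases List.mem_cons.1 hKb with hKb | hKb
    · subst hKb
      rcases hpar with h0 | h0
      · simp at h0
      · exact List.mem_cons_of_mem _ h0
    · exact List.mem_cons_of_mem _ (h.parent K b hKb)
  · rw [keep₃ 7 (by decide) (by decide), keep₂ 7 (by decide), hσ₁, record_effect, hk, h.length]
    simp only [Function.update_self]
    exact h.holds.cons k
  · rw [keepv₃, keepv₂ 3 (by decide), hσ₁, record_effect, h.length]
    simp
  · intro K hK
    rw [inherit_effect_four, hk₂, e4, e5]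
    by_cases hg : 2 ≤ k.gen
    · rw [if_neg (hc2.2 hg), ← code_child_true, ← code_child_false]
      obtain ⟨c, hc⟩ := Elem.exists_eq_child (K := k) (by omega)
      have hsib : (Prog.sibling (.var 5)).eval σ₂ = (k.parent.child !c).code :=
        eval_sibling (by rw [← hc]; exact hk₂)
      have v5 : σ.arr 5 k.code = k.nbrCode 1 :=
        h.nbr_one k hg (Or.inr (hpar.resolve_left (by omega)))
      by_cases ht : K = k.child true
      · rw [ht, Function.update_self, v5, hc, Elem.nbrCode_zero_child_true]
      · rw [Function.update_of_ne (hne K true ht)]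
        by_cases hf : K = k.child false
        · rw [hf, Function.update_self, hsib, ← two_mul, ← Elem.nbrCode_zero_child_false, ← hc]
        · rw [Function.update_of_ne (hne K false hf)]
          exact h.nbr_zero K (hold K hK fun b => by cases b <;> assumption)
    · rw [if_pos (not_not.1 (mt hc2.1 hg))]
      exact h.nbr_zero K (hsmall K hg hK)
  · intro K hK2 hK
    have hK' : K.gen ≤ 2 ∨ K.parent ∈ k :: M := hK.imp le_of_eq id
    have fix : K.gen ≤ 2 ∨ K.parent ∈ M → K.gen = 2 ∨ K.parent ∈ M :=
      fun h => h.imp (fun h => by omega) id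
    rw [inherit_effect_five _ _ (by rw [hk₂]; exact k.code_pos), hk₂, e4, e5, v4]
    by_cases hg : 2 ≤ k.gen
    · rw [if_neg (hc2.2 hg), ← code_child_true, ← code_child_false]
      by_cases ht : K = k.child true
      · rw [ht, Function.update_self, Elem.nbrCode_one_child hg]
        rfl
      · rw [Function.update_of_ne (hne K true ht)]
        by_cases hf : K = k.child false
        · rw [hf, Function.update_self, Elem.nbrCode_one_child hg]
          split_ifs with h0
          · rw [h0]
          · rfl
        · rw [Function.update_of_ne (hne K false hf)]
          exact h.nbr_one K hK2 (fix (hold K hK' fun b => by cases b <;> assumption))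
    · rw [if_pos (not_not.1 (mt hc2.1 hg))]
      exact h.nbr_one K hK2 (fix (hsmall K hg hK'))

end Step

end InitialMesh

namespace InitialMesh

variable {T₀ : InitialMesh}

section Step

variable {B : Finset T₀.Elem} {M s : List T₀.Elem} {k : T₀.Elem} {σ : Store}

lemma bisectTop_stack (h : Core M σ) (hk : σ.var 5 = k.code)
    (hpar : k.gen = 0 ∨ k.parent ∈ M) :
    ((Prog.bisectTop T₀.size).effect σ).arr 6 =
        (if k.nbrCode 0 = 0 then σ.arr 6 else
          Function.update (σ.arr 6) (σ.var 2 - 1) (k.nbrCode 0)) ∧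
      ((Prog.bisectTop T₀.size).effect σ).var 2 =
        if k.nbrCode 0 = 0 then σ.var 2 - 1 else σ.var 2 := by
  set σ₁ := Prog.record.effect σ with hσ₁
  set σ₂ := Prog.replaceTop.effect σ₁ with hσ₂
  have hσ₃ : (Prog.bisectTop T₀.size).effect σ = (Prog.inherit T₀.size).effect σ₂ := rfl
  have lf : (Prog.inherit T₀.size).LoopFree := by simp [Prog.inherit, Prog.LoopFree]
  have v4 : σ.arr 4 k.code = k.nbrCode 0 :=
    h.nbr_zero k (hpar.imp (fun h => by omega) id)
  have e₁ : σ₁.arr 4 (σ₁.var 5) = k.nbrCode 0 := by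
    rw [← v4, ← hk, hσ₁, record_effect]; simp
  have e₂ : σ₁.arr 6 = σ.arr 6 ∧ σ₁.var 2 = σ.var 2 := by
    rw [hσ₁, record_effect]; simp
  rw [hσ₃, Prog.effect_arr_eq (a := 6) lf (by simp [Prog.inherit, Prog.AvoidsArr]),
    Prog.effect_var_eq (x := 2) lf (by simp [Prog.inherit, Prog.AvoidsVar]), hσ₂,
    replaceTop_effect_arr, replaceTop_effect_var, e₁, e₂.1, e₂.2]
  exact ⟨rfl, rfl⟩

lemma card_union_le (hM : ∀ K ∈ M, K ∈ B) (hs : ∀ K ∈ s, K ∈ B) :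
    (M.toFinset ∪ s.toFinset).card ≤ B.card := by
  refine Finset.card_le_card fun K hK => ?_
  rcases Finset.mem_union.1 hK with h | h
  · exact hM K (List.mem_toFinset.1 h)
  · exact hs K (List.mem_toFinset.1 h)

lemma length_le_card (hn : M.Nodup) (hM : ∀ K ∈ M, K ∈ B) : M.length ≤ B.card := by
  rw [← List.toFinset_card_of_nodup hn]
  exact Finset.card_le_card fun K hK => hM K (List.mem_toFinset.1 hK)

lemma sub_card_union_anti {M s M' s' : List T₀.Elem}
    (hsub : ∀ K, K ∈ M ∨ K ∈ s → K ∈ M' ∨ K ∈ s') :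
    B.card - (M'.toFinset ∪ s'.toFinset).card ≤ B.card - (M.toFinset ∪ s.toFinset).card := by
  refine Nat.sub_le_sub_left (Finset.card_le_card fun K hK => ?_) _
  have := hsub K (by simpa using hK)
  simpa using this

/-- One step of the closure maintains the invariant and decreases the potential. -/
lemma Closing.closeStep (h : Closing B M (k :: s) σ) (hB : ParentClosed B)
    (hB' : PartnerClosed B) :
    ∃ M' s', Closing B M' s' ((Prog.closeStep T₀.size).effect σ) ∧
      potential B M' s' < potential B M (k :: s) ∧
      ∀ K, K ∈ M ∨ K ∈ k :: s → K ∈ M' ∨ K ∈ s' := by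
  set σ₀ : Store := { σ with var := Function.update σ.var 5 k.code } with hσ₀
  have hk6 : σ.arr 6 (σ.var 2 - 1) = k.code := by
    rw [h.stack_length, List.length_cons, Nat.add_sub_cancel]; exact h.stack_holds.1
  have hstep : (Prog.closeStep T₀.size).effect σ =
      (Prog.cond (.read 3 (.var 5)) Prog.pop
      (.cond (.sub (.add (.var 5) (.const 1)) (.const (2 * T₀.size)))
        (.cond (.read 3 (.half (.var 5))) (Prog.bisectTop T₀.size) Prog.pushParent)
        (Prog.bisectTop T₀.size))).effect σ₀ := by
    rw [hσ₀, ← hk6]; rfl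
  have v5 : σ₀.var 5 = k.code := by simp [hσ₀]
  have v2 : σ₀.var 2 = s.length + 1 := by simp [hσ₀, h.stack_length]
  have core₀ : Core M σ₀ := h.core.congr rfl rfl rfl rfl (by simp [hσ₀])
  have hkB : k ∈ B := h.stack_subset k (by simp)
  have hsB : ∀ K ∈ s, K ∈ B := fun K hK => h.stack_subset K (by simp [hK])
  have hsort := List.pairwise_cons.1 h.sorted
  have hlen := length_le_card h.core.nodup h.subset
  have ecode : ∀ g, Expr.eval σ₀ (.sub (.add (.var 5) (.const 1)) (.const (2 ^ g * T₀.size))) ≠ 0 ↔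
      g ≤ k.gen := fun g => by
    rw [← le_gen_iff_code_sub]; simp [Expr.eval, v5]
  have ecode1 := ecode 1
  rw [pow_one] at ecode1
  have emark : ∀ K : T₀.Elem, σ₀.arr 3 K.code = if K ∈ M then 1 else 0 := core₀.mark
  rw [hstep]
  -- the top of the stack is bisected already
  by_cases hkM : k ∈ M
  · rw [Prog.effect_cond_pos]
    swap
    · simp [Expr.eval, v5, emark, hkM]
    have hcov : ∀ K, K ∈ M ∨ K ∈ k :: s → K ∈ M ∨ K ∈ s := by
      rintro K (hK | hK)
      · exact Or.inl hK
      · rcases List.mem_cons.1 hK with rfl | hK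
        · exact Or.inl hkM
        · exact Or.inr hK
    refine ⟨M, s, ⟨core₀.congr rfl rfl rfl rfl (by simp [Prog.pop, Prog.effect]), h.subset, hsB,
      h.stack_holds.2, by simp [Prog.pop, Prog.effect, Expr.eval, v2], hsort.2,
      fun K hK L hL => hcov L (h.partner K hK L hL)⟩, ?_, hcov⟩
    have := sub_card_union_anti (B := B) hcov
    simp only [potential, List.length_cons] at this ⊢
    omega
  -- the top of the stack is bisected, and its neighbour across the refinement edge takes its place
  have key : (k.gen = 0 ∨ k.parent ∈ M) → ∃ M' s',
      Closing B M' s' ((Prog.bisectTop T₀.size).effect σ₀) ∧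
      potential B M' s' < potential B M (k :: s) ∧
      ∀ K, K ∈ M ∨ K ∈ k :: s → K ∈ M' ∨ K ∈ s' := by
    intro hpar
    have hcore := core₀.bisectTop v5 hkM hpar
    have hst := bisectTop_stack core₀ v5 hpar
    have hsub : ∀ K ∈ k :: M, K ∈ B := fun K hK => by
      rcases List.mem_cons.1 hK with rfl | hK
      · exact hkB
      · exact h.subset K hK
    have hlen' := length_le_card hcore.nodup hsub
    rw [List.length_cons] at hlen'
    have hcov : ∀ s' : List T₀.Elem, (∀ K ∈ s, K ∈ s') →
        ∀ K, K ∈ M ∨ K ∈ k :: s → K ∈ k :: M ∨ K ∈ s' := by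
      rintro s' hs' K (hK | hK)
      · exact Or.inl (by simp [hK])
      · rcases List.mem_cons.1 hK with rfl | hK
        · exact Or.inl (by simp)
        · exact Or.inr (hs' K hK)
    have hpot : ∀ s' : List T₀.Elem, (∀ K ∈ s, K ∈ s') → (∀ K ∈ s', K ∈ B) →
        s'.length ≤ s.length + 1 → potential B (k :: M) s' < potential B M (k :: s) := by
      intro s' hs' hs'B hl
      have := sub_card_union_anti (B := B) (hcov s' hs')
      simp only [potential, List.length_cons] at this ⊢
      omega
    by_cases hn : ∃ L, Elem.IsNbr 0 k L
    · obtain ⟨L, hL⟩ := hn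
      have hn0 : k.nbrCode 0 ≠ 0 := by rw [Elem.nbrCode_eq hL]; exact L.code_pos.ne'
      rw [if_neg hn0, if_neg hn0, Elem.nbrCode_eq hL, v2, Nat.add_sub_cancel] at hst
      have hLB := hB' k hkB L hL
      have hs'B : ∀ K ∈ L :: s, K ∈ B := fun K hK => by
        rcases List.mem_cons.1 hK with rfl | hK
        · exact hLB
        · exact hsB K hK
      have hsub' : ∀ K ∈ s, K ∈ L :: s := fun K hK => by simp [hK]
      refine ⟨k :: M, L :: s, ⟨hcore, hsub, hs'B, ?_, by rw [hst.2]; rfl,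
        List.pairwise_cons.2 ⟨fun K hK => hL.1 ▸ hsort.1 K hK, hsort.2⟩, ?_⟩,
        hpot _ hsub' hs'B le_rfl, hcov _ hsub'⟩
      · rw [hst.1]; exact h.stack_holds.2.cons L
      · intro K hK L' hL'
        rcases List.mem_cons.1 hK with rfl | hK
        · exact Or.inr (by rw [hL.unique hL']; simp)
        · exact hcov _ hsub' L' (h.partner K hK L' hL')
    · have hn0 := Elem.nbrCode_eq_zero hn
      rw [if_pos hn0, if_pos hn0, v2, Nat.add_sub_cancel] at hst
      refine ⟨k :: M, s, ⟨hcore, hsub, hsB, ?_, hst.2, hsort.2, ?_⟩,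
        hpot _ (fun _ h => h) hsB (by omega), hcov _ fun _ h => h⟩
      · rw [hst.1]; exact h.stack_holds.2
      · intro K hK L' hL'
        rcases List.mem_cons.1 hK with rfl | hK
        · exact absurd ⟨L', hL'⟩ hn
        · exact hcov _ (fun _ h => h) L' (h.partner K hK L' hL')
  rw [Prog.effect_cond_neg]
  swap
  · simp [Expr.eval, v5, emark, hkM]
  by_cases hg : 1 ≤ k.gen
  swap
  · rw [Prog.effect_cond_neg]
    swap
    · exact not_not.1 (mt ecode1.1 hg)
    exact key (Or.inl (by omega))
  rw [Prog.effect_cond_pos]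
  swap
  · exact ecode1.2 hg
  by_cases hpM : k.parent ∈ M
  · rw [Prog.effect_cond_pos]
    swap
    · simp [Expr.eval, v5, Elem.code_half hg, emark, hpM]
    exact key (Or.inr hpM)
  -- the parent has to be bisected first; it is pushed
  rw [Prog.effect_cond_neg]
  swap
  · simp [Expr.eval, v5, Elem.code_half hg, emark, hpM]
  obtain ⟨b, hb⟩ := Elem.exists_eq_child hg
  have hpB : k.parent ∈ B := hB k.parent b (hb ▸ hkB)
  have hgp : k.parent.gen < k.gen := by rw [Elem.gen_parent]; omega
  have hs'B : ∀ K ∈ k.parent :: k :: s, K ∈ B := fun K hK => by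
    rcases List.mem_cons.1 hK with rfl | hK
    · exact hpB
    · exact h.stack_subset K hK
  -- all elements on the stack have a higher generation than the parent
  have hnot : k.parent ∉ k :: s := fun hmem => by
    rcases List.mem_cons.1 hmem with he | hmem
    · exact absurd (congrArg Elem.gen he) hgp.ne
    · exact absurd (hsort.1 _ hmem) (by omega)
  have hcov : ∀ K, K ∈ M ∨ K ∈ k :: s → K ∈ M ∨ K ∈ k.parent :: k :: s :=
    fun K hK => hK.imp id (List.mem_cons_of_mem _)
  refine ⟨M, k.parent :: k :: s, ⟨core₀.congr rfl rfl rfl rfl (by simp [Prog.pushParent,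
    Prog.effect]), h.subset, hs'B, ?_, by simp [Prog.pushParent, Prog.effect, Expr.eval, v2],
    List.pairwise_cons.2 ⟨fun K hK => ?_, h.sorted⟩, fun K hK L hL =>
      hcov L (h.partner K hK L hL)⟩, ?_, hcov⟩
  · have := h.stack_holds.cons k.parent
    rw [← Elem.code_half hg, List.length_cons, ← v2, ← v5] at this
    simpa [Prog.pushParent, Prog.effect, Expr.eval] using this
  · rcases List.mem_cons.1 hK with rfl | hK
    · exact hgp
    · exact hgp.trans (hsort.1 K hK)
  · -- the union of bisected elements and stack has grown
    have h1 := card_union_le h.subset hs'B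
    have h2 : M.toFinset ∪ (k.parent :: k :: s).toFinset =
        insert k.parent (M.toFinset ∪ (k :: s).toFinset) := by
      ext K; simp only [Finset.mem_union, Finset.mem_insert, List.mem_toFinset, List.mem_cons]
      tauto
    rw [h2, Finset.card_insert_of_notMem
      (by simp only [Finset.mem_union, List.mem_toFinset]; tauto)] at h1
    simp only [potential, h2, Finset.card_insert_of_notMem (show k.parent ∉ M.toFinset ∪
      (k :: s).toFinset by simp only [Finset.mem_union, List.mem_toFinset]; tauto)]
    simp only [List.length_cons]
    omega

end Step

end InitialMesh

/-! ### Amortized cost of the closure -/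

lemma Store.update_var_self (σ : Store) (x v : ℕ) :
    ({ σ with var := Function.update σ.var x v } : Store).var x = v := Function.update_self _ _ _

namespace Prog

/-- The number of operations per bisected element, and per call, of the program `close`. -/
def closeCost (m : ℕ) : ℕ := 4 * ((closeStep m).maxCost + 2) + 7

/-- Run a program for each member of a list, starting with the last one. -/
def forEach {α : Type*} (l : List α) (c : α → Prog) : Prog := l.foldr (fun x p => seq p (c x)) skip

lemma forEach_loopFree {α : Type*} {l : List α} {c : α → Prog} (h : ∀ x, (c x).LoopFree) :
    (forEach l c).LoopFree := by
  induction l with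
  | nil => trivial
  | cons x l ih => exact ⟨ih, h x⟩

lemma forEach_avoidsVar {α : Type*} {l : List α} {c : α → Prog} {n : ℕ}
    (h : ∀ x, (c x).AvoidsVar n) : (forEach l c).AvoidsVar n := by
  induction l with
  | nil => trivial
  | cons x l ih => exact ⟨ih, h x⟩

lemma forEach_avoidsArr {α : Type*} {l : List α} {c : α → Prog} {n : ℕ}
    (h : ∀ x, (c x).AvoidsArr n) : (forEach l c).AvoidsArr n := by
  induction l with
  | nil => trivial
  | cons x l ih => exact ⟨ih, h x⟩

lemma close_avoidsVar {m n : ℕ} (h2 : n ≠ 2) (h3 : n ≠ 3) (h5 : n ≠ 5) :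
    (close m).AvoidsVar n := by
  simp [close, closeStep, bisectTop, record, replaceTop, inherit, pushParent, pop, AvoidsVar,
    h2.symm, h3.symm, h5.symm]

lemma close_avoidsArr {m n : ℕ} (h : n < 3) : (close m).AvoidsArr n := by
  have h' : ∀ a ≥ 3, a ≠ n := fun a ha => by omega
  simp [close, closeStep, bisectTop, record, replaceTop, inherit, pushParent, pop, AvoidsArr, h']

end Prog

namespace InitialMesh

variable {T₀ : InitialMesh}

section Grows

variable {B : Finset T₀.Elem} {M M₁ M' : List T₀.Elem} {σ σ₁ σ' : Store} {c c₁ c₂ : Prog}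
  {b b₁ b₂ : ℕ}

/-- The program enlarges the closed list `M` of bisected elements to `M'`. Up to a number of `b`
operations, the operations are paid for by the new elements. -/
structure Grows (B : Finset T₀.Elem) (c : Prog) (M : List T₀.Elem) (σ : Store)
    (M' : List T₀.Elem) (σ' : Store) (b : ℕ) : Prop where
  closing : Closing B M' [] σ'
  subset : M ⊆ M'
  runs : ∃ T, c.Runs σ σ' T ∧ T + Prog.closeCost T₀.size * M.length ≤
    Prog.closeCost T₀.size * M'.length + b

lemma Grows.mono (h : Grows B c M σ M' σ' b) (hb : b ≤ b₁) : Grows B c M σ M' σ' b₁ :=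
  ⟨h.closing, h.subset, let ⟨T, h1, h2⟩ := h.runs; ⟨T, h1, by omega⟩⟩

lemma Grows.seq (h₁ : Grows B c₁ M σ M₁ σ₁ b₁) (h₂ : Grows B c₂ M₁ σ₁ M' σ' b₂) :
    Grows B (.seq c₁ c₂) M σ M' σ' (b₁ + b₂) := by
  obtain ⟨T₁, r₁, l₁⟩ := h₁.runs
  obtain ⟨T₂, r₂, l₂⟩ := h₂.runs
  exact ⟨h₂.closing, List.Subset.trans h₁.subset h₂.subset, _, r₁.seq r₂, by omega⟩

lemma Grows.cond_true {e : Expr} (he : e.eval σ ≠ 0) (h : Grows B c₁ M σ M' σ' b) :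
    Grows B (.cond e c₁ c₂) M σ M' σ' (e.cost + 1 + b) := by
  obtain ⟨T, r, l⟩ := h.runs
  exact ⟨h.closing, h.subset, _, r.cond_true he, by omega⟩

lemma Grows.cond_false {e : Expr} (he : e.eval σ = 0) (h : Grows B c₂ M σ M' σ' b) :
    Grows B (.cond e c₁ c₂) M σ M' σ' (e.cost + 1 + b) := by
  obtain ⟨T, r, l⟩ := h.runs
  exact ⟨h.closing, h.subset, _, r.cond_false he, by omega⟩

lemma Grows.var_eq (h : Grows B c M σ M' σ' b) {x : ℕ} (hc : c.AvoidsVar x) :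
    σ'.var x = σ.var x := let ⟨_, r, _⟩ := h.runs; r.var_eq hc

lemma Grows.arr_eq (h : Grows B c M σ M' σ' b) {a : ℕ} (hc : c.AvoidsArr a) :
    σ'.arr a = σ.arr a := let ⟨_, r, _⟩ := h.runs; r.arr_eq hc

/-- Programs that do not interfere with the closure. -/
lemma Grows.of_loopFree (h : Closing B M [] σ) (hl : c.LoopFree)
    (hv : ∀ x, x = 2 ∨ x = 3 → c.AvoidsVar x)
    (ha : ∀ a, a = 3 ∨ a = 4 ∨ a = 5 ∨ a = 7 → c.AvoidsArr a) :
    Grows B c M σ M (c.effect σ) c.maxCost where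
  closing :=
    { core := h.core.congr (Prog.effect_arr_eq hl (ha 3 (by simp)) _)
        (Prog.effect_arr_eq hl (ha 4 (by simp)) _) (Prog.effect_arr_eq hl (ha 5 (by simp)) _)
        (Prog.effect_arr_eq hl (ha 7 (by simp)) _) (Prog.effect_var_eq hl (hv 3 (by simp)) _)
      subset := h.subset
      stack_subset := h.stack_subset
      stack_holds := trivial
      stack_length := by rw [Prog.effect_var_eq hl (hv 2 (by simp)), h.stack_length]
      sorted := h.sorted
      partner := h.partner }
  subset := List.Subset.refl M
  runs := ⟨_, Prog.runs_effect hl σ, by omega⟩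

lemma Grows.assign (h : Closing B M [] σ) {x : ℕ} (hx : x ≠ 2) (hx' : x ≠ 3) (e : Expr) :
    Grows B (.assign x e) M σ M { σ with var := Function.update σ.var x (e.eval σ) }
      (e.cost + 1) :=
  Grows.of_loopFree h trivial (by rintro y (rfl | rfl) <;> simpa [Prog.AvoidsVar])
    fun _ _ => trivial

lemma Closing.partner_mem (h : Closing B M [] σ) {K L : T₀.Elem} (hK : K ∈ M)
    (hL : Elem.IsNbr 0 K L) : L ∈ M := by simpa using h.partner K hK L hL

/-- Bisecting one element and all elements that have to be bisected with it. With the element alone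
on the stack, the potential exceeds four times the number of elements of `B` that are not bisected
yet by at most one, and with an empty stack it equals four times this number. -/
lemma exists_grows_close (h : Closing B M [] σ) (hB : ParentClosed B) (hB' : PartnerClosed B)
    {p : T₀.Elem} (hp : p ∈ B) (h4 : σ.var 4 = p.code) :
    ∃ M' σ', Grows B (Prog.close T₀.size) M σ M' σ' (Prog.closeCost T₀.size) ∧ p ∈ M' := by
  set σ₀ : Store :=
    { var := Function.update σ.var 2 1
      arr := Function.update σ.arr 6 (Function.update (σ.arr 6) 0 p.code) } with hσ₀
  have h₀ : Closing B M [p] σ₀ :=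
    { core := h.core.congr (by simp [hσ₀]) (by simp [hσ₀]) (by simp [hσ₀]) (by simp [hσ₀])
        (by simp [hσ₀])
      subset := h.subset
      stack_subset := by simpa using hp
      stack_holds := ⟨by simp [hσ₀], trivial⟩
      stack_length := by simp [hσ₀]
      sorted := by simp
      partner := fun K hK L hL => Or.inl (h.partner_mem hK hL) }
  obtain ⟨n', -, σ', hr, ⟨M', s', hC, hpot, hcov⟩, he⟩ := Prog.runs_loop (e := .var 2)
    (c := Prog.closeStep T₀.size) (T := (Prog.closeStep T₀.size).maxCost)
    (fun n τ => ∃ M' s', Closing B M' s' τ ∧ potential B M' s' = n ∧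
      ∀ K, K ∈ M ∨ K ∈ [p] → K ∈ M' ∨ K ∈ s')
    (by
      rintro n τ ⟨M₁, s₁, hC, rfl, hcov⟩ he
      rcases s₁ with _ | ⟨k, s⟩
      · exact absurd hC.stack_length he
      · obtain ⟨M', s', hC', hpot, hcov'⟩ := hC.closeStep hB hB'
        exact ⟨_, hpot, _, Prog.runs_effect (Prog.closeStep_loopFree _) _, M', s', hC', rfl,
          fun K hK => hcov' K (hcov K hK)⟩)
    (potential B M [p]) σ₀ ⟨M, [p], h₀, rfl, fun _ h => h⟩
  obtain rfl : s' = [] := List.length_eq_zero_iff.1 (hC.stack_length.symm.trans he)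
  have hcov' : ∀ K, K ∈ M ∨ K ∈ [p] → K ∈ M' := fun K hK => by simpa using hcov K hK
  have hsub : M ⊆ M' := fun K hK => hcov' K (Or.inl hK)
  have l1 : M.length ≤ M'.length := (h.core.nodup.subperm hsub).length_le
  have l2 := length_le_card hC.core.nodup hC.subset
  have hpot' : potential B M [p] - n' ≤ 4 * (M'.length - M.length) + 1 := by
    have : M.length ≤ (M.toFinset ∪ [p].toFinset).card := by
      rw [← List.toFinset_card_of_nodup h.core.nodup]
      exact Finset.card_le_card Finset.subset_union_left
    rw [← hpot]
    simp only [potential, List.toFinset_nil, Finset.union_empty,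
      List.toFinset_card_of_nodup hC.core.nodup, List.length_nil, List.length_singleton]
    omega
  refine ⟨M', σ', ⟨hC, hsub, 3 + (2 + _), Prog.Runs.seq (σ₁ := { σ with
    arr := Function.update σ.arr 6 (Function.update (σ.arr 6) 0 p.code) }) ⟨3, le_rfl, ?_⟩
    (Prog.Runs.seq (σ₁ := σ₀) ⟨2, le_rfl, ?_⟩ hr), ?_⟩, hcov' p (by simp)⟩
  · rw [← h4]; exact Exec.write σ 6 (.const 0) (.var 4)
  · exact Exec.assign _ 2 (.const 1)
  · set A := (Prog.closeStep T₀.size).maxCost with hA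
    obtain ⟨d, hd⟩ := Nat.exists_eq_add_of_le l1
    rw [hd, Nat.add_sub_cancel_left] at hpot'
    have hx : Expr.cost (.var 2) = 1 := rfl
    have := Nat.mul_le_mul_right (A + 2) hpot'
    rw [hx, Prog.closeCost, ← hA, hd, show 1 + 1 + A = A + 2 by omega]
    nlinarith

end Grows

/-! ### The elements required by one hat function -/

section Position

variable {K L : T₀.Elem} {z : Pt}

/-- A bound for the number of elements of one generation that contain a given point. -/
lemma exists_valence_bound (T₀ : InitialMesh) : ∃ V, ∀ (g : ℕ) (z : Pt) (S : Finset T₀.Elem),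
    (∀ L ∈ S, L.gen = g ∧ z ∈ L.tri.body) → S.card ≤ V := by
  obtain ⟨V, hV⟩ := exists_card_near_le (T₀ := T₀) 0 le_rfl
  exact ⟨V, fun g z S hS => hV g z S fun K hK => ⟨(hS K hK).1, z, (hS K hK).2, by simp⟩⟩

lemma tri_keep_eq {b : Bool} (hz : K.tri (keep b) ∈ T₀.domain) (hg : 2 ≤ K.gen)
    (hgL : L.gen = K.gen) (hL : K.tri (keep b) ∈ Set.range L.tri) :
    L.tri (keep b) = K.tri (keep b) := by
  obtain ⟨V, hV⟩ := exists_valence_bound T₀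
  obtain ⟨t, -, ht⟩ := exists_walk_eq hz hg (hV K.gen _) hgL hL
  obtain ⟨h1, h2⟩ := iterate_walk hz hg t
  rcases ht with rfl | ht
  · exact h2
  · rw [ht.tri_keep (by omega), h2]

/-- From generation two on, an interior vertex has the same position in all elements of one
generation. -/
lemma position_eq (hz : z ∈ T₀.domain) (hg : 2 ≤ K.gen) (hgL : L.gen = K.gen) {k l : Fin 3}
    (hk : K.tri k = z) (hl : L.tri l = z) : k = l := by
  by_cases h : ∃ b, k = keep b
  · obtain ⟨b, rfl⟩ := h
    have := tri_keep_eq (hk ▸ hz) hg hgL ⟨l, hl.trans hk.symm⟩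
    exact Tri.injective L.det_ne ((this.trans hk).trans hl.symm)
  · by_cases h' : ∃ b, l = keep b
    · obtain ⟨b, rfl⟩ := h'
      have := tri_keep_eq (hl ▸ hz) (hgL ▸ hg) hgL.symm ⟨k, hk.trans hl.symm⟩
      exact (Tri.injective K.det_ne ((this.trans hl).trans hk.symm)).symm
    · have hk0 : ∀ k : Fin 3, (¬ ∃ b, k = keep b) → k = 0 := by decide
      rw [hk0 k h, hk0 l h']

end Position

end InitialMesh

/-! ### Processing one item of the input

The current position in the input is in variable `1`. Variable `4` receives the elements that have
to be bisected. -/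

namespace Prog

/-- An expression that vanishes exactly if `x` has the value `n`. -/
def differs (x : Expr) (n : ℕ) : Expr := .add (.sub x (.const n)) (.sub (.const n) x)

/-- The expression for `x % 2`. -/
def odd (x : Expr) : Expr := .sub x (.add (.half x) (.half x))

/-- One step of the walk around a vertex: bisect the element in variable `4`, and go to the
neighbour of the neighbour. The direction of the walk depends on which child of the element was
given in the input. -/
def walkOn (m : ℕ) : Prog :=
  seq (close m) (seq (assign 4 (.read 4 (.var 4)))
    (cond (odd (.read 1 (.var 1))) (assign 4 (.read 5 (.var 4))) (assign 4 (sibling (.var 4)))))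

/-- Processing an item of a level higher than one; `V` is a bound for the number of elements around
a vertex. -/
def highItem (m V : ℕ) : Prog :=
  seq (assign 4 (.half (.read 1 (.var 1))))
    (cond (.read 2 (.var 1))
      (cond (.sub (.read 2 (.var 1)) (.const 1))
        (forEach (List.range V) fun _ => walkOn m)
        (seq (assign 4 (.half (.var 4))) (close m)))
      (close m))

/-- Processing an item of level one by means of a table. Each entry consists of an element, the
position of a vertex, and an element that has to be bisected. -/
def lowItem (m : ℕ) (table : List (ℕ × ℕ × ℕ)) : Prog :=
  forEach table fun q => cond (differs (.read 1 (.var 1)) q.1) skip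
    (cond (differs (.read 2 (.var 1)) q.2.1) skip (seq (assign 4 (.const q.2.2)) (close m)))

/-- Processing one item of the input. -/
def item (m V : ℕ) (table : List (ℕ × ℕ × ℕ)) : Prog :=
  cond (.read 0 (.var 1))
    (cond (.sub (.read 0 (.var 1)) (.const 1)) (highItem m V) (lowItem m table)) skip

lemma item_avoidsVar {m V : ℕ} {table : List (ℕ × ℕ × ℕ)} {n : ℕ} (h2 : n ≠ 2) (h3 : n ≠ 3)
    (h4 : n ≠ 4) (h5 : n ≠ 5) : (item m V table).AvoidsVar n := by
  have hc : (close m).AvoidsVar n := close_avoidsVar h2 h3 h5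
  refine ⟨⟨⟨h4.symm, ⟨forEach_avoidsVar fun _ => ?_, h4.symm, hc⟩, hc⟩,
    forEach_avoidsVar fun _ => ?_⟩, trivial⟩
  · exact ⟨hc, h4.symm, h4.symm, h4.symm⟩
  · exact ⟨trivial, trivial, h4.symm, hc⟩

lemma item_avoidsArr {m V : ℕ} {table : List (ℕ × ℕ × ℕ)} {n : ℕ} (h : n < 3) :
    (item m V table).AvoidsArr n := by
  have hc : (close m).AvoidsArr n := close_avoidsArr h
  refine ⟨⟨⟨trivial, ⟨forEach_avoidsArr fun _ => ?_, trivial, hc⟩, hc⟩,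
    forEach_avoidsArr fun _ => ?_⟩, trivial⟩
  · exact ⟨hc, trivial, trivial, trivial⟩
  · exact ⟨trivial, trivial, trivial, hc⟩

lemma eval_differs (x : Expr) (n : ℕ) (σ : Store) : (differs x n).eval σ = 0 ↔ x.eval σ = n := by
  simp only [differs, Expr.eval]; omega

end Prog

namespace InitialMesh

variable {T₀ : InitialMesh} {B : Finset T₀.Elem} {M : List T₀.Elem} {σ : Store}

lemma eval_odd {x : Expr} {K : T₀.Elem} {b : Bool} (h : x.eval σ = (K.child b).code) :
    (Prog.odd x).eval σ = b.toNat := by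
  simp only [Prog.odd, Expr.eval, h, Elem.code_child_half]
  rw [Elem.code_child]; omega

/-- The number of operations for one step of the walk around a vertex, apart from those that are
paid for by bisected elements. -/
def walkCost (m : ℕ) : ℕ := Prog.closeCost m + 3 + ((Prog.odd (.read 1 (.var 1))).cost + 1 +
  ((Prog.sibling (.var 4)).cost + 1))

/-- One step of the walk around a vertex. -/
lemma exists_grows_walkOn (h : Closing B M [] σ) (hB : ParentClosed B) (hB' : PartnerClosed B)
    {P K L : T₀.Elem} {b : Bool} (hc : σ.arr 1 (σ.var 1) = (P.child b).code) (hg : 2 ≤ K.gen)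
    (hK : K ∈ B) (h4 : σ.var 4 = K.code) (hL : WalkStep b K L) :
    ∃ M' σ', Grows B (Prog.walkOn T₀.size) M σ M' σ' (walkCost T₀.size) ∧ K ∈ M' ∧
      σ'.var 4 = L.code := by
  obtain ⟨M₁, σ₁, hG, hK₁⟩ := exists_grows_close h hB hB' hK h4
  obtain ⟨Q, hQ, hQL⟩ := hL
  have hpar : ∀ X ∈ M₁, 0 < X.gen → X.parent ∈ M₁ := fun X hX h0 => by
    obtain ⟨c, hc⟩ := Elem.exists_eq_child h0
    exact hG.closing.core.parent _ c (hc ▸ hX)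
  have e4 : σ₁.var 4 = K.code := by
    rw [hG.var_eq (Prog.close_avoidsVar (by decide) (by decide) (by decide)), h4]
  have e1 : σ₁.arr 1 (σ₁.var 1) = (P.child b).code := by
    rw [hG.var_eq (Prog.close_avoidsVar (by decide) (by decide) (by decide)),
      hG.arr_eq (Prog.close_avoidsArr (by decide)), hc]
  have hG₂ := Grows.assign hG.closing (x := 4) (by decide) (by decide) (.read 4 (.var 4))
  set σ₂ : Store := { σ₁ with
    var := Function.update σ₁.var 4 (Expr.eval σ₁ (.read 4 (.var 4))) } with hσ₂
  have hQ₁ : Q ∈ M₁ := hG.closing.partner_mem hK₁ hQ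
  have hgQ : Q.gen = K.gen := hQ.1.symm
  have e4₂ : σ₂.var 4 = Q.code := by
    simp [hσ₂, Expr.eval, e4, hG.closing.core.nbr_zero K (Or.inr (hpar K hK₁ (by omega))),
      Elem.nbrCode_eq hQ]
  have e1₂ : Expr.eval σ₂ (.read 1 (.var 1)) = (P.child b).code := by
    simp [hσ₂, Expr.eval, e1]
  have hodd := eval_odd e1₂
  clear_value σ₂
  cases b
  · have hG₃ := Grows.assign hG₂.closing (x := 4) (by decide) (by decide) (Prog.sibling (.var 4))
    have hG₄ := Grows.cond_false (e := Prog.odd (.read 1 (.var 1)))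
      (c₁ := .assign 4 (.read 5 (.var 4))) hodd hG₃
    refine ⟨_, _, ((hG.seq (hG₂.seq hG₄))).mono ?_, hK₁, ?_⟩
    · simp only [walkCost, Prog.sibling, Expr.cost]; omega
    · obtain ⟨c, hc⟩ := Elem.exists_eq_child (K := Q) (by omega)
      have hQ' : Elem.IsNbr 2 Q (Q.parent.child !c) := by
        have := Elem.isNbr_two_child Q.parent c
        rwa [← hc] at this
      rw [show L = Q.parent.child !c from hQL.unique hQ']
      exact (Store.update_var_self _ _ _).trans <| eval_sibling (by rw [← hc]; exact e4₂)
  · have hG₃ := Grows.assign hG₂.closing (x := 4) (by decide) (by decide) (.read 5 (.var 4))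
    have hG₄ := Grows.cond_true (e := Prog.odd (.read 1 (.var 1)))
      (c₂ := .assign 4 (Prog.sibling (.var 4))) (by rw [hodd]; simp) hG₃
    refine ⟨_, _, ((hG.seq (hG₂.seq hG₄))).mono ?_, hK₁, ?_⟩
    · simp only [walkCost, Prog.sibling, Expr.cost]; omega
    · refine (Store.update_var_self _ _ _).trans ?_
      rw [Expr.eval, Expr.eval, e4₂,
        hG₂.closing.core.nbr_one Q (by omega) (Or.inr (hpar Q hQ₁ (by omega)))]
      exact Elem.nbrCode_eq hQL

lemma walkOn_avoidsVar (m : ℕ) : (Prog.walkOn m).AvoidsVar 1 :=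
  have h : (4 : ℕ) ≠ 1 := by decide
  ⟨Prog.close_avoidsVar (by decide) (by decide) (by decide), h, h, h⟩

lemma walkOn_avoidsArr (m : ℕ) : (Prog.walkOn m).AvoidsArr 1 :=
  ⟨Prog.close_avoidsArr (by decide), trivial, trivial, trivial⟩

/-- The walk around an interior vertex. -/
lemma exists_grows_walk (h : Closing B M [] σ) (hB : ParentClosed B) (hB' : PartnerClosed B)
    {P : T₀.Elem} {b : Bool} (hc : σ.arr 1 (σ.var 1) = (P.child b).code)
    (h4 : σ.var 4 = P.code) (hz : P.tri (keep b) ∈ T₀.domain) (hg : 2 ≤ P.gen)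
    (hmem : ∀ t, (walk b)^[t] P ∈ B) {α : Type*} (l : List α) :
    ∃ M' σ', Grows B (Prog.forEach l fun _ => Prog.walkOn T₀.size) M σ M' σ'
      (l.length * walkCost T₀.size + 1) ∧ (∀ t < l.length, (walk b)^[t] P ∈ M') ∧
      σ'.var 4 = ((walk b)^[l.length] P).code := by
  induction l with
  | nil =>
    exact ⟨M, σ, ⟨h, List.Subset.refl M, 1, ⟨1, le_rfl, .skip σ⟩, by simp; omega⟩, by simp, h4⟩
  | cons x l ih =>
    obtain ⟨M₁, σ₁, hG, ht, h4₁⟩ := ih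
    have hv := hG.var_eq (x := 1) (Prog.forEach_avoidsVar fun _ => walkOn_avoidsVar _)
    have ha := hG.arr_eq (a := 1) (Prog.forEach_avoidsArr fun _ => walkOn_avoidsArr _)
    obtain ⟨M', σ', hG', hK, h4'⟩ := exists_grows_walkOn hG.closing hB hB'
      (by rw [hv, ha]; exact hc) (by rw [(iterate_walk hz hg _).1]; exact hg) (hmem _) h4₁
      (walkStep_iterate hz hg l.length)
    refine ⟨M', σ', (hG.seq hG').mono ?_, fun t ht' => ?_, h4'⟩
    · rw [List.length_cons, add_mul]; omega
    · rcases Nat.lt_succ_iff_lt_or_eq.1 ht' with h' | rfl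
      · exact hG'.subset (ht t h')
      · exact hK

end InitialMesh

namespace InitialMesh

variable {T₀ : InitialMesh} {B : Finset T₀.Elem} {M : List T₀.Elem} {σ : Store}

section Required

variable {K P : T₀.Elem} {k : Fin 3} {j : ℕ} {z : Pt}

/-- If `z` is the newest vertex of an element, the required elements are its parent and the neighbour
of the parent across the refinement edge. -/
lemma requires_zero (hz : z ∈ T₀.domain) (hK : K.gen = 2 * j) (hk : K.tri 0 = z)
    (h : T₀.Requires j z P) : P = K.parent ∨ Elem.IsNbr 0 K.parent P := by
  obtain ⟨L, l, hj, hL, hl, rfl⟩ := h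
  obtain rfl := position_eq hz (by omega) (by omega) hk hl
  obtain ⟨b, hb⟩ := Elem.exists_eq_child (K := K) (by omega)
  obtain ⟨c, hc⟩ := Elem.exists_eq_child (K := L) (by omega)
  rw [if_neg (by decide)]
  have hm : midpoint ℝ (K.parent.tri 1) (K.parent.tri 2) ∈ L.parent.tri.body := by
    have h1 : midpoint ℝ (K.parent.tri 1) (K.parent.tri 2) = K.tri 0 := by
      conv_rhs => rw [hb]
      rfl
    rw [h1, hk, ← hl]
    exact Elem.body_subset_parent L (Elem.range_subset_body L ⟨0, rfl⟩)
  exact (Elem.eq_or_isNbr_of_midpoint_mem (by rw [Elem.gen_parent, Elem.gen_parent, hK, hL])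
    hm).imp_left Eq.symm

lemma tri_one_eq (hg : 2 ≤ K.gen) :
    K.tri 1 = midpoint ℝ (K.parent.parent.tri 1) (K.parent.parent.tri 2) := by
  obtain ⟨b, hb⟩ := Elem.exists_eq_child (K := K) (by omega)
  obtain ⟨c, hc⟩ := Elem.exists_eq_child (K := K.parent) (by rw [Elem.gen_parent]; omega)
  conv_lhs => rw [hb, hc]
  rfl

lemma requires_one (hz : z ∈ T₀.domain) (hK : K.gen = 2 * j) (hk : K.tri 1 = z)
    (h : T₀.Requires j z P) : P = K.parent.parent ∨ Elem.IsNbr 0 K.parent.parent P := by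
  obtain ⟨L, l, hj, hL, hl, rfl⟩ := h
  obtain rfl := position_eq hz (by omega) (by omega) hk hl
  rw [if_pos rfl]
  have hm : midpoint ℝ (K.parent.parent.tri 1) (K.parent.parent.tri 2) ∈
      L.parent.parent.tri.body := by
    rw [← tri_one_eq (by omega), hk, ← hl]
    exact Elem.body_subset_parent _
      (Elem.body_subset_parent L (Elem.range_subset_body L ⟨1, rfl⟩))
  exact (Elem.eq_or_isNbr_of_midpoint_mem (by simp only [Elem.gen_parent, hK, hL]) hm).imp_left
    Eq.symm

lemma tri_two_child (K : T₀.Elem) (b : Bool) : (K.child b).tri 2 = K.tri (keep b) := by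
  cases b <;> rfl

lemma requires_two (hz : z ∈ T₀.domain) {b : Bool} (hj : 1 < j) (hP : P.gen + 1 = 2 * j)
    (hk : P.tri (keep b) = z) {V : ℕ}
    (hV : ∀ (g : ℕ) (z : Pt) (S : Finset T₀.Elem),
      (∀ L ∈ S, L.gen = g ∧ z ∈ L.tri.body) → S.card ≤ V) {Q : T₀.Elem}
    (h : T₀.Requires j z Q) :
    ∃ t < V, Q = (walk b)^[t] P ∨ Elem.IsNbr 0 ((walk b)^[t] P) Q := by
  obtain ⟨L, l, -, hL, hl, rfl⟩ := h
  obtain rfl := position_eq (K := P.child b) hz (by simp; omega) (by simp; omega)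
    ((tri_two_child P b).trans hk) hl
  rw [if_neg (by decide)]
  obtain ⟨c, hc⟩ := Elem.exists_eq_child (K := L) (by omega)
  refine exists_walk_eq (hk ▸ hz) (by omega) (hV P.gen _) (by rw [Elem.gen_parent]; omega) ?_
  rw [hk, ← hl, hc, tri_two_child]
  exact ⟨_, rfl⟩

end Required

/-- The number of operations for an item of a level higher than one, apart from those that are paid
for by bisected elements. The summand `100` is a generous bound for the tests. -/
def highCost (m V : ℕ) : ℕ := V * walkCost m + Prog.closeCost m + 100

/-- Processing an item of a level higher than one. -/
lemma exists_grows_highItem (h : Closing B M [] σ) (hB : ParentClosed B) (hB' : PartnerClosed B)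
    {V : ℕ} (hV : ∀ (g : ℕ) (z : Pt) (S : Finset T₀.Elem),
      (∀ L ∈ S, L.gen = g ∧ z ∈ L.tri.body) → S.card ≤ V)
    {K : T₀.Elem} {k : Fin 3} {j : ℕ} (hj : 1 < j) (hK : K.gen = 2 * j)
    (hz : K.tri k ∈ T₀.domain) (hreq : ∀ P, T₀.Requires j (K.tri k) P → P ∈ B)
    (h1 : σ.arr 1 (σ.var 1) = K.code) (h2 : σ.arr 2 (σ.var 1) = k) :
    ∃ M' σ', Grows B (Prog.highItem T₀.size V) M σ M' σ' (highCost T₀.size V) ∧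
      ∀ P, T₀.Requires j (K.tri k) P → P ∈ M' := by
  have hG₁ := Grows.assign h (x := 4) (by decide) (by decide) (.half (.read 1 (.var 1)))
  set σ₁ : Store := { σ with
    var := Function.update σ.var 4 (Expr.eval σ (.half (.read 1 (.var 1)))) } with hσ₁
  have h4 : σ₁.var 4 = K.parent.code := by
    simp [hσ₁, Expr.eval, h1, Elem.code_half (show 0 < K.gen by omega)]
  have h1' : σ₁.arr 1 (σ₁.var 1) = K.code := by simp [hσ₁, h1]
  have h2' : σ₁.arr 2 (σ₁.var 1) = k := by simp [hσ₁, h2]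
  clear_value σ₁
  obtain ⟨b, hb⟩ := Elem.exists_eq_child (K := K) (by omega)
  have hgP : K.parent.gen + 1 = 2 * j := by rw [Elem.gen_parent]; omega
  have e2 : Expr.eval σ₁ (.read 2 (.var 1)) = k := h2'
  have ecost : ∀ a x, (Expr.read a (.var x)).cost = 2 := fun _ _ => rfl
  have fin : ∀ k : Fin 3, k = 0 ∨ k = 1 ∨ k = 2 := by decide
  rcases fin k with rfl | rfl | rfl
  · obtain ⟨M', σ', hG, hP⟩ := exists_grows_close hG₁.closing hB hB'
      (hreq K.parent ⟨K, 0, by omega, hK, rfl, rfl⟩) h4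
    refine ⟨M', σ', (hG₁.seq (Grows.cond_false (by rw [e2]; rfl) hG)).mono ?_, fun P hP' => ?_⟩
    · simp only [highCost, Expr.cost]; omega
    · rcases requires_zero hz hK rfl hP' with rfl | hn
      · exact hP
      · exact hG.closing.partner_mem hP hn
  · have hG₂ := Grows.assign hG₁.closing (x := 4) (by decide) (by decide) (.half (.var 4))
    obtain ⟨M', σ', hG, hP⟩ := exists_grows_close (p := K.parent.parent) hG₂.closing hB hB'
      (hreq _ ⟨K, 1, by omega, hK, rfl, rfl⟩)
      (by
        refine (Store.update_var_self _ _ _).trans ?_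
        rw [Expr.eval, Expr.eval, h4, Elem.code_half (by omega)])
    refine ⟨M', σ', (hG₁.seq (Grows.cond_true (by rw [e2]; decide)
      (Grows.cond_false (by simp only [Expr.eval, h2']; rfl) (hG₂.seq hG)))).mono ?_,
      fun P hP' => ?_⟩
    · simp only [highCost, Expr.cost]; omega
    · rcases requires_one hz hK rfl hP' with rfl | hn
      · exact hP
      · exact hG.closing.partner_mem hP hn
  · have hk : K.parent.tri (keep b) = K.tri 2 := by
      conv_rhs => rw [hb, tri_two_child]
    have hz' : K.parent.tri (keep b) ∈ T₀.domain := hk ▸ hz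
    obtain ⟨M', σ', hG, hP, -⟩ := exists_grows_walk (P := K.parent) (b := b) hG₁.closing hB hB'
      (by rw [← hb]; exact h1') h4 hz' (by omega)
      (fun t => hreq _ ⟨((walk b)^[t] K.parent).child b, 2, by omega, by
        rw [Elem.gen_child, (iterate_walk hz' (by omega) t).1]; omega, by
        rw [tri_two_child, (iterate_walk hz' (by omega) t).2, hk], rfl⟩) (List.range V)
    rw [List.length_range] at hG hP
    refine ⟨M', σ', (hG₁.seq (Grows.cond_true (by rw [e2]; decide)
      (Grows.cond_true (by simp only [Expr.eval, h2']; decide) hG))).mono ?_,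
      fun P hP' => ?_⟩
    · simp only [highCost, Expr.cost]; omega
    · obtain ⟨t, ht, hn⟩ := requires_two hz hj hgP hk hV hP'
      rcases hn with rfl | hn
      · exact hP t ht
      · exact hG.closing.partner_mem (hP t ht) hn

/-- An entry of the table for items of level one. -/
def entry (q : T₀.Elem × Fin 3 × T₀.Elem) : ℕ × ℕ × ℕ := (q.1.code, q.2.1, q.2.2.code)

/-- Processing an item of level one. -/
lemma exists_grows_lowItem (h : Closing B M [] σ) (hB : ParentClosed B) (hB' : PartnerClosed B)
    {K : T₀.Elem} {k : Fin 3} (l : List (T₀.Elem × Fin 3 × T₀.Elem))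
    (hl : ∀ P, (K, k, P) ∈ l → P ∈ B)
    (h1 : σ.arr 1 (σ.var 1) = K.code) (h2 : σ.arr 2 (σ.var 1) = k) :
    ∃ M' σ', Grows B (Prog.lowItem T₀.size (l.map entry)) M σ M' σ'
      (l.length * (Prog.closeCost T₀.size + 100) + 1) ∧ ∀ P, (K, k, P) ∈ l → P ∈ M' := by
  induction l with
  | nil => exact ⟨M, σ, ⟨h, List.Subset.refl M, 1, ⟨1, le_rfl, .skip σ⟩, by simp; omega⟩, by simp⟩
  | cons q l ih =>
    obtain ⟨M₁, σ₁, hG, hP⟩ := ih fun P hP => hl P (by simp [hP])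
    have hc1 : (Prog.close T₀.size).AvoidsVar 1 :=
      Prog.close_avoidsVar (by decide) (by decide) (by decide)
    have hc2 : ∀ n < 3, (Prog.close T₀.size).AvoidsArr n := fun n hn => Prog.close_avoidsArr hn
    have hv := hG.var_eq (x := 1) (Prog.forEach_avoidsVar fun _ =>
      ⟨trivial, trivial, (by decide : (4 : ℕ) ≠ 1), hc1⟩)
    have ha : ∀ n < 3, σ₁.arr n = σ.arr n := fun n hn =>
      hG.arr_eq (Prog.forEach_avoidsArr fun _ => ⟨trivial, trivial, trivial, hc2 n hn⟩)
    have e1 : Expr.eval σ₁ (.read 1 (.var 1)) = K.code := by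
      simp only [Expr.eval]; rw [hv, ha 1 (by decide), h1]
    have e2 : Expr.eval σ₁ (.read 2 (.var 1)) = k := by
      simp only [Expr.eval]; rw [hv, ha 2 (by decide), h2]
    have t1 := Prog.eval_differs (.read 1 (.var 1)) q.1.code σ₁
    have t2 := Prog.eval_differs (.read 2 (.var 1)) q.2.1 σ₁
    rw [e1] at t1
    rw [e2] at t2
    have skip : Grows B .skip M₁ σ₁ M₁ σ₁ 1 :=
      ⟨hG.closing, List.Subset.refl _, 1, ⟨1, le_rfl, .skip _⟩, by omega⟩
    by_cases hK : K = q.1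
    · by_cases hk : k = q.2.1
      · have hq : q = (K, k, q.2.2) := by rw [hK, hk]
        have hG₂ := Grows.assign hG.closing (x := 4) (by decide) (by decide) (.const q.2.2.code)
        obtain ⟨M', σ', hG₃, hp⟩ := exists_grows_close (p := q.2.2) hG₂.closing hB hB'
          (hl _ (by rw [← hq]; simp)) (Store.update_var_self _ _ _)
        refine ⟨M', σ', (hG.seq (Grows.cond_false (t1.2 (by rw [hK])) (Grows.cond_false
          (t2.2 (by rw [hk])) (hG₂.seq hG₃)))).mono ?_, fun P hP' => ?_⟩
        · simp only [List.length_cons, add_mul, Prog.differs, Expr.cost]; omega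
        · rcases List.mem_cons.1 hP' with he | hP'
          · rw [← he] at hp; exact hp
          · exact hG₃.subset (hP P hP')
      · refine ⟨M₁, σ₁, (hG.seq (Grows.cond_false (t1.2 (by rw [hK])) (Grows.cond_true
          (fun h => hk (Fin.ext (t2.1 h))) skip))).mono ?_, fun P hP' => ?_⟩
        · simp only [List.length_cons, add_mul, Prog.differs, Expr.cost]; omega
        · rcases List.mem_cons.1 hP' with he | hP'
          · exact absurd (by rw [← he]) hk
          · exact hP P hP'
    · refine ⟨M₁, σ₁, (hG.seq (Grows.cond_true
        (fun h => hK (Elem.code_inj.1 (t1.1 h))) skip)).mono ?_, fun P hP' => ?_⟩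
      · simp only [List.length_cons, add_mul, Prog.differs, Expr.cost]; omega
      · rcases List.mem_cons.1 hP' with he | hP'
        · exact absurd (by rw [← he]) hK
        · exact hP P hP'

lemma finite_gen_le (T₀ : InitialMesh) (g : ℕ) : {K : T₀.Elem | K.gen ≤ g}.Finite :=
  (Set.finite_univ.prod (List.finite_length_le Bool g)).subset fun _ h => ⟨trivial, h⟩

/-- The table of all elements that are required by the hat functions of level one. -/
lemma exists_table (T₀ : InitialMesh) : ∃ l : List (T₀.Elem × Fin 3 × T₀.Elem),
    ∀ K k P, (K, k, P) ∈ l ↔ K.gen = 2 ∧ T₀.Requires 1 (K.tri k) P := by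
  have hf : {q : T₀.Elem × Fin 3 × T₀.Elem |
      q.1.gen = 2 ∧ T₀.Requires 1 (q.1.tri q.2.1) q.2.2}.Finite := by
    refine ((finite_gen_le T₀ 2).prod (Set.finite_univ.prod (finite_gen_le T₀ 2))).subset ?_
    rintro ⟨K, k, P⟩ ⟨hK, L, l, -, hL, -, hP⟩
    refine ⟨hK.le, trivial, ?_⟩
    simp only at hP
    subst hP
    simp only [Set.mem_ofPred_eq]
    split_ifs <;> simp only [Elem.gen_parent] <;> omega
  exact ⟨hf.toFinset.toList, fun K k P => by simp⟩

/-- The number of operations for one item, apart from those that are paid for by bisected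
elements. -/
def itemCost (m V n : ℕ) : ℕ := highCost m V + (n * (Prog.closeCost m + 100) + 1) + 100

/-- Processing one item of the input. -/
lemma exists_grows_item (h : Closing B M [] σ) (hB : ParentClosed B) (hB' : PartnerClosed B)
    {V : ℕ} (hV : ∀ (g : ℕ) (z : Pt) (S : Finset T₀.Elem),
      (∀ L ∈ S, L.gen = g ∧ z ∈ L.tri.body) → S.card ≤ V)
    {l : List (T₀.Elem × Fin 3 × T₀.Elem)}
    (hl : ∀ K k P, (K, k, P) ∈ l ↔ K.gen = 2 ∧ T₀.Requires 1 (K.tri k) P)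
    {i : T₀.FrameIndex} (hreq : ∀ P, T₀.Requires i.level i.node P → P ∈ B)
    (hi : T₀.Represents i (σ.arr 0 (σ.var 1), σ.arr 1 (σ.var 1), σ.arr 2 (σ.var 1))) :
    ∃ M' σ', Grows B (Prog.item T₀.size V (l.map entry)) M σ M' σ'
      (itemCost T₀.size V l.length) ∧ ∀ P, T₀.Requires i.level i.node P → P ∈ M' := by
  obtain ⟨h0, K, hK, k, hk, h1, h2⟩ := hi
  simp only at h0 h1 h2
  rw [mem_uniform] at hK
  have hz := i.mem.1
  rw [← hk] at hreq hz ⊢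
  have e0 : Expr.eval σ (.read 0 (.var 1)) = i.level := h0
  rcases Nat.lt_trichotomy i.level 1 with hj | hj | hj
  · refine ⟨M, σ, (Grows.cond_false (by rw [e0]; omega) (b := 1)
      ⟨h, List.Subset.refl _, 1, ⟨1, le_rfl, .skip _⟩, by omega⟩).mono ?_, ?_⟩
    · simp only [itemCost, Expr.cost]; omega
    · rintro P ⟨-, -, hj', -⟩; omega
  · rw [hj] at hreq hK ⊢
    obtain ⟨M', σ', hG, hP⟩ := exists_grows_lowItem (K := K) (k := k) h hB hB' l
      (fun P hP => hreq P ((hl K k P).1 hP).2) h1 h2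
    refine ⟨M', σ', (Grows.cond_true (by rw [e0, hj]; decide) (Grows.cond_false
      (by simp only [Expr.eval]; rw [h0, hj]) hG)).mono ?_,
      fun P hP' => hP P ((hl K k P).2 ⟨by omega, hP'⟩)⟩
    simp only [itemCost, Expr.cost]; omega
  · obtain ⟨M', σ', hG, hP⟩ := exists_grows_highItem h hB hB' hV hj hK hz hreq h1 h2
    refine ⟨M', σ', (Grows.cond_true (by rw [e0]; omega) (Grows.cond_true
      (by simp only [Expr.eval]; rw [h0]; omega) hG)).mono ?_, hP⟩
    simp only [itemCost, Expr.cost]; omega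

end InitialMesh

/-! ### The complete program -/

namespace Prog

/-- Store the neighbours of one element: `q` consists of its number and the numbers of its
neighbours opposite the vertices `0` and `1`. -/
def tabulate (q : ℕ × ℕ × ℕ) : Prog :=
  seq (write 4 (.const q.1) (.const q.2.1)) (write 5 (.const q.1) (.const q.2.2))

/-- Processing the input. -/
def processInput (m V : ℕ) (table : List (ℕ × ℕ × ℕ)) : Prog :=
  loop (.sub (.var 0) (.var 1)) (seq (item m V table) (assign 1 (.add (.var 1) (.const 1))))

/-- Write the element with number `e` to the output if it is not bisected. -/
def emit (e : Expr) : Prog :=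
  cond (.read 3 e) skip (seq (write 0 (.var 0) e) (assign 0 (.add (.var 0) (.const 1))))

/-- Write the children of the element at position `var 7` of the list of bisected elements to the
output. -/
def emitChildren : Prog :=
  seq (emit (.add (.read 7 (.var 7)) (.read 7 (.var 7))))
    (seq (emit (.add (.add (.read 7 (.var 7)) (.read 7 (.var 7))) (.const 1)))
      (assign 7 (.add (.var 7) (.const 1))))

/-- Output of the elements that are not bisected among the roots and the children of the bisected
elements. -/
def output (roots : List ℕ) : Prog :=
  seq (assign 0 (.const 0)) (seq (forEach roots fun n => emit (.const n))
    (loop (.sub (.var 3) (.var 7)) emitChildren))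

lemma emit_loopFree (e : Expr) : (emit e).LoopFree := ⟨trivial, trivial, trivial⟩

lemma emit_avoidsVar {n : ℕ} (h : n ≠ 0) (e : Expr) : (emit e).AvoidsVar n :=
  ⟨trivial, trivial, h.symm⟩

lemma emit_avoidsArr {n : ℕ} (h : n ≠ 0) (e : Expr) : (emit e).AvoidsArr n :=
  ⟨trivial, h.symm, trivial⟩

lemma emitChildren_loopFree : emitChildren.LoopFree :=
  ⟨emit_loopFree _, emit_loopFree _, trivial⟩

end Prog

namespace InitialMesh

variable {T₀ : InitialMesh}

section Initialization

lemma tabulate_loopFree (l : List (ℕ × ℕ × ℕ)) : (Prog.forEach l Prog.tabulate).LoopFree :=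
  Prog.forEach_loopFree fun _ => ⟨trivial, trivial⟩

lemma tabulate_effect (l : List T₀.Elem) (σ : Store) {K : T₀.Elem} (hK : K ∈ l) :
    ((Prog.forEach (l.map fun K => (K.code, K.nbrCode 0, K.nbrCode 1)) Prog.tabulate).effect
        σ).arr 4 K.code = K.nbrCode 0 ∧
      ((Prog.forEach (l.map fun K => (K.code, K.nbrCode 0, K.nbrCode 1)) Prog.tabulate).effect
        σ).arr 5 K.code = K.nbrCode 1 := by
  induction l with
  | nil => simp at hK
  | cons L l ih =>
    rw [List.map_cons, show ∀ q l, Prog.forEach (q :: l) Prog.tabulate =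
      .seq (Prog.forEach l Prog.tabulate) (Prog.tabulate q) from fun _ _ => rfl]
    simp only [Prog.effect, Prog.tabulate, Expr.eval]
    by_cases h : K = L
    · subst h; simp
    · have hne : K.code ≠ L.code := fun hc => h (Elem.code_inj.1 hc)
      have := ih ((List.mem_cons.1 hK).resolve_left h)
      simpa [Function.update_of_ne hne] using this

/-- After the tabulation of the neighbours in the first generations, no element is bisected. -/
lemma closing_tabulate {B : Finset T₀.Elem} {l : List T₀.Elem} (hl : ∀ K, K ∈ l ↔ K.gen ≤ 2)
    (L : List (ℕ × ℕ × ℕ)) :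
    Closing B [] [] ((Prog.forEach (l.map fun K => (K.code, K.nbrCode 0, K.nbrCode 1))
      Prog.tabulate).effect (inputStore L)) where
  core :=
    { mark := fun K => by
        rw [Prog.effect_arr_eq (tabulate_loopFree _) (Prog.forEach_avoidsArr fun _ =>
          ⟨(by decide : (4 : ℕ) ≠ 3), (by decide : (5 : ℕ) ≠ 3)⟩)]
        simp [inputStore]
      nodup := List.nodup_nil
      parent := by simp
      holds := trivial
      length := by
        rw [Prog.effect_var_eq (tabulate_loopFree _) (Prog.forEach_avoidsVar fun _ =>
          ⟨trivial, trivial⟩)]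
        simp [inputStore]
      nbr_zero := fun K hK => (tabulate_effect l _ ((hl K).2 (by simpa using hK))).1
      nbr_one := fun K _ hK => (tabulate_effect l _ ((hl K).2 (by
        rcases hK with h | h
        · exact h.le
        · simp at h))).2 }
  subset := by simp
  stack_subset := by simp
  stack_holds := trivial
  stack_length := by
    rw [Prog.effect_var_eq (tabulate_loopFree _) (Prog.forEach_avoidsVar fun _ =>
      ⟨trivial, trivial⟩)]
    simp [inputStore]
  sorted := List.Pairwise.nil
  partner := by simp

end Initialization

section Input

variable {B : Finset T₀.Elem} {M : List T₀.Elem} {σ : Store}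

/-- Processing the input: for each item, a bounded number of operations is not paid for by bisected
elements. -/
lemma exists_grows_processInput (hB : ParentClosed B)
    (hB' : PartnerClosed B) {V : ℕ} (hV : ∀ (g : ℕ) (z : Pt) (S : Finset T₀.Elem),
      (∀ L ∈ S, L.gen = g ∧ z ∈ L.tri.body) → S.card ≤ V)
    {table : List (T₀.Elem × Fin 3 × T₀.Elem)}
    (ht : ∀ K k P, (K, k, P) ∈ table ↔ K.gen = 2 ∧ T₀.Requires 1 (K.tri k) P)
    {l : List T₀.FrameIndex} {L : List (ℕ × ℕ × ℕ)} (hL : List.Forall₂ T₀.Represents l L)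
    (h : Closing B M [] σ) (hreq : ∀ i ∈ l, ∀ P, T₀.Requires i.level i.node P → P ∈ B)
    (hn : σ.var 0 - σ.var 1 = L.length)
    (hin : ∀ (k : ℕ) (hk : k < L.length),
      (σ.arr 0 (σ.var 1 + k), σ.arr 1 (σ.var 1 + k), σ.arr 2 (σ.var 1 + k)) = L[k]) :
    ∃ M' σ', Grows B (Prog.processInput T₀.size V (table.map entry)) M σ M' σ'
      (L.length * (itemCost T₀.size V table.length + 8) + 4) ∧
      ∀ i ∈ l, ∀ P, T₀.Requires i.level i.node P → P ∈ M' := by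
  induction hL generalizing M σ with
  | nil =>
    exact ⟨M, σ, ⟨h, List.Subset.refl M, 4, ⟨4, le_rfl, .loop_false hn⟩, by simp; omega⟩,
      by simp⟩
  | @cons i q l L hi _ ih =>
    have hin0 := hin 0 (by simp)
    simp only [add_zero, List.getElem_cons_zero] at hin0
    obtain ⟨M₁, σ₁, hG, hP⟩ := exists_grows_item h hB hB' hV ht (hreq i (by simp))
      (by rw [hin0]; exact hi)
    have hG' := hG.seq (Grows.assign hG.closing (x := 1) (by decide) (by decide)
      (.add (.var 1) (.const 1)))
    set σ₂ : Store := { σ₁ with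
      var := Function.update σ₁.var 1 (Expr.eval σ₁ (.add (.var 1) (.const 1))) } with hσ₂
    have e1 : σ₁.var 1 = σ.var 1 := hG.var_eq (Prog.item_avoidsVar (by decide) (by decide)
      (by decide) (by decide))
    have v0 : σ₂.var 0 = σ.var 0 := by
      rw [← hG.var_eq (x := 0) (Prog.item_avoidsVar (by decide) (by decide) (by decide)
        (by decide))]
      simp [hσ₂]
    have v1 : σ₂.var 1 = σ.var 1 + 1 := by simp [hσ₂, Expr.eval, e1]
    have ha : ∀ n < 3, σ₂.arr n = σ.arr n := fun n hn =>
      hG.arr_eq (Prog.item_avoidsArr hn)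
    clear_value σ₂
    rw [List.length_cons] at hn
    obtain ⟨M', σ', hG₂, hP₂⟩ := ih hG'.closing (fun i hi => hreq i (by simp [hi]))
      (by rw [v0, v1]; omega) fun k hk => by
        rw [v1, ha 0 (by decide), ha 1 (by decide), ha 2 (by decide), add_assoc, add_comm 1 k]
        exact hin (k + 1) (by simpa using hk)
    obtain ⟨T₁, r₁, l₁⟩ := hG'.runs
    obtain ⟨T₂, r₂, l₂⟩ := hG₂.runs
    obtain ⟨t₁, r₁, x₁⟩ := r₁
    obtain ⟨t₂, r₂, x₂⟩ := r₂
    refine ⟨M', σ', ⟨hG₂.closing, List.Subset.trans hG'.subset hG₂.subset, _, ⟨_, le_rfl,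
      .loop_true (by simp only [Expr.eval]; omega) x₁ x₂⟩, ?_⟩, fun j hj P hP' => ?_⟩
    · simp only [List.length_cons, add_mul, Expr.cost] at l₁ l₂ ⊢
      omega
    · rcases List.mem_cons.1 hj with rfl | hj
      · exact hG₂.subset (hP P hP')
      · exact hP₂ j hj P hP'

end Input

section Output

variable {M xs : List T₀.Elem} {σ : Store}

/-- The elements of `xs` that do not belong to `M` have been written to the output. -/
structure Emitted (M xs : List T₀.Elem) (σ : Store) : Prop where
  mark : ∀ K : T₀.Elem, σ.arr 3 K.code = if K ∈ M then 1 else 0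
  holds : Holds (σ.arr 0) (xs.filter (· ∉ M))
  length : σ.var 0 = (xs.filter (· ∉ M)).length

lemma Emitted.emit (h : Emitted M xs σ) {e : Expr} {K : T₀.Elem} (he : e.eval σ = K.code) :
    Emitted M (K :: xs) ((Prog.emit e).effect σ) := by
  have hm : Expr.eval σ (.read 3 e) = if K ∈ M then 1 else 0 := by
    rw [← h.mark, ← he]; rfl
  by_cases hK : K ∈ M
  · rw [Prog.emit, Prog.effect_cond_pos]
    swap
    · rw [hm]; simp [hK]
    have hf : (K :: xs).filter (· ∉ M) = xs.filter (· ∉ M) := by simp [hK]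
    exact ⟨h.mark, by rw [hf]; exact h.holds, by rw [hf]; exact h.length⟩
  · rw [Prog.emit, Prog.effect_cond_neg]
    swap
    · rw [hm]; simp [hK]
    have hf : (K :: xs).filter (· ∉ M) = K :: xs.filter (· ∉ M) := by simp [hK]
    refine ⟨fun L => ?_, ?_, ?_⟩
    · rw [← h.mark L]; simp [Prog.effect]
    · rw [hf]
      simp only [Prog.effect, Function.update_self, Expr.eval, he, h.length]
      exact h.holds.cons K
    · rw [hf]
      simp [Prog.effect, Expr.eval, h.length]

lemma Emitted.forEach (h : Emitted M [] σ) (l : List T₀.Elem) :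
    Emitted M l ((Prog.forEach (l.map Elem.code) fun n => Prog.emit (.const n)).effect σ) := by
  induction l with
  | nil => exact h
  | cons K l ih => exact ih.emit rfl

/-- The children of an element. -/
def Elem.children (K : T₀.Elem) : List T₀.Elem := [K.child true, K.child false]

lemma Emitted.emitChildren (h : Emitted M xs σ) {K : T₀.Elem}
    (hK : σ.arr 7 (σ.var 7) = K.code) :
    Emitted M (K.children ++ xs) (Prog.emitChildren.effect σ) := by
  have h1 := h.emit (e := .add (.read 7 (.var 7)) (.read 7 (.var 7))) (K := K.child false)
    (by simp only [Expr.eval]; rw [hK, code_child_false])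
  set σ₁ := (Prog.emit (.add (.read 7 (.var 7)) (.read 7 (.var 7)))).effect σ with hσ₁
  have e7 : σ₁.arr 7 (σ₁.var 7) = K.code := by
    rw [hσ₁, Prog.effect_arr_eq (Prog.emit_loopFree _) (Prog.emit_avoidsArr (by decide) _),
      Prog.effect_var_eq (Prog.emit_loopFree _) (Prog.emit_avoidsVar (by decide) _), hK]
  have h2 := h1.emit (e := .add (.add (.read 7 (.var 7)) (.read 7 (.var 7))) (.const 1))
    (K := K.child true) (by simp only [Expr.eval]; rw [e7, code_child_true])
  exact ⟨h2.mark, h2.holds, (Prog.effect_var_eq (c := .assign 7 (.add (.var 7) (.const 1)))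
    trivial (by decide : (7 : ℕ) ≠ 0) _).trans h2.length⟩

lemma emitChildren_var_seven : (Prog.emitChildren.effect σ).var 7 = σ.var 7 + 1 := by
  refine (Store.update_var_self _ _ _).trans ?_
  simp only [Expr.eval]
  rw [Prog.effect_var_eq (Prog.emit_loopFree _) (Prog.emit_avoidsVar (by decide) _),
    Prog.effect_var_eq (Prog.emit_loopFree _) (Prog.emit_avoidsVar (by decide) _)]

lemma Holds.apply_length {f : ℕ → ℕ} {A D : List T₀.Elem} {K : T₀.Elem}
    (h : Holds f (A ++ K :: D)) : f D.length = K.code := by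
  induction A with
  | nil => exact h.1
  | cons L A ih => exact ih h.2

lemma Holds.getElem_reverse {f : ℕ → ℕ} {l : List T₀.Elem} (h : Holds f l) {k : ℕ}
    (hk : k < l.reverse.length) : f k = l.reverse[k].code := by
  have hk' : k < l.length := by simpa using hk
  obtain ⟨A, D, K, hl, hD⟩ : ∃ A D K, l = A ++ K :: D ∧ D.length = k := by
    refine ⟨l.take (l.length - 1 - k), l.drop (l.length - k), l[l.length - 1 - k], ?_, ?_⟩
    · conv_lhs => rw [← List.take_append_drop (l.length - 1 - k) l]
      rw [List.drop_eq_getElem_cons (by omega), show l.length - 1 - k + 1 = l.length - k by omega]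
    · rw [List.length_drop]; omega
  subst hl hD
  rw [h.apply_length]
  simp

/-- The number of operations for the output of the mesh, apart from a bounded number for each
bisected element. -/
def outputCost (roots : List ℕ) : ℕ :=
  6 + (Prog.forEach roots fun n => Prog.emit (.const n)).maxCost

/-- The output phase. -/
lemma exists_runs_output (h : Core M σ) (h7 : σ.var 7 = 0) (roots : List T₀.Elem) :
    ∃ σ', (Prog.output (roots.map Elem.code)).Runs σ σ'
        (M.length * (4 + Prog.emitChildren.maxCost) + outputCost (roots.map Elem.code)) ∧
      Emitted M (M.flatMap Elem.children ++ roots) σ' := by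
  set σ₀ : Store := { σ with var := Function.update σ.var 0 0 } with hσ₀
  have h₀ : Emitted M [] σ₀ := ⟨h.mark, trivial, by simp [hσ₀]⟩
  set p := Prog.forEach (roots.map Elem.code) fun n => Prog.emit (.const n) with hp
  have hpl : p.LoopFree := Prog.forEach_loopFree fun _ => Prog.emit_loopFree _
  have h₁ := h₀.forEach roots
  rw [← hp] at h₁
  have keepv : ∀ n ≠ 0, (p.effect σ₀).var n = σ₀.var n := fun n hn =>
    Prog.effect_var_eq hpl (Prog.forEach_avoidsVar fun _ => Prog.emit_avoidsVar hn _) _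
  have keepa : ∀ n ≠ 0, (p.effect σ₀).arr n = σ₀.arr n := fun n hn =>
    Prog.effect_arr_eq hpl (Prog.forEach_avoidsArr fun _ => Prog.emit_avoidsArr hn _) _
  obtain ⟨n', -, σ', hr, ⟨A, D, hM, hA, hE, h7', h3', -⟩, he⟩ := Prog.runs_loop
    (e := .sub (.var 3) (.var 7)) (c := Prog.emitChildren) (T := Prog.emitChildren.maxCost)
    (fun n τ => ∃ A D, M = A ++ D ∧ A.length = n ∧
      Emitted M (D.flatMap Elem.children ++ roots) τ ∧ τ.var 7 = D.length ∧
      τ.var 3 = M.length ∧ Holds (τ.arr 7) M)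
    (by
      rintro n τ ⟨A, D, hM, rfl, hE, h7', h3', hH⟩ he
      rcases List.eq_nil_or_concat A with rfl | ⟨A, K, rfl⟩
      · refine absurd ?_ he
        simp only [Expr.eval]
        rw [h7', h3', hM]; simp
      · rw [List.concat_eq_append, List.append_assoc, List.singleton_append] at hM
        refine ⟨A.length, by simp, _, Prog.runs_effect Prog.emitChildren_loopFree τ, A, K :: D, hM,
          rfl, ?_, ?_, ?_, ?_⟩
        · rw [List.flatMap_cons, List.append_assoc]
          refine hE.emitChildren ?_
          rw [hM] at hH
          rw [h7']
          exact hH.apply_length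
        · rw [emitChildren_var_seven, h7']; rfl
        · rw [Prog.effect_var_eq Prog.emitChildren_loopFree ⟨Prog.emit_avoidsVar (by decide) _,
            Prog.emit_avoidsVar (by decide) _, (by decide : (7 : ℕ) ≠ 3)⟩, h3']
        · rw [Prog.effect_arr_eq Prog.emitChildren_loopFree ⟨Prog.emit_avoidsArr (by decide) _,
            Prog.emit_avoidsArr (by decide) _, trivial⟩]
          exact hH)
    M.length (p.effect σ₀) ⟨M, [], by simp, rfl, h₁, by
      rw [keepv 7 (by decide)]; simpa [hσ₀] using h7, by
      rw [keepv 3 (by decide)]; simpa [hσ₀] using h.length, by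
      rw [keepa 7 (by decide)]; exact h.holds⟩
  have hA0 : A = [] := by
    simp only [Expr.eval] at he
    rw [h7', h3', hM, List.length_append] at he
    exact List.length_eq_zero_iff.1 (by omega)
  rw [hA0, List.nil_append] at hM
  subst hM
  refine ⟨σ', (Prog.Runs.seq (σ₁ := σ₀) ⟨2, le_rfl, Exec.assign σ 0 (.const 0)⟩
    (Prog.Runs.seq (Prog.runs_effect hpl σ₀) hr)).mono ?_, hE⟩
  have : (M.length - n') * (1 + 1 + 1 + 1 + Prog.emitChildren.maxCost) ≤
      M.length * (4 + Prog.emitChildren.maxCost) := Nat.mul_le_mul (Nat.sub_le _ _) le_rfl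
  simp only [outputCost, ← hp, Expr.cost] at this ⊢
  omega

lemma isOutput_of_emitted (hM : M.Nodup) (h : Emitted M (M.flatMap Elem.children ++ xs) σ)
    (hxs : xs.Nodup) (hxs' : ∀ K, K ∈ xs ↔ K.gen = 0) :
    T₀.IsOutput (leaves M.toFinset) σ := by
  set l := (M.flatMap Elem.children ++ xs).filter (· ∉ M) with hl
  have hmem : ∀ K, K ∈ M.flatMap Elem.children ↔ ∃ P ∈ M, ∃ b, K = P.child b := fun K => by
    simp [Elem.children, Bool.exists_bool, or_comm]
  have hnod : (M.flatMap Elem.children).Nodup := by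
    refine List.nodup_flatMap.2 ⟨fun K _ => by simp [Elem.children, Elem.child_inj], ?_⟩
    refine hM.imp fun {K L} hKL X hX hX' => hKL ?_
    simp only [Elem.children, List.mem_cons, List.not_mem_nil, or_false] at hX hX'
    rcases hX with rfl | rfl <;> rcases hX' with hX' | hX' <;> exact (Elem.child_inj.1 hX').1
  have hl' : l.Nodup := by
    refine (List.nodup_append'.2 ⟨hnod, hxs, fun K hK hK' => ?_⟩).filter _
    obtain ⟨P, -, b, rfl⟩ := (hmem K).1 hK
    simpa using (hxs' _).1 hK'
  refine ⟨l.reverse, List.nodup_reverse.2 hl', fun K => ?_, by rw [h.length, List.length_reverse],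
    fun k hk => h.holds.getElem_reverse hk⟩
  rw [List.mem_reverse, hl, List.mem_filter, List.mem_append, hmem, hxs', mem_leaves]
  simp [or_comm]

end Output

end InitialMesh

namespace InitialMesh

/-- The program that computes the smallest conforming mesh. -/
def meshProg (m V : ℕ) (nbrs table : List (ℕ × ℕ × ℕ)) (roots : List ℕ) : Prog :=
  .seq (Prog.forEach nbrs Prog.tabulate)
    (.seq (Prog.processInput m V table) (Prog.output roots))

lemma processInput_avoidsVar_seven (m V : ℕ) (table : List (ℕ × ℕ × ℕ)) :
    (Prog.processInput m V table).AvoidsVar 7 :=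
  ⟨Prog.item_avoidsVar (by decide) (by decide) (by decide) (by decide),
    (by decide : (1 : ℕ) ≠ 7)⟩

/-- Correctness of the program. The cost is bounded in terms of the numbers of items and of
bisected elements. -/
lemma exists_runs_meshProg (T₀ : InitialMesh) :
    ∃ (p : Prog) (c : ℕ), ∀ (Θ : Finset T₀.FrameIndex) (B : Finset T₀.Elem),
      (∀ K, K ∈ B ↔ Needed (T₀.Required Θ) K) → ∀ L, T₀.IsInput Θ L →
      ∃ σ T, p.Runs (inputStore L) σ T ∧ T ≤ c * (Θ.card + B.card + 1) ∧
        T₀.IsOutput (leaves B) σ := by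
  classical
  obtain ⟨V, hV⟩ := exists_valence_bound T₀
  obtain ⟨table, ht⟩ := exists_table T₀
  obtain ⟨small, hs⟩ : ∃ l : List T₀.Elem, ∀ K, K ∈ l ↔ K.gen ≤ 2 :=
    ⟨(finite_gen_le T₀ 2).toFinset.toList, fun K => by simp⟩
  set nbrs := small.map fun K => (K.code, K.nbrCode 0, K.nbrCode 1) with hnbrs
  set roots := T₀.initial.toList.map Elem.code with hroots
  refine ⟨meshProg T₀.size V nbrs (table.map entry) roots,
    (Prog.forEach nbrs Prog.tabulate).maxCost + (itemCost T₀.size V table.length + 8) + 4 +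
    Prog.closeCost T₀.size + (4 + Prog.emitChildren.maxCost) + outputCost roots,
    fun Θ B hBN L hL => ?_⟩
  have hB := parentClosed_of_needed hBN
  have hB' := partnerClosed_of_needed hBN
  obtain ⟨l, hln, hlΘ, hlL⟩ := hL
  have hlen : L.length = Θ.card := by
    rw [← hlL.length_eq, ← List.toFinset_card_of_nodup hln]
    congr 1
    ext i
    rw [List.mem_toFinset, hlΘ]
  have hC : Closing B [] [] ((Prog.forEach nbrs Prog.tabulate).effect (inputStore L)) :=
    closing_tabulate hs L
  have hr := Prog.runs_effect (tabulate_loopFree nbrs) (inputStore L)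
  set σ₁ := (Prog.forEach nbrs Prog.tabulate).effect (inputStore L) with hσ₁
  have hv : ∀ n, σ₁.var n = (inputStore L).var n := fun n =>
    hr.var_eq (Prog.forEach_avoidsVar fun _ => ⟨trivial, trivial⟩)
  have ha : ∀ n < 4, σ₁.arr n = (inputStore L).arr n := fun n hn =>
    hr.arr_eq (Prog.forEach_avoidsArr fun _ => ⟨(by omega : 4 ≠ n), (by omega : 5 ≠ n)⟩)
  obtain ⟨M, σ₂, hG, hM⟩ := exists_grows_processInput hB hB' hV ht hlL hC
    (fun i hi P hP => (hBN P).2 (.base ⟨i, (hlΘ i).1 hi, hP⟩))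
    (by rw [hv, hv]; simp [inputStore])
    (fun k hk => by
      rw [hv, ha 0 (by decide), ha 1 (by decide), ha 2 (by decide)]
      simp [inputStore, hk])
  obtain ⟨T₂, r₂, l₂⟩ := hG.runs
  obtain ⟨σ', r₃, hE⟩ := exists_runs_output hG.closing.core
    (by rw [r₂.var_eq (processInput_avoidsVar_seven _ _ _), hv]; rfl) T₀.initial.toList
  have hMB : M.toFinset = B := by
    refine Finset.Subset.antisymm (fun K hK => hG.closing.subset K (List.mem_toFinset.1 hK))
      fun K hK => needed_subset (fun K b hK => ?_) (fun K hK L hL => ?_) ?_ ((hBN K).1 hK)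
    · exact List.mem_toFinset.2 (hG.closing.core.parent K b (List.mem_toFinset.1 hK))
    · exact List.mem_toFinset.2 (hG.closing.partner_mem (List.mem_toFinset.1 hK) hL)
    · rintro P ⟨i, hi, hP⟩
      exact List.mem_toFinset.2 (hM i ((hlΘ i).2 hi) P hP)
  have hMc : M.length = B.card := by
    rw [← hMB, List.toFinset_card_of_nodup hG.closing.core.nodup]
  refine ⟨σ', _, hr.seq (r₂.seq r₃), ?_, ?_⟩
  · rw [hMc, hlen, List.length_nil, mul_zero, add_zero] at l₂
    rw [hMc, ← hroots]
    set a₁ := (Prog.forEach nbrs Prog.tabulate).maxCost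
    set a₂ := itemCost T₀.size V table.length + 8
    set a₃ := Prog.closeCost T₀.size
    set a₄ := 4 + Prog.emitChildren.maxCost
    set a₅ := outputCost roots
    set s := Θ.card + B.card + 1 with hs
    have m₁ : a₁ ≤ a₁ * s := Nat.le_mul_of_pos_right _ (by omega)
    have m₂ : Θ.card * a₂ ≤ a₂ * s := by rw [mul_comm]; exact Nat.mul_le_mul_left _ (by omega)
    have m₃ : a₃ * B.card ≤ a₃ * s := Nat.mul_le_mul_left _ (by omega)
    have m₄ : B.card * a₄ ≤ a₄ * s := by rw [mul_comm]; exact Nat.mul_le_mul_left _ (by omega)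
    have m₅ : a₅ ≤ a₅ * s := Nat.le_mul_of_pos_right _ (by omega)
    have e : (a₁ + a₂ + 4 + a₃ + a₄ + a₅) * s =
        a₁ * s + a₂ * s + 4 * s + a₃ * s + a₄ * s + a₅ * s := by ring
    rw [e]
    omega
  · rw [← hMB]
    exact isOutput_of_emitted hG.closing.core.nodup hE (Finset.nodup_toList _) fun K => by simp

end InitialMesh

theorem mainTheorem7 (T₀ : InitialMesh) :
    ∃ (C : ℕ) (mesh : Prog),
      ∀ (M : Type*) (parent : T₀.FrameIndex → T₀.FrameIndex)
        (Λ : Finset ((M →₀ ℕ) × T₀.FrameIndex)), T₀.IsTree parent Λ →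
      ∀ ν : M →₀ ℕ, (∃ i, (ν, i) ∈ Λ) →
      ∃ T : Finset T₀.Elem,
        T₀.IsSmallestMesh T (T₀.slice Λ ν) ∧
        T.card ≤ C * (T₀.slice Λ ν).card ∧
        ∀ L : List (ℕ × ℕ × ℕ), T₀.IsInput (T₀.slice Λ ν) L →
          ∃ (σ : Store) (t : ℕ), Exec mesh (inputStore L) σ t ∧
            t ≤ C * (T₀.slice Λ ν).card ∧ T₀.IsOutput T σ := by

  obtain ⟨p, c, hc⟩ := InitialMesh.exists_runs_meshProg T₀
  obtain ⟨N, hN⟩ := InitialMesh.exists_card_needed_le T₀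
  -- at most `N` elements are bisected per frame element, and the mesh has at most `size` elements
  -- more than twice the number of bisected elements
  refine ⟨T₀.size + 2 * N + c * (N + 2), p, fun M parent Λ hΛ ν ⟨i, hi⟩ => ?_⟩
  have hmem : ∀ i, i ∈ T₀.slice Λ ν ↔ (ν, i) ∈ Λ := fun i => by simp [InitialMesh.slice]
  obtain ⟨B, hB, hcard⟩ := hN (T₀.slice Λ ν) fun i hi h0 => by
    obtain ⟨h1, h2⟩ := hΛ ν i ((hmem i).1 hi) h0
    exact ⟨parent i, (hmem _).2 h1, h2⟩
  have hpos : 1 ≤ (T₀.slice Λ ν).card := Finset.card_pos.2 ⟨i, (hmem i).2 hi⟩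
  set n := (T₀.slice Λ ν).card with hn
  have e : (T₀.size + 2 * N + c * (N + 2)) * n = T₀.size * n + 2 * (N * n) + c * ((N + 2) * n) := by
    ring
  refine ⟨InitialMesh.leaves B, InitialMesh.isSmallestMesh_leaves hB, ?_, fun L hL => ?_⟩
  · have h1 := InitialMesh.card_leaves_le B
    have h2 : T₀.size ≤ T₀.size * n := Nat.le_mul_of_pos_right _ hpos
    rw [e]
    omega
  · obtain ⟨σ, T, ⟨t, htT, hE⟩, hT, hO⟩ := hc _ B hB L hL
    refine ⟨σ, t, hE, ?_, hO⟩
    have h1 : c * ((T₀.slice Λ ν).card + B.card + 1) ≤ c * ((N + 2) * n) :=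
      Nat.mul_le_mul_left c (by rw [add_mul]; omega)
    rw [e]
    omega
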